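/- \textbf{Setting.} Let $d\ge 1$. A classification problem is a pair $(\eta,\mathbb P_X)$ with $\eta:\mathbb R^d\to[0,1]$ and $\mathbb P_X$ a probability carried by $[0,1]^d$; $X\sim\mathbb P_X$ and $Y\in\{0,1\}$ is Bernoulli$(\eta(x))$ given $X=x$. For a classifier $f$ let $R(f)=\mathbb P(Y\ne f(X))$, $f^*=\mathbf 1\{\eta\ge 1/2\}$ and $\mathcal E(f)=R(f)-R(f^*)$. For $\alpha>0$, $\beta,\Delta_0,c_3\ge 0$, $\lambda\ge 1$, the class $\mathcal P(\alpha,\beta,\Delta_0)=\mathcal P(\alpha,\beta,\Delta_0;\lambda,c_3)$ consists of the problems such that (i) $\eta$ is $(\lambda,\alpha)$-Hölder: if $\alpha\le1$, $|\eta(x)-\eta(y)|\le\lambda|x-y|_2^\alpha$ for all $x,y\in\mathbb R^d$; if $\alpha>1$, $\eta\in C^{\lfloor\alpha\rfloor}(\mathbb R^d)$, $\sum_{|s|=j}|D^s\eta(x)|\le\lambda$ for all $x$ and all integers $0\le j\le\alpha$, and $\sum_{|s|=\lfloor\alpha\rfloor}|D^s\eta(x)-D^s\eta(y)|\le\lambda|x-y|_2^{\alpha-\lfloor\alpha\rfloor}$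 for all $x,y$; (ii) $\mathbb P_X(|\eta(X)-1/2|<\Delta_0)=0$ and $\mathbb P_X(|\eta(X)-1/2|\le\Delta_0+\Delta)\le c_3\Delta^\beta$ for all $\Delta>0$. The learner may request, at any point $x\in\mathbb R^d$, an independent label with law Bernoulli$(\eta(x))$. \textbf{Grid.} $G_l$ is the partition of $[0,1]^d$ into $2^{ld}$ dyadic cells of side $2^{-l}$; $x_C$ is the center of a cell $C$ and, for $C\in G_l$, $\tilde C$ is the set of points at sup-norm distance at most $2^{-l}$ from $C$. Put $b_{l,\alpha}=\lambda d^{(\alpha\wedge1)/2}2^{-l\alpha}$, $\delta_{l,\alpha}=\delta2^{-l(d+1)(\alpha\vee1)}$, $t_{l,\alpha}=\big\lceil\frac{\log(1/\delta_{l,\alpha})}{2b_{l,\alpha}^2}\big\rceil$ if $\alpha\le1$ and $t_{l,\alpha}=\big\lceil4^{2d+1}(\alpha+1)^{2d}\frac{\log(1/\delta_{l,\alpha})}{b_{l,\alpha}^2}\big\rceil$ if $\alpha>1$, and $B_{l,\alpha}=2\Big[\sqrt{\frac{\log(1/\delta_{l,\alpha\wedge1})}{2t_{l,\alpha\wedge1}}}+b_{l,\alpha\wedge1}\Big]$.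 \textbf{Subroutine with input $(n,\delta,\alpha,\lambda)$, $n$ real.} Start with $l=1$, $\mathcal A_1=G_1$ (and $\mathcal A_0=\emptyset$), $S^0=S^1=\emptyset$, $t=2^dt_{1,\alpha\wedge1}$. While $\mathcal A_l\neq\emptyset$ and $t+|\mathcal A_l|t_{l,\alpha}\le n$: for each $C\in\mathcal A_l$ request $t_{l,\alpha\wedge1}$ labels at $x_C$ and let $\hat\eta(x_C)$ be their mean; if $|\hat\eta(x_C)-1/2|\le B_{l,\alpha}$, put all cells of $G_{l+1}$ contained in $C$ into $\mathcal A_{l+1}$; otherwise add $C$ to $S^y$ with $y=\mathbf 1\{\hat\eta(x_C)\ge1/2\}$. Then increase $l$ by one and add $|\mathcal A_l|t_{l,\alpha\wedge1}$ (for the new $l$) to $t$. When the loop ends let $L=l-1$. If $\alpha>1$, then for each $C\in\mathcal A_L$ draw $t_{L,\alpha}$ independent uniform points $X_{C,i}$ of $\tilde C$, request their labels $Y_{C,i}$, and for each $C'\in G_{\lfloor L\alpha\rfloor}$ with $C'\subset C$ set $$\hat\eta_C(x_{C'})=\frac{3^d}{t_{L,\alpha}}\sum_{i\le t_{L,\alpha}}K_\alpha\big((x_{C'}-X_{C,i})2^L\big)Y_{C,i};$$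 add $C'$ to $S^1$ if $\hat\eta_C(x_{C'})-1/2>4^{d+1}\lambda2^{-\alpha L}$, and to $S^0$ if $\hat\eta_C(x_{C'})-1/2<-4^{d+1}\lambda2^{-\alpha L}$. Here $K_\alpha(z)=\prod_{i=1}^d\tilde k_\alpha(z^{(i)})$, $\tilde k_\alpha(u)=\mathbf 1\{|u|\le1\}\sum_{m=0}^{\lfloor\alpha\rfloor}\varphi_m(0)\varphi_m(u)$, and $\varphi_m$ are the Legendre polynomials orthonormal in $L^2([-1,1])$. Return $S^0,S^1$. \textbf{Adaptive algorithm with input $(n,\delta,\lambda)$.} Let $s^0_0=s^1_0=\emptyset$. For $i=1,\dots,\lfloor\log n\rfloor^3$ run the Subroutine, on fresh independent samples, with input $\big(\frac{n}{\lfloor\log n\rfloor^3},\frac{\delta}{\lfloor\log n\rfloor^3},\frac{i}{\lfloor\log n\rfloor^2},\lambda\big)$, obtain $S^0_i,S^1_i$, and set $s^y_i=s^y_{i-1}\cup(S^y_i\setminus s^{1-y}_{i-1})$ for $y\in\{0,1\}$. Return $\hat f_n=\mathbf 1\{s^1_{\lfloor\log n\rfloor^3}\}$. \textbf{Theorem (Upper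 bound).} For all $d\ge1$, $\alpha>0$, $\beta\ge0$, $c_3\ge0$ there are constants $C_1,C_2>0$ (depending on $d,\alpha,\beta,c_3$ only; in particular not on $n,\delta,\lambda$) such that the following holds. Let $n\in\mathbb N^*$, $0<\delta<1$, $\lambda\ge1$, $\Delta_0\ge0$, $\frac1{\lfloor\log n\rfloor}\le\alpha\le\lfloor\log n\rfloor$, and let $(\eta,\mathbb P_X)\in\mathcal P(\alpha,\beta,\Delta_0;\lambda,c_3)$. The adaptive algorithm with input $(n,\delta,\lambda)$ requests at most $n$ labels, and with probability at least $1-8\delta$ its output $\hat f_n$ satisfies both of the following: \begin{itemize} \item $\displaystyle\mathcal E(\hat f_n)\le C_1\lambda^{\frac{d(\beta+1)}{2\alpha+d}}\Big(\frac{\log^3(n)\log(\frac{\lambda n}{\delta})}{n}\Big)^{\frac{\alpha(\beta+1)}{2\alpha+d}};$ \item if $\Delta_0>0$ and $\displaystyle\frac{n}{\lfloor\log^3(n)\rfloor}>C_2\lambda^{d/\alpha}\log\big(\tfrac{\lambda n}{\delta}\big)\Big(\frac1{\Delta_0}\Big)^{\frac{2\alpha+d}{\alpha}}$, then $\mathcal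 E(\hat f_n)=0$. \end{itemize} -/

import Mathlib

open MeasureTheory ProbabilityTheory

noncomputable section

namespace ActiveLearning

/-- Feature space `ℝ^d` with the Euclidean norm. -/
abbrev Pt (d : ℕ) := EuclideanSpace ℝ (Fin d)

/-! ## Classification problems

Labels live in `Bool`: `true` is the label `1`, `false` is the label `0`. -/

/-- Law of a pair `(X, Y)` with `X ∼ ν` and, given `X = x`, `Y ∼ Bernoulli (η x)`. -/
def pairLaw {d : ℕ} (η : Pt d → ℝ) (ν : Measure (Pt d)) : Measure (Pt d × Bool) :=
  (ν.withDensity fun x => ENNReal.ofReal (η x)).map (fun x => (x, true)) +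
    (ν.withDensity fun x => ENNReal.ofReal (1 - η x)).map (fun x => (x, false))

/-- The risk `R(f) = P(Y ≠ f(X))` of a classifier. -/
def risk {d : ℕ} (η : Pt d → ℝ) (PX : Measure (Pt d)) (f : Pt d → Bool) : ℝ :=
  (pairLaw η PX).real {p | p.2 ≠ f p.1}

open Classical in
/-- The Bayes classifier `x ↦ 1{η(x) ≥ 1/2}`. -/
def bayes {d : ℕ} (η : Pt d → ℝ) : Pt d → Bool := fun x => decide (1 / 2 ≤ η x)

/-- The excess risk `R(f) - R(f*)`. -/
def excessRisk {d : ℕ} (η : Pt d → ℝ) (PX : Measure (Pt d)) (f : Pt d → Bool) : ℝ :=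
  risk η PX f - risk η PX (bayes η)

/-- The unit cube `[0,1]^d`. -/
def unitCube (d : ℕ) : Set (Pt d) := {x | ∀ i, x i ∈ Set.Icc (0 : ℝ) 1}

/-- The `i`-th partial derivative. -/
def partialD {d : ℕ} (i : Fin d) (g : Pt d → ℝ) : Pt d → ℝ :=
  fun x => lineDeriv ℝ g x (EuclideanSpace.single i 1)

/-- The mixed partial derivative `D^s g` for a multi-index `s`. -/
def mixedPartial {d : ℕ} (s : Fin d → ℕ) (g : Pt d → ℝ) : Pt d → ℝ :=
  (List.finRange d).foldr (fun i f => (partialD i)^[s i] f) g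

/-- The multi-indices `s` with `|s| = j`. -/
def multiIndices (d j : ℕ) : Finset (Fin d → ℕ) := Finset.piAntidiag Finset.univ j

/-- The Hölder class `Σ(lam, α)` of functions `ℝ^d → [0,1]`; for `α ≤ 1` only the Hölder quotient is
constrained. -/
def HolderClass {d : ℕ} (lam α : ℝ) (g : Pt d → ℝ) : Prop :=
  (∀ x, g x ∈ Set.Icc (0 : ℝ) 1) ∧
  (α ≤ 1 → ∀ x y, |g x - g y| ≤ lam * ‖x - y‖ ^ α) ∧
  (1 < α →
    ContDiff ℝ (⌊α⌋₊ : ℕ) g ∧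
    (∀ j : ℕ, (j : ℝ) ≤ α → ∀ x, ∑ s ∈ multiIndices d j, |mixedPartial s g x| ≤ lam) ∧
    (∀ x y, ∑ s ∈ multiIndices d ⌊α⌋₊, |mixedPartial s g x - mixedPartial s g y|
      ≤ lam * ‖x - y‖ ^ (α - (⌊α⌋₊ : ℝ))))

/-- The margin condition with parameters `β`, `Δ₀`, `c₃`. -/
def MarginCondition {d : ℕ} (β Δ₀ c₃ : ℝ) (η : Pt d → ℝ) (PX : Measure (Pt d)) : Prop :=
  PX {x | |η x - 1 / 2| < Δ₀} = 0 ∧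
  ∀ Δ : ℝ, 0 < Δ → PX.real {x | |η x - 1 / 2| ≤ Δ₀ + Δ} ≤ c₃ * Δ ^ β

/-- The class `P(α, β, Δ₀; lam, c₃)` of classification problems `(η, P_X)`, with no restriction on
the marginal `P_X` besides being a probability carried by `[0,1]^d`. -/
structure ProblemClass {d : ℕ} (α β Δ₀ lam c₃ : ℝ) (η : Pt d → ℝ) (PX : Measure (Pt d)) :
    Prop where
  prob : IsProbabilityMeasure PX
  support : PX (unitCube d)ᶜ = 0
  smooth : HolderClass lam α η
  margin : MarginCondition β Δ₀ c₃ η PX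

/-! ## Dyadic cells

A cell of the grid `G_l` is given by its index `c : Fin d → ℕ` with entries in `{0, …, 2^l - 1}`. -/

/-- Indices of the cells of `G_l`. -/
def grid (d l : ℕ) : Finset (Fin d → ℕ) := Fintype.piFinset fun _ => Finset.range (2 ^ l)

/-- The cell of `G_l` with index `c`: half-open, except that the faces `x i = 1` of the unit cube
are included, so that the cells of `G_l` form a partition of `[0,1]^d`. -/
def cell {d : ℕ} (l : ℕ) (c : Fin d → ℕ) : Set (Pt d) :=
  {x | ∀ i, (c i : ℝ) / 2 ^ l ≤ x i ∧
    (x i < ((c i : ℝ) + 1) / 2 ^ l ∨ (c i + 1 = 2 ^ l ∧ x i = 1))}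

/-- The center of a cell. -/
def center {d : ℕ} (l : ℕ) (c : Fin d → ℕ) : Pt d :=
  WithLp.toLp 2 fun i => ((c i : ℝ) + 1 / 2) / 2 ^ l

/-- The inflated cell: all points at sup-norm distance at most `2^{-l}` from the cell. -/
def inflatedCell {d : ℕ} (l : ℕ) (c : Fin d → ℕ) : Set (Pt d) :=
  {x | ∀ i, x i ∈ Set.Icc (((c i : ℝ) - 1) / 2 ^ l) (((c i : ℝ) + 2) / 2 ^ l)}

/-! ## The active sampling model -/

/-- The label requests a run of the non-adaptive subroutine may make: the `j`-th request at the
center of the cell `c` of `G_l`, or the `j`-th request at a uniform random point of the inflated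
cell. -/
inductive Query (d : ℕ) : Type
  | atCenter (l : ℕ) (c : Fin d → ℕ) (j : ℕ) : Query d
  | inInflated (l : ℕ) (c : Fin d → ℕ) (j : ℕ) : Query d

/-- The distribution of the point at which the label is requested. -/
def queryLaw {d : ℕ} : Query d → Measure (Pt d)
  | .atCenter l c _ => Measure.dirac (center l c)
  | .inInflated l c _ => cond volume (inflatedCell l c)

/-- The (point, label) answers to all requests that one run of the subroutine might make. -/
abbrev Tape (d : ℕ) := Query d → Pt d × Bool

/-- `Z (i, q)` is the answer to the request `q` in phase `i`: all answers are independent, the point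
has the law prescribed by the request, and given that the point is `x` the label is
Bernoulli of parameter `η x`. -/
structure IsSampling {d : ℕ} {Ω : Type*} [MeasurableSpace Ω] (μ : Measure Ω) (η : Pt d → ℝ)
    (Z : ℕ × Query d → Ω → Pt d × Bool) : Prop where
  measurable : ∀ q, Measurable (Z q)
  indep : iIndepFun Z μ
  law : ∀ q, μ.map (Z q) = pairLaw η (queryLaw q.2)

/-! ## The Legendre kernel -/

/-- The Legendre polynomials, orthonormal in `L²([-1,1])` (Rodrigues' formula). -/
def legendrePhi (m : ℕ) (u : ℝ) : ℝ :=
  Real.sqrt ((2 * m + 1) / 2) / (2 ^ m * (m.factorial : ℝ)) *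
    (Polynomial.derivative^[m] (((Polynomial.X : Polynomial ℝ) ^ 2 - 1) ^ m)).eval u

open Classical in
/-- The one-dimensional kernel of order `⌊α⌋ + 1` (its moments of orders `1, …, ⌊α⌋` vanish). -/
def legendreKernel (α u : ℝ) : ℝ :=
  if |u| ≤ 1 then ∑ m ∈ Finset.range (⌊α⌋₊ + 1), legendrePhi m 0 * legendrePhi m u else 0

/-- The product kernel on `ℝ^d`. -/
def productKernel {d : ℕ} (α : ℝ) (z : Pt d) : ℝ := ∏ i, legendreKernel α (z i)

/-! ## The non-adaptive subroutine -/

/-- `b_{l,α} = lam d^{(α ∧ 1)/2} 2^{-lα}`. -/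
def bLevel (d : ℕ) (lam α : ℝ) (l : ℕ) : ℝ :=
  lam * (d : ℝ) ^ (min α 1 / 2) * (2 : ℝ) ^ (-((l : ℝ) * α))

/-- `δ_{l,α} = δ 2^{-l(d+1)(α ∨ 1)}`. -/
def deltaLevel (d : ℕ) (δ α : ℝ) (l : ℕ) : ℝ :=
  δ * (2 : ℝ) ^ (-((l : ℝ) * ((d : ℝ) + 1) * max α 1))

open Classical in
/-- The number `t_{l,α}` of samples, rounded up to an integer. -/
def numSamples (d : ℕ) (δ lam α : ℝ) (l : ℕ) : ℕ :=
  if α ≤ 1 then ⌈Real.log (1 / deltaLevel d δ α l) / (2 * bLevel d lam α l ^ 2)⌉₊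
  else ⌈(4 : ℝ) ^ (2 * d + 1) * (α + 1) ^ (2 * d) *
    (Real.log (1 / deltaLevel d δ α l) / bLevel d lam α l ^ 2)⌉₊

/-- The input `(n, δ, α, lam)` of the subroutine; the budget `n` may be any real number. -/
structure SubInput where
  n : ℝ
  δ : ℝ
  α : ℝ
  lam : ℝ

namespace SubInput

variable {d : ℕ}

/-- `t_{l, α ∧ 1}`, the number of labels requested at the center of an active cell of depth `l`. -/
def tCenter (P : SubInput) (d l : ℕ) : ℕ := numSamples d P.δ P.lam (min P.α 1) l

/-- `t_{l, α}`. -/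
def tFull (P : SubInput) (d l : ℕ) : ℕ := numSamples d P.δ P.lam P.α l

/-- The empirical mean of the labels requested at the center of a cell. -/
def etaHat (P : SubInput) (Z : Tape d) (l : ℕ) (c : Fin d → ℕ) : ℝ :=
  (∑ j ∈ Finset.range (P.tCenter d l), if (Z (.atCenter l c j)).2 = true then (1 : ℝ) else 0) /
    (P.tCenter d l : ℝ)

/-- The threshold `B_{l,α}`. -/
def threshold (P : SubInput) (d l : ℕ) : ℝ :=
  2 * (Real.sqrt (Real.log (1 / deltaLevel d P.δ (min P.α 1) l) / (2 * (P.tCenter d l : ℝ)))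
    + bLevel d P.lam (min P.α 1) l)

open Classical in
/-- The active cells `A_l`: `A_1 = G_1` (and `A_0` is empty), and `A_{l+1}` consists of the children
of those cells of `A_l` that are not labelled at depth `l`. -/
def active (P : SubInput) (Z : Tape d) : ℕ → Finset (Fin d → ℕ)
  | 0 => ∅
  | 1 => grid d 1
  | l + 2 => (grid d (l + 2)).filter fun c' => ∃ c ∈ P.active Z (l + 1),
      |P.etaHat Z (l + 1) c - 1 / 2| ≤ P.threshold d (l + 1) ∧ cell (l + 2) c' ⊆ cell (l + 1) c

/-- The budget used at the centers of the active cells up to and including depth `l`. -/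
def used (P : SubInput) (Z : Tape d) (l : ℕ) : ℕ :=
  ∑ k ∈ Finset.Icc 1 l, (P.active Z k).card * P.tCenter d k

/-- The condition for the loop to treat depth `l`: some cell is active and the budget suffices. -/
def LoopCond (P : SubInput) (Z : Tape d) (l : ℕ) : Prop :=
  (P.active Z l).Nonempty ∧
    (P.used Z l : ℝ) + ((P.active Z l).card : ℝ) * (P.tFull d l : ℝ) ≤ P.n

open Classical in
/-- The last depth `L` treated by the loop (`0` if the loop is never entered). At least one label is
requested at each treated depth, so that `L` is at most the budget. -/
def finalDepth (P : SubInput) (Z : Tape d) : ℕ :=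
  Nat.findGreatest (fun L => ∀ l ∈ Finset.Icc 1 L, P.LoopCond Z l) ⌊P.n⌋₊

open Classical in
/-- The points labelled `y` by the loop. -/
def loopLabelled (P : SubInput) (Z : Tape d) (y : Bool) : Set (Pt d) :=
  {x | ∃ l ∈ Finset.Icc 1 (P.finalDepth Z), ∃ c ∈ P.active Z l, x ∈ cell l c ∧
    P.threshold d l < |P.etaHat Z l c - 1 / 2| ∧ y = decide (1 / 2 ≤ P.etaHat Z l c)}

/-- The kernel estimator at `x` from the uniform sample in the inflated cell of the cell `c` of
depth `l`. The factor `3^d` is the volume of the inflated cell divided by that of the cell. -/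
def kernelEstimate (P : SubInput) (Z : Tape d) (l : ℕ) (c : Fin d → ℕ) (x : Pt d) : ℝ :=
  3 ^ d / (P.tFull d l : ℝ) * ∑ j ∈ Finset.range (P.tFull d l),
    productKernel P.α ((2 : ℝ) ^ l • (x - (Z (.inInflated l c j)).1)) *
      (if (Z (.inInflated l c j)).2 = true then 1 else 0)

/-- The points labelled `y` by the kernel step, run (only if `α > 1`) on the last partition. -/
def kernelLabelled (P : SubInput) (Z : Tape d) (y : Bool) : Set (Pt d) :=
  {x | 1 < P.α ∧ ∃ c ∈ P.active Z (P.finalDepth Z), ∃ c' ∈ grid d ⌊(P.finalDepth Z : ℝ) * P.α⌋₊,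
    cell ⌊(P.finalDepth Z : ℝ) * P.α⌋₊ c' ⊆ cell (P.finalDepth Z) c ∧
    x ∈ cell ⌊(P.finalDepth Z : ℝ) * P.α⌋₊ c' ∧
    (4 : ℝ) ^ (d + 1) * P.lam * (2 : ℝ) ^ (-(P.α * (P.finalDepth Z : ℝ))) <
      (if y = true then 1 else -1) *
        (P.kernelEstimate Z (P.finalDepth Z) c (center ⌊(P.finalDepth Z : ℝ) * P.α⌋₊ c') - 1 / 2)}

/-- The output `S^y` of the subroutine. -/
def output (P : SubInput) (Z : Tape d) (y : Bool) : Set (Pt d) :=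
  P.loopLabelled Z y ∪ P.kernelLabelled Z y

open Classical in
/-- The number of labels requested by the subroutine. -/
def requests (P : SubInput) (Z : Tape d) : ℕ :=
  P.used Z (P.finalDepth Z) +
    if 1 < P.α then (P.active Z (P.finalDepth Z)).card * P.tFull d (P.finalDepth Z) else 0

end SubInput

/-! ## The adaptive algorithm -/

/-- `⌊log n⌋` -/
def flog (n : ℕ) : ℕ := ⌊Real.log n⌋₊

/-- The input of the subroutine in phase `i`. -/
def phaseInput (n : ℕ) (δ lam : ℝ) (i : ℕ) : SubInput where
  n := (n : ℝ) / (flog n : ℝ) ^ 3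
  δ := δ / (flog n : ℝ) ^ 3
  α := (i : ℝ) / (flog n : ℝ) ^ 2
  lam := lam

/-- The aggregated sets `s_i^y`; `Z i` is the tape of phase `i`. -/
def aggregate {d : ℕ} (n : ℕ) (δ lam : ℝ) (Z : ℕ → Tape d) : ℕ → Bool → Set (Pt d)
  | 0, _ => ∅
  | i + 1, y => aggregate n δ lam Z i y ∪
      ((phaseInput n δ lam (i + 1)).output (Z (i + 1)) y \ aggregate n δ lam Z i (!y))

open Classical in
/-- The classifier returned by the adaptive algorithm with input `n`, `δ`, `lam`. -/
def adaptiveClassifier {d : ℕ} (n : ℕ) (δ lam : ℝ) (Z : ℕ → Tape d) : Pt d → Bool :=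
  fun x => decide (x ∈ aggregate n δ lam Z (flog n ^ 3) true)

/-- The total number of labels requested by the adaptive algorithm. -/
def totalRequests {d : ℕ} (n : ℕ) (δ lam : ℝ) (Z : ℕ → Tape d) : ℕ :=
  ∑ i ∈ Finset.Icc 1 (flog n ^ 3), (phaseInput n δ lam i).requests (Z i)

end ActiveLearning

end

/-! All requests are independent, so Hoeffding's inequality and a union bound over every depth and
every cell (not just the random active ones) make the estimates of all phases with parameter a ≤ α
accurate with probability at least 1 - 4δ (`measure_not_good_le`). The rest is deterministic. With E
= `marginConst` * `rate`, the classifier agrees with the Bayes classifier at every point of the cube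
where |η - 1/2| > E (`adaptiveClassifier_eq`). Hence the excess risk is at most 2E times the mass of
{|η - 1/2| ≤ E}, which the margin condition bounds, and it vanishes once E < Δ₀.

In a phase with a ≤ α the test at a center never errs: its threshold is twice the sum of the
deviation and the oscillation of η over the cell. A cell left open satisfies |η - 1/2| ≤ 6 b. For a
> 1 the kernel step improves the resolution of the last depth L to order 2^{-aL}, so the points
without a label satisfy |η - 1/2| ≤ C λ 2^{-aL} (`mem_output_or`). If the loop stopped for lack of
budget, counting labels bounds λ 2^{-αL} by the rate (`resolution_le`). The last phase with a ≤ α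
has α - a ≤ ⌊log n⌋^{-2}; since only depths of order log n matter, 2^{-aL} and 2^{-αL} then differ
by a constant factor, and that phase labels every point with |η - 1/2| > E.

The delicate point is that the kernel step of a phase with a ≤ α may still be wrong. Its threshold
4^{d+1} λ 2^{-aL} absorbs the deviation, the Taylor terms of degree between a and α, and the passage
from the center to the point, but not the Taylor remainder of order α, whose constant `biasConst`
depends on α. A wrong label therefore only forces |η - 1/2| ≤ `biasConst` * λ 2^{-αL}. If the budget
ran out, this is below E. Otherwise the point was also labelled by the center test at some depth l ≤
L where λ √d 2^{-l} < |η - 1/2|. Comparing the two inequalities gives l ≤ L₀ with L₀ depending on d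
and α only, and then the phase with a = 1, which comes earlier, has already proposed the right label
(`mem_output_of_mem_output_not`). Since the aggregation never overrides an earlier label, the error
is harmless.

The sample sizes of the kernel step contain explicit constants, so the kernel must be bounded
explicitly, by 4(⌊a⌋ + 1) in one variable (`abs_legendreKernel_le`). This uses Sonin's function in
the interior of [-1, 1] and a Christoffel–Darboux cancellation near the endpoints. -/

noncomputable section

namespace ActiveLearning

/-! ### Orthonormality and completeness of the Legendre polynomials. -/

section Legendre
open Polynomial

/-- The `L²([-1,1])` pairing of polynomials. -/
def polyPair (p q : ℝ[X]) : ℝ := ∫ x in (-1 : ℝ)..1, p.eval x * q.eval x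

lemma polynomial_intervalIntegrable (p : ℝ[X]) (a b : ℝ) :
    IntervalIntegrable (fun x => p.eval x) volume a b := p.continuous.intervalIntegrable a b

lemma polyPair_eq (p q : ℝ[X]) : polyPair p q = ∫ x in (-1 : ℝ)..1, (p * q).eval x := by
  simp [polyPair]

lemma polyPair_comm (p q : ℝ[X]) : polyPair p q = polyPair q p := by
  simp [polyPair, mul_comm]

lemma polyPair_add_right (p q r : ℝ[X]) : polyPair p (q + r) = polyPair p q + polyPair p r := by
  rw [polyPair_eq, polyPair_eq, polyPair_eq,
    ← intervalIntegral.integral_add (polynomial_intervalIntegrable _ _ _)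
      (polynomial_intervalIntegrable _ _ _)]
  simp [mul_add]

lemma polyPair_C_mul_right (c : ℝ) (p q : ℝ[X]) : polyPair p (C c * q) = c * polyPair p q := by
  rw [polyPair, polyPair, ← intervalIntegral.integral_const_mul]
  congr 1; ext x; simp; ring

lemma polyPair_zero_right (p : ℝ[X]) : polyPair p 0 = 0 := by simp [polyPair]

lemma polyPair_sum_right {ι : Type*} (s : Finset ι) (p : ℝ[X]) (f : ι → ℝ[X]) :
    polyPair p (∑ i ∈ s, f i) = ∑ i ∈ s, polyPair p (f i) := by
  classical
  induction s using Finset.induction_on with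
  | empty => simp [polyPair_zero_right]
  | insert a s ha ih => rw [Finset.sum_insert ha, Finset.sum_insert ha, polyPair_add_right, ih]

lemma polyPair_self_nonneg (p : ℝ[X]) : 0 ≤ polyPair p p :=
  intervalIntegral.integral_nonneg (by norm_num) fun x _ => mul_self_nonneg _

lemma polyPair_sq_le (p q : ℝ[X]) (hq : 0 < polyPair q q) :
    polyPair p q ^ 2 ≤ polyPair p p * polyPair q q := by
  set G := polyPair q q with hG
  set m := polyPair p q with hm
  have h := polyPair_self_nonneg (C G * p + C (-m) * q)
  rw [polyPair_add_right, polyPair_C_mul_right, polyPair_C_mul_right, polyPair_comm _ p,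
    polyPair_comm _ q, polyPair_add_right, polyPair_add_right, polyPair_C_mul_right,
    polyPair_C_mul_right, polyPair_C_mul_right, polyPair_C_mul_right, polyPair_comm q p,
    ← hG, ← hm] at h
  have : 0 ≤ G * (polyPair p p * G - m ^ 2) := by linarith
  have := nonneg_of_mul_nonneg_right this hq
  linarith

lemma polyPair_derivative_right (p q : ℝ[X]) (h1 : p.eval 1 = 0) (h2 : p.eval (-1) = 0) :
    polyPair p (derivative q) = - polyPair (derivative p) q := by
  rw [polyPair, polyPair, intervalIntegral.integral_mul_deriv_eq_deriv_mul
    (fun x _ => p.hasDerivAt x) (fun x _ => q.hasDerivAt x)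
    (polynomial_intervalIntegrable _ _ _) (polynomial_intervalIntegrable _ _ _), h1, h2]
  ring

/-- The polynomial `(X² - 1)^m` in Rodrigues' formula. -/
def rodriguesBase (m : ℕ) : ℝ[X] := (X ^ 2 - 1) ^ m

/-- The `m`-th derivative of `(X² - 1)^m`, a multiple of the `m`-th Legendre polynomial. -/
def rodrigues (m : ℕ) : ℝ[X] := derivative^[m] (rodriguesBase m)

lemma rodriguesBase_eq (m : ℕ) :
    rodriguesBase m = (X - C 1) ^ m * (X + C 1) ^ m := by
  rw [rodriguesBase, ← mul_pow]; congr 1; simp; ring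

/-- (X² - 1)^m vanishes to order m at ±1; this kills the boundary terms of the m integrations by
parts. -/
lemma eval_iterate_derivative_rodriguesBase {m j : ℕ} (hj : j < m) {u : ℝ} (hu : u ^ 2 = 1) :
    (derivative^[j] (rodriguesBase m)).eval u = 0 := by
  have h : ((X : ℝ[X]) ^ 2 - 1) ^ (m - j) ∣ derivative^[j] (rodriguesBase m) :=
    pow_sub_dvd_iterate_derivative_of_pow_dvd j (dvd_refl _)
  obtain ⟨r, hr⟩ := h
  rw [hr, eval_mul, eval_pow]
  have : m - j ≠ 0 := by omega
  simp [hu, this]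

lemma polyPair_iterate_derivative (m j : ℕ) (hj : j ≤ m) (q : ℝ[X]) :
    polyPair (derivative^[j] (rodriguesBase m)) q =
      (-1) ^ j * polyPair (rodriguesBase m) (derivative^[j] q) := by
  induction j generalizing q with
  | zero => simp
  | succ j ih =>
    have h := polyPair_derivative_right (derivative^[j] (rodriguesBase m)) q
      (eval_iterate_derivative_rodriguesBase (by omega) (by norm_num))
      (eval_iterate_derivative_rodriguesBase (by omega) (by norm_num))
    rw [ih (by omega)] at h
    rw [Function.iterate_succ_apply', Function.iterate_succ_apply, pow_succ]
    linarith

lemma polyPair_rodrigues (m : ℕ) (q : ℝ[X]) :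
    polyPair (rodrigues m) q = (-1) ^ m * polyPair (rodriguesBase m) (derivative^[m] q) :=
  polyPair_iterate_derivative m m le_rfl q

lemma polyPair_rodrigues_of_natDegree_lt {m : ℕ} {q : ℝ[X]} (h : q.natDegree < m) :
    polyPair (rodrigues m) q = 0 := by
  rw [polyPair_rodrigues, iterate_derivative_eq_zero h, polyPair_zero_right, mul_zero]

lemma rodriguesBase_monic (m : ℕ) : (rodriguesBase m).Monic := by
  rw [rodriguesBase_eq]
  exact ((monic_X_sub_C _).pow m).mul ((monic_X_add_C _).pow m)

lemma rodriguesBase_natDegree (m : ℕ) : (rodriguesBase m).natDegree = 2 * m := by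
  rw [rodriguesBase_eq, Monic.natDegree_mul ((monic_X_sub_C _).pow m) ((monic_X_add_C _).pow m)]
  rw [natDegree_pow, natDegree_pow, natDegree_X_sub_C, natDegree_X_add_C]; ring

lemma rodrigues_coeff (m : ℕ) : (rodrigues m).coeff m = ((2 * m).descFactorial m : ℝ) := by
  rw [rodrigues, coeff_iterate_derivative]
  have := (rodriguesBase_monic m).coeff_natDegree
  rw [rodriguesBase_natDegree] at this
  rw [← two_mul, this]; simp

lemma rodrigues_natDegree_le (m : ℕ) : (rodrigues m).natDegree ≤ m := by
  have := natDegree_iterate_derivative (rodriguesBase m) m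
  rw [rodriguesBase_natDegree] at this
  exact this.trans (by omega)

lemma iterate_derivative_rodriguesBase (m : ℕ) :
    derivative^[2 * m] (rodriguesBase m) = C ((2 * m).factorial : ℝ) := by
  have h := natDegree_iterate_derivative (rodriguesBase m) (2 * m)
  rw [rodriguesBase_natDegree, Nat.sub_self, Nat.le_zero] at h
  rw [eq_C_of_natDegree_eq_zero h, coeff_iterate_derivative, zero_add, Nat.descFactorial_self]
  have := (rodriguesBase_monic m).coeff_natDegree
  rw [rodriguesBase_natDegree] at this
  rw [this]; simp

/-- Integration by parts against X, using X ((X² - 1)^{m+1})' = 2(m+1) ((X² - 1)^{m+1} + (X² -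
1)^m). This recursion yields the norm of the Rodrigues polynomials. -/
lemma integral_rodriguesBase_succ (m : ℕ) :
    (2 * (m : ℝ) + 3) * ∫ x in (-1 : ℝ)..1, (rodriguesBase (m + 1)).eval x =
      - (2 * (m + 1)) * ∫ x in (-1 : ℝ)..1, (rodriguesBase m).eval x := by
  have h := polyPair_derivative_right (rodriguesBase (m + 1)) X
    (eval_iterate_derivative_rodriguesBase (j := 0) (by omega) (by norm_num))
    (eval_iterate_derivative_rodriguesBase (j := 0) (by omega) (by norm_num))
  have e1 : derivative (rodriguesBase (m + 1)) * X =
      C (2 * (m + 1) : ℝ) * rodriguesBase (m + 1) + C (2 * (m + 1) : ℝ) * rodriguesBase m := by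
    simp only [rodriguesBase, derivative_pow, derivative_sub, derivative_X, derivative_one]
    simp [pow_succ]; ring
  rw [polyPair_eq, polyPair_eq, e1, derivative_X, mul_one] at h
  simp only [eval_add, eval_mul, eval_C] at h
  rw [intervalIntegral.integral_add, intervalIntegral.integral_const_mul,
    intervalIntegral.integral_const_mul] at h
  · linarith
  · exact ((rodriguesBase (m + 1)).continuous.const_mul _).intervalIntegrable _ _ 
  · exact ((rodriguesBase m).continuous.const_mul _).intervalIntegrable _ _

lemma integral_rodriguesBase (m : ℕ) :
    ((2 * m + 1).factorial : ℝ) * ∫ x in (-1 : ℝ)..1, (rodriguesBase m).eval x =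
      (-1) ^ m * 2 ^ (2 * m + 1) * (m.factorial : ℝ) ^ 2 := by
  induction m with
  | zero => simp [rodriguesBase]; norm_num
  | succ m ih =>
    have h := integral_rodriguesBase_succ m
    have e : ((2 * (m + 1) + 1).factorial : ℝ) =
        (2 * (m : ℝ) + 3) * (2 * (m : ℝ) + 2) * (2 * m + 1).factorial := by
      rw [show 2 * (m + 1) + 1 = (2 * m + 1) + 1 + 1 by ring, Nat.factorial_succ,
        Nat.factorial_succ]; push_cast; ring
    rw [e, Nat.factorial_succ m]
    push_cast
    calc _ = (2 * (m : ℝ) + 2) * ((2 * m + 1).factorial : ℝ) *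
          ((2 * (m : ℝ) + 3) * ∫ x in (-1 : ℝ)..1, (rodriguesBase (m + 1)).eval x) := by ring
      _ = - (2 * (m : ℝ) + 2) * (2 * (m + 1)) * (((2 * m + 1).factorial : ℝ) *
          ∫ x in (-1 : ℝ)..1, (rodriguesBase m).eval x) := by rw [h]; ring
      _ = _ := by rw [ih]; ring

lemma polyPair_rodrigues_self (m : ℕ) :
    (2 * (m : ℝ) + 1) * polyPair (rodrigues m) (rodrigues m) =
      2 * (2 ^ m * (m.factorial : ℝ)) ^ 2 := by
  rw [polyPair_rodrigues, rodrigues, ← Function.iterate_add_apply, ← two_mul,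
    iterate_derivative_rodriguesBase, polyPair_eq]
  simp only [eval_mul, eval_C]
  rw [intervalIntegral.integral_mul_const]
  have h := integral_rodriguesBase m
  rw [Nat.factorial_succ] at h
  push_cast at h
  have h1 : ((-1 : ℝ) ^ m) * (-1) ^ m = 1 := by rw [← mul_pow]; simp
  calc _ = (-1) ^ m * ((2 * (m : ℝ) + 1) * ((2 * m).factorial : ℝ) *
        ∫ x in (-1 : ℝ)..1, (rodriguesBase m).eval x) := by ring
    _ = ((-1 : ℝ) ^ m * (-1) ^ m) * (2 ^ (2 * m + 1) * (m.factorial : ℝ) ^ 2) := by rw [h]; ring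
    _ = _ := by rw [h1]; ring

/-- The normalized Legendre polynomial. -/
def legPoly (m : ℕ) : ℝ[X] :=
  C (Real.sqrt ((2 * m + 1) / 2) / (2 ^ m * (m.factorial : ℝ))) * rodrigues m

lemma legendrePhi_eq (m : ℕ) (u : ℝ) : legendrePhi m u = (legPoly m).eval u := by
  simp [legendrePhi, legPoly, rodrigues, rodriguesBase]

lemma legPoly_const_sq (m : ℕ) :
    (Real.sqrt ((2 * m + 1) / 2) / (2 ^ m * (m.factorial : ℝ))) ^ 2 *
      (2 ^ m * (m.factorial : ℝ)) ^ 2 = (2 * m + 1) / 2 := by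
  have : (m.factorial : ℝ) ≠ 0 := by exact_mod_cast m.factorial_ne_zero
  rw [← mul_pow, div_mul_cancel₀ _ (by positivity), Real.sq_sqrt (by positivity)]

lemma legPoly_const_ne_zero (m : ℕ) :
    Real.sqrt ((2 * m + 1) / 2) / (2 ^ m * (m.factorial : ℝ)) ≠ 0 := by
  have := legPoly_const_sq m
  intro h
  rw [h] at this
  have : (0 : ℝ) < (2 * m + 1) / 2 := by positivity
  simp at *
  linarith

lemma polyPair_legPoly_self (m : ℕ) : polyPair (legPoly m) (legPoly m) = 1 := by
  rw [legPoly, polyPair_C_mul_right, polyPair_comm, polyPair_C_mul_right, ← mul_assoc, ← sq]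
  have h := polyPair_rodrigues_self m
  have h2 := legPoly_const_sq m
  have : (0 : ℝ) < 2 * m + 1 := by positivity
  have h3 : polyPair (rodrigues m) (rodrigues m) =
    2 * (2 ^ m * (m.factorial : ℝ)) ^ 2 / (2 * m + 1) := by rw [← h]; field_simp
  rw [h3]
  calc _ = 2 * ((Real.sqrt ((2 * m + 1) / 2) / (2 ^ m * (m.factorial : ℝ))) ^ 2 *
      (2 ^ m * (m.factorial : ℝ)) ^ 2) / (2 * m + 1) := by ring
    _ = 1 := by rw [h2]; field_simp

lemma legPoly_natDegree_le (m : ℕ) : (legPoly m).natDegree ≤ m :=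
  (natDegree_C_mul_le _ _).trans (rodrigues_natDegree_le m)

lemma polyPair_legPoly_of_natDegree_lt {m : ℕ} {q : ℝ[X]} (h : q.natDegree < m) :
    polyPair (legPoly m) q = 0 := by
  rw [legPoly, polyPair_comm, polyPair_C_mul_right, polyPair_comm,
    polyPair_rodrigues_of_natDegree_lt h, mul_zero]

lemma polyPair_legPoly_ne {m k : ℕ} (h : m ≠ k) : polyPair (legPoly m) (legPoly k) = 0 := by
  rcases lt_or_gt_of_ne h with h | h
  · rw [polyPair_comm]
    exact polyPair_legPoly_of_natDegree_lt ((legPoly_natDegree_le m).trans_lt h)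
  · exact polyPair_legPoly_of_natDegree_lt ((legPoly_natDegree_le k).trans_lt h)

lemma legPoly_coeff_ne_zero (m : ℕ) : (legPoly m).coeff m ≠ 0 := by
  rw [legPoly, coeff_C_mul, rodrigues_coeff]
  refine mul_ne_zero (legPoly_const_ne_zero m) ?_
  have : 0 < (2 * m).descFactorial m := Nat.descFactorial_pos.2 (by omega)
  positivity

/-- The polynomial of index N has a nonzero coefficient at X^N, so a multiple of it can be
subtracted to lower the degree. -/
lemma exists_legPoly_expansion (N : ℕ) (q : ℝ[X]) (hq : q.natDegree < N) :
    ∃ c : ℕ → ℝ, q = ∑ j ∈ Finset.range N, C (c j) * legPoly j := by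
  induction N generalizing q with
  | zero => omega
  | succ N ih =>
    set a := q.coeff N / (legPoly N).coeff N with ha
    have hc : (q - C a * legPoly N).coeff N = 0 := by
      rw [coeff_sub, coeff_C_mul, ha, div_mul_cancel₀ _ (legPoly_coeff_ne_zero N), sub_self]
    have hd : (q - C a * legPoly N).natDegree ≤ N := by
      refine (natDegree_sub_le _ _).trans (max_le (by omega) ?_)
      exact (natDegree_C_mul_le _ _).trans (legPoly_natDegree_le N)
    -- The zero polynomial has `natDegree` 0, so it must be set apart when N = 0.
    have hd0 : q - C a * legPoly N = 0 ∨ (q - C a * legPoly N).natDegree < N := by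
      by_cases h0 : q - C a * legPoly N = 0
      · exact Or.inl h0
      · right
        refine lt_of_le_of_ne hd fun h => h0 ?_
        rw [← leadingCoeff_eq_zero, leadingCoeff, h, hc]
    rcases hd0 with h0 | h0
    · refine ⟨fun j => if j = N then a else 0, ?_⟩
      rw [Finset.sum_range_succ, Finset.sum_eq_zero]
      · simpa [sub_eq_zero] using h0
      · intro j hj
        have := (Finset.mem_range.1 hj).ne
        simp [this]
    · obtain ⟨c, hc⟩ := ih _ h0
      refine ⟨fun j => if j = N then a else c j, ?_⟩
      rw [Finset.sum_range_succ]
      have : ∑ j ∈ Finset.range N, C (if j = N then a else c j) * legPoly j =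
          ∑ j ∈ Finset.range N, C (c j) * legPoly j :=
        Finset.sum_congr rfl fun j hj => by simp [(Finset.mem_range.1 hj).ne]
      rw [this, ← hc]; simp

lemma legPoly_expansion (N : ℕ) (q : ℝ[X]) (hq : q.natDegree < N) :
    q = ∑ j ∈ Finset.range N, C (polyPair (legPoly j) q) * legPoly j := by
  obtain ⟨c, hc⟩ := exists_legPoly_expansion N q hq
  have : ∀ j ∈ Finset.range N, polyPair (legPoly j) q = c j := by
    intro j hj
    conv_lhs => rw [hc]
    rw [polyPair_sum_right, Finset.sum_eq_single j]
    · rw [polyPair_C_mul_right, polyPair_legPoly_self, mul_one]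
    · intro k _ hk
      rw [polyPair_C_mul_right, polyPair_legPoly_ne hk.symm, mul_zero]
    · exact fun h => absurd hj h
  conv_lhs => rw [hc]
  exact Finset.sum_congr rfl fun j hj => by rw [this j hj]

end Legendre

/-! ### Legendre's equation, Sonin's function, and bounds and moments of the kernel. -/

section LegendreBounds
open Polynomial

lemma C_two_eq : (C (2 : ℝ) : ℝ[X]) = 2 := rfl

/-- The polynomial w = (X² - 1)^m solves (X² - 1) w' = 2 m X w; differentiating m + 1 times by
Leibniz's rule gives Legendre's equation. -/
lemma rodrigues_ode (m : ℕ) :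
    (X ^ 2 - 1) * derivative (derivative (rodrigues m)) + 2 * X * derivative (rodrigues m) =
      C ((m : ℝ) * (m + 1)) * rodrigues m := by
  set w := rodriguesBase m with hw
  have hbase : derivative w * X * X = derivative w + (2 * m : ℕ) • (w * X) := by
    rw [hw]
    cases m with
    | zero => simp [rodriguesBase]
    | succ m =>
      simp only [rodriguesBase, derivative_pow, derivative_sub, derivative_X, derivative_one]
      simp [pow_succ, C_two_eq]; ring
  have h := congrArg (derivative^[m + 1]) hbase
  have e0 : ∀ j, derivative^[j] (derivative w) = derivative^[j + 1] w := fun j => by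
    rw [← Function.iterate_succ_apply]
  -- The truncated m - 1 comes from Leibniz's rule; for m = 0 the factor m makes it harmless.
  have em : (m : ℝ[X]) * derivative^[m - 1 + 1] w = m * derivative^[m] w := by
    cases m with
    | zero => simp
    | succ m => simp
  rw [iterate_map_add, iterate_derivative_mul_X, iterate_derivative_mul_X,
    iterate_derivative_smul, iterate_derivative_mul_X, Nat.add_sub_cancel,
    iterate_derivative_mul_X, e0, e0, e0] at h
  have d1 : derivative (rodrigues m) = derivative^[m + 1] w := by
    rw [rodrigues, Function.iterate_succ_apply']
  have d2 : derivative (derivative (rodrigues m)) = derivative^[m + 1 + 1] w := by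
    rw [d1, ← Function.iterate_succ_apply' derivative]
  have d0 : rodrigues m = derivative^[m] w := rfl
  rw [d2, d1, d0]
  simp only [nsmul_eq_mul] at h
  push_cast at h
  simp only [map_mul, map_add, map_natCast, map_one]
  linear_combination h - (m + 1 : ℝ[X]) * em

/-- In Leibniz's rule for (X - 1)^m (X + 1)^m only one term has no factor vanishing at u. -/
lemma rodrigues_eval_sq (m : ℕ) {u : ℝ} (hu : u = 1 ∨ u = -1) :
    (rodrigues m).eval u ^ 2 = (2 ^ m * (m.factorial : ℝ)) ^ 2 := by
  rw [rodrigues, rodriguesBase_eq, iterate_derivative_mul, eval_finsetSum]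
  simp only [iterate_derivative_X_sub_pow, iterate_derivative_X_add_pow]
  rcases hu with rfl | rfl
  · rw [Finset.sum_eq_single 0]
    · simp [Nat.descFactorial_self]; norm_num; ring
    · intro k hk hk0
      have h1 := Finset.mem_range.1 hk
      have : m - (m - k) ≠ 0 := by omega
      simp [this]
    · simp
  · rw [Finset.sum_eq_single m]
    · simp [Nat.descFactorial_self]; norm_num; rw [mul_pow, mul_pow, ← pow_mul, ← pow_mul, mul_comm m 2, pow_mul, pow_mul]; norm_num
    · intro k hk hk0
      have h1 := Finset.mem_range.1 hk
      have : m - k ≠ 0 := by omega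
      simp [this]
    · simp

lemma legPoly_ode (m : ℕ) :
    (X ^ 2 - 1) * derivative (derivative (legPoly m)) + 2 * X * derivative (legPoly m) =
      C ((m : ℝ) * (m + 1)) * legPoly m := by
  rw [legPoly]
  simp only [derivative_C_mul]
  linear_combination (C (Real.sqrt ((2 * m + 1) / 2) / (2 ^ m * (m.factorial : ℝ)))) *
    rodrigues_ode m

lemma legPoly_eval_sq (m : ℕ) {u : ℝ} (hu : u = 1 ∨ u = -1) :
    (legPoly m).eval u ^ 2 = (2 * m + 1) / 2 := by
  rw [legPoly, eval_C_mul, mul_pow, rodrigues_eval_sq m hu, legPoly_const_sq]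

/-- Sonin's function of the normalized Legendre polynomial. -/
def sonin (m : ℕ) : ℝ[X] :=
  legPoly m ^ 2 + C (1 / ((m : ℝ) * (m + 1))) * ((1 - X ^ 2) * derivative (legPoly m) ^ 2)

/-- Legendre's equation eliminates the second derivative. What remains has the sign of u, so Sonin's
function, which dominates the square of the polynomial, grows with |u|. -/
lemma derivative_sonin (m : ℕ) (hm : 0 < m) :
    derivative (sonin m) = C (2 / ((m : ℝ) * (m + 1))) * X * derivative (legPoly m) ^ 2 := by
  have hN : ((m : ℝ) * (m + 1)) ≠ 0 := by positivity
  have e : C (1 / ((m : ℝ) * (m + 1))) * C ((m : ℝ) * (m + 1)) = 1 := by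
    rw [← C_mul, one_div_mul_cancel hN, C_1]
  have e2 : C (2 / ((m : ℝ) * (m + 1))) = 2 * C (1 / ((m : ℝ) * (m + 1))) := by
    rw [show (2 : ℝ[X]) = C 2 from rfl, ← C_mul]; congr 1; ring
  rw [sonin, e2]
  have dc : derivative (C (1 / ((m : ℝ) * (m + 1)))) = 0 := derivative_C
  generalize C (1 / ((m : ℝ) * (m + 1))) = c at e dc ⊢
  simp [derivative_pow, C_two_eq, dc]
  linear_combination (-2 * c * derivative (legPoly m)) * legPoly_ode m
    - 2 * legPoly m * derivative (legPoly m) * e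

lemma sonin_eval_of_sq_eq_one (m : ℕ) {u : ℝ} (hu : u = 1 ∨ u = -1) :
    (sonin m).eval u = (2 * m + 1) / 2 := by
  have h := legPoly_eval_sq m hu
  have h2 : 1 - u ^ 2 = 0 := by rcases hu with rfl | rfl <;> norm_num
  simp [sonin, h, h2]

lemma legPoly_sq_le_sonin (m : ℕ) {u : ℝ} (hu : |u| ≤ 1) :
    (legPoly m).eval u ^ 2 ≤ (sonin m).eval u := by
  have h2 : 0 ≤ 1 - u ^ 2 := by nlinarith [sq_abs u, abs_nonneg u]
  simp only [sonin, eval_add, eval_pow, eval_mul, eval_C, eval_sub, eval_one, eval_X]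
  have : 0 ≤ 1 / ((m : ℝ) * (m + 1)) * ((1 - u ^ 2) * eval u (derivative (legPoly m)) ^ 2) := by
    positivity
  linarith

lemma sonin_monotoneOn (m : ℕ) (hm : 0 < m) :
    MonotoneOn (fun u => (sonin m).eval u) (Set.Icc 0 1) := by
  refine monotoneOn_of_deriv_nonneg (convex_Icc 0 1) (sonin m).continuous.continuousOn
    (sonin m).differentiable.differentiableOn fun x hx => ?_
  rw [interior_Icc] at hx
  have hx0 : 0 ≤ x := hx.1.le
  rw [Polynomial.deriv, derivative_sonin m hm]
  simp only [eval_mul, eval_C, eval_X, eval_pow]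
  positivity

lemma sonin_antitoneOn (m : ℕ) (hm : 0 < m) :
    AntitoneOn (fun u => (sonin m).eval u) (Set.Icc (-1) 0) := by
  refine antitoneOn_of_deriv_nonpos (convex_Icc _ _) (sonin m).continuous.continuousOn
    (sonin m).differentiable.differentiableOn fun x hx => ?_
  rw [interior_Icc] at hx
  rw [Polynomial.deriv, derivative_sonin m hm]
  simp only [eval_mul, eval_C, eval_X, eval_pow]
  have h1 : 0 ≤ 2 / ((m : ℝ) * (m + 1)) * eval x (derivative (legPoly m)) ^ 2 := by positivity
  nlinarith [hx.2]

/-- Each of the two summands has integral 1: the square by normalization, the other by parts and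
Legendre's equation. -/
lemma integral_sonin (m : ℕ) (hm : 0 < m) : ∫ x in (-1 : ℝ)..1, (sonin m).eval x = 2 := by
  have hN : ((m : ℝ) * (m + 1)) ≠ 0 := by positivity
  have h := polyPair_derivative_right ((1 - X ^ 2) * derivative (legPoly m)) (legPoly m)
    (by simp) (by simp)
  have e : derivative ((1 - X ^ 2) * derivative (legPoly m)) =
      C (-((m : ℝ) * (m + 1))) * legPoly m := by
    rw [C_neg, neg_mul, ← legPoly_ode]
    simp only [derivative_mul, derivative_sub, derivative_one, derivative_pow, derivative_X]
    simp [C_two_eq]; ring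
  rw [e, polyPair_comm (C _ * _), polyPair_C_mul_right, polyPair_legPoly_self] at h
  have e3 : sonin m = legPoly m * legPoly m +
      C (1 / ((m : ℝ) * (m + 1))) * ((1 - X ^ 2) * derivative (legPoly m) *
        derivative (legPoly m)) := by rw [sonin]; ring
  rw [e3]
  simp only [eval_add, eval_C_mul]
  rw [intervalIntegral.integral_add (polynomial_intervalIntegrable _ _ _)
    ((polynomial_intervalIntegrable _ _ _).const_mul _), intervalIntegral.integral_const_mul,
    ← polyPair_eq, ← polyPair_eq, h, polyPair_legPoly_self]
  field_simp
  norm_num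

lemma legPoly_zero_sq (u : ℝ) : (legPoly 0).eval u ^ 2 = 1 / 2 := by
  simp [legPoly, rodrigues, rodriguesBase]

lemma legPoly_sq_le (m : ℕ) {u : ℝ} (hu : |u| ≤ 1) :
    (legPoly m).eval u ^ 2 ≤ (2 * m + 1) / 2 := by
  rcases Nat.eq_zero_or_pos m with rfl | hm
  · rw [legPoly_zero_sq]; norm_num
  refine (legPoly_sq_le_sonin m hu).trans ?_
  obtain ⟨h1, h2⟩ := abs_le.1 hu
  rcases le_total 0 u with h | h
  · rw [← sonin_eval_of_sq_eq_one m (Or.inl rfl)]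
    exact sonin_monotoneOn m hm ⟨h, h2⟩ ⟨zero_le_one, le_rfl⟩ h2
  · rw [← sonin_eval_of_sq_eq_one m (Or.inr rfl)]
    exact sonin_antitoneOn m hm ⟨le_rfl, by norm_num⟩ ⟨h1, h⟩ h1

lemma sonin_nonneg (m : ℕ) {u : ℝ} (hu : |u| ≤ 1) : 0 ≤ (sonin m).eval u :=
  (sq_nonneg _).trans (legPoly_sq_le_sonin m hu)

/-- Between u and the nearer endpoint Sonin's function is at least its value at u, while its total
integral is 2. -/
lemma mul_legPoly_sq_le (m : ℕ) {u : ℝ} (hu : |u| ≤ 1) :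
    (1 - |u|) * (legPoly m).eval u ^ 2 ≤ 2 := by
  rcases Nat.eq_zero_or_pos m with rfl | hm
  · rw [legPoly_zero_sq]; linarith [abs_nonneg u]
  obtain ⟨h1, h2⟩ := abs_le.1 hu
  have hI : ∀ a b : ℝ, IntervalIntegrable (fun x => (sonin m).eval x) volume a b :=
    fun a b => polynomial_intervalIntegrable _ a b
  have hsplit := intervalIntegral.integral_add_adjacent_intervals (hI (-1) u) (hI u 1)
  rw [integral_sonin m hm] at hsplit
  have hn1 : 0 ≤ ∫ x in (-1 : ℝ)..u, (sonin m).eval x :=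
    intervalIntegral.integral_nonneg h1 fun x hx =>
      sonin_nonneg m (abs_le.2 ⟨hx.1, hx.2.trans h2⟩)
  have hn2 : 0 ≤ ∫ x in u..(1 : ℝ), (sonin m).eval x :=
    intervalIntegral.integral_nonneg h2 fun x hx =>
      sonin_nonneg m (abs_le.2 ⟨h1.trans hx.1, hx.2⟩)
  refine (mul_le_mul_of_nonneg_left (legPoly_sq_le_sonin m hu) (by linarith)).trans ?_
  rcases le_total 0 u with h | h
  · have : ∫ x in u..(1 : ℝ), (sonin m).eval u ≤ ∫ x in u..(1 : ℝ), (sonin m).eval x :=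
      intervalIntegral.integral_mono_on h2 (by simp) (hI u 1) fun x hx =>
        sonin_monotoneOn m hm ⟨h, h2⟩ ⟨h.trans hx.1, hx.2⟩ hx.1
    rw [intervalIntegral.integral_const, smul_eq_mul] at this
    rw [abs_of_nonneg h]; linarith
  · have : ∫ x in (-1 : ℝ)..u, (sonin m).eval u ≤ ∫ x in (-1 : ℝ)..u, (sonin m).eval x :=
      intervalIntegral.integral_mono_on h1 (by simp) (hI _ _) fun x hx =>
        sonin_antitoneOn m hm ⟨hx.1, hx.2.trans h⟩ ⟨h1, h⟩ hx.2
    rw [intervalIntegral.integral_const, smul_eq_mul] at this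
    rw [abs_of_nonpos h]; linarith

lemma legPoly_eval_zero_sq_le (m : ℕ) : (legPoly m).eval 0 ^ 2 ≤ 2 := by
  have := mul_legPoly_sq_le m (u := 0) (by simp)
  simpa using this

/-- The polynomial `∑_{m ≤ p} φ_m(0) φ_m`. -/
def kerPoly (p : ℕ) : ℝ[X] := ∑ m ∈ Finset.range (p + 1), C ((legPoly m).eval 0) * legPoly m

lemma legendreKernel_eq (α : ℝ) {u : ℝ} (hu : |u| ≤ 1) :
    legendreKernel α u = (kerPoly ⌊α⌋₊).eval u := by
  rw [legendreKernel, if_pos hu, kerPoly, eval_finsetSum]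
  exact Finset.sum_congr rfl fun m _ => by rw [legendrePhi_eq, legendrePhi_eq, eval_C_mul]

lemma legendreKernel_eq_zero (α : ℝ) {u : ℝ} (hu : ¬ |u| ≤ 1) : legendreKernel α u = 0 := by
  rw [legendreKernel, if_neg hu]

/-- Reproducing property: pairing with the kernel sums the coefficients of q times φ_m(0). It gives
the moments up to order p, and also the squared norm, as the kernel's own value at 0. -/
lemma polyPair_kerPoly (p : ℕ) (q : ℝ[X]) (hq : q.natDegree ≤ p) :
    polyPair (kerPoly p) q = q.eval 0 := by
  rw [polyPair_comm, kerPoly, polyPair_sum_right]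
  conv_rhs => rw [legPoly_expansion (p + 1) q (by omega), eval_finsetSum]
  exact Finset.sum_congr rfl fun m _ => by
    rw [polyPair_C_mul_right, eval_C_mul, mul_comm, polyPair_comm]

lemma kerPoly_natDegree_le (p : ℕ) : (kerPoly p).natDegree ≤ p := by
  refine natDegree_sum_le_of_forall_le _ _ fun m hm => ?_
  exact (natDegree_C_mul_le _ _).trans
    ((legPoly_natDegree_le m).trans (by have := Finset.mem_range.1 hm; omega))

lemma polyPair_kerPoly_self_le (p : ℕ) : polyPair (kerPoly p) (kerPoly p) ≤ 2 * (p + 1) := by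
  rw [polyPair_kerPoly p _ (kerPoly_natDegree_le p), kerPoly, eval_finsetSum]
  calc _ ≤ ∑ m ∈ Finset.range (p + 1), (2 : ℝ) := Finset.sum_le_sum fun m _ => by
        rw [eval_C_mul, ← sq]; exact legPoly_eval_zero_sq_le m
    _ = _ := by simp; ring

lemma polyPair_X_pow_self (s : ℕ) : polyPair (X ^ s) (X ^ s) = 2 / (2 * s + 1) := by
  rw [polyPair_eq, ← pow_add]
  simp only [eval_pow, eval_X]
  rw [integral_pow, ← two_mul]
  have : ((-1 : ℝ)) ^ (2 * s + 1) = -1 := by rw [pow_succ, pow_mul]; simp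
  rw [this]; push_cast; ring

/-- Cauchy–Schwarz gives the bound 2. The form s! is the one that cancels against the 1/s! of
Taylor's formula, so that the normalized moments are at most 1 whatever the order of the kernel. -/
lemma polyPair_kerPoly_X_pow_le (p s : ℕ) (hs : p < s) (hp : 0 < p) :
    |polyPair (kerPoly p) (X ^ s)| ≤ s.factorial := by
  have h := polyPair_sq_le (kerPoly p) (X ^ s) (by rw [polyPair_X_pow_self]; positivity)
  rw [polyPair_X_pow_self] at h
  have hps : (p : ℝ) + 1 ≤ s := by exact_mod_cast hs
  have h2 : polyPair (kerPoly p) (X ^ s) ^ 2 ≤ 2 ^ 2 := by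
    refine h.trans ((mul_le_mul_of_nonneg_right (polyPair_kerPoly_self_le p)
      (by positivity)).trans ?_)
    rw [mul_div_assoc', div_le_iff₀ (by positivity)]
    nlinarith
  have h3 : |polyPair (kerPoly p) (X ^ s)| ≤ 2 := abs_le_of_sq_le_sq h2 (by norm_num)
  have : (2 : ℕ) ≤ s.factorial := (show 2 ≤ s by omega).trans (Nat.self_le_factorial s)
  exact h3.trans (by exact_mod_cast this)

/-- For |u| ≤ 3/4 one has φ_m(u)² ≤ 8 and φ_m(0)² ≤ 2, so each term of the sum is at most 4. -/
lemma abs_kerPoly_le_of_le (p : ℕ) {u : ℝ} (hu : |u| ≤ 3 / 4) :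
    |(kerPoly p).eval u| ≤ 4 * (p + 1) := by
  rw [kerPoly, eval_finsetSum]
  refine (Finset.abs_sum_le_sum_abs _ _).trans ?_
  calc _ ≤ ∑ m ∈ Finset.range (p + 1), (4 : ℝ) := Finset.sum_le_sum fun m _ => by
        rw [eval_C_mul]
        refine abs_le_of_sq_le_sq ?_ (by norm_num)
        rw [mul_pow]
        have h1 := legPoly_eval_zero_sq_le m
        have h2 := mul_legPoly_sq_le m (u := u) (by linarith)
        have h3 := sq_nonneg ((legPoly m).eval u)
        have h4 : (legPoly m).eval u ^ 2 ≤ 8 := by nlinarith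
        nlinarith [sq_nonneg ((legPoly m).eval 0)]
    _ = _ := by simp; ring

/-- Near the endpoints a termwise bound would be of order p^{3/2}. Instead, by the reproducing
property, X times the kernel is orthogonal to all φ_j with j < p; hence only φ_p and φ_{p+1} occur
in its expansion, and dividing by |u| ≥ 3/4 costs a constant. -/
lemma abs_kerPoly_le_of_ge (p : ℕ) {u : ℝ} (hu1 : 3 / 4 ≤ |u|) (hu : |u| ≤ 1) :
    |(kerPoly p).eval u| ≤ 4 * (p + 1) := by
  set Q := X * kerPoly p with hQ
  have hQd : Q.natDegree < p + 2 := by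
    have := natDegree_mul_le (p := X) (q := kerPoly p)
    have h1 := kerPoly_natDegree_le p
    have h2 := natDegree_X_le (R := ℝ)
    rw [hQ]
    omega
  have hQQ : polyPair Q Q ≤ 2 * (p + 1) := by
    refine le_trans ?_ (polyPair_kerPoly_self_le p)
    refine intervalIntegral.integral_mono_on (by norm_num)
      ((Q.continuous.mul Q.continuous).intervalIntegrable _ _)
      (((kerPoly p).continuous.mul (kerPoly p).continuous).intervalIntegrable _ _) fun x hx => ?_
    have hx2 : x ^ 2 ≤ 1 := by nlinarith [hx.1, hx.2]
    rw [hQ, eval_mul, eval_X]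
    nlinarith [sq_nonneg ((kerPoly p).eval x)]
  have hcoef : ∀ j, polyPair (legPoly j) Q ^ 2 ≤ 2 * (p + 1) := fun j => by
    have := polyPair_sq_le Q (legPoly j) (by rw [polyPair_legPoly_self]; norm_num)
    rw [polyPair_legPoly_self, mul_one, polyPair_comm] at this
    exact this.trans hQQ
  have hlow : ∀ j ∈ Finset.range p, C (polyPair (legPoly j) Q) * legPoly j = 0 := by
    intro j hj
    have : polyPair (legPoly j) Q = polyPair (kerPoly p) (X * legPoly j) := by
      rw [polyPair_eq, polyPair_eq]; congr 2; ext x; congr 1; rw [hQ]; ring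
    rw [this, polyPair_kerPoly]
    · simp
    · have h0 := natDegree_mul_le (p := X) (q := legPoly j)
      have h1 := legPoly_natDegree_le j
      have h2 := natDegree_X_le (R := ℝ)
      have := Finset.mem_range.1 hj
      omega
  have hexp := legPoly_expansion (p + 2) Q hQd
  rw [Finset.sum_range_succ, Finset.sum_range_succ, Finset.sum_eq_zero hlow, zero_add] at hexp
  have hev := congrArg (eval u) hexp
  rw [hQ, eval_mul, eval_X, eval_add, eval_C_mul, eval_C_mul, ← hQ] at hev
  have hp : (0 : ℝ) ≤ p := p.cast_nonneg
  -- Weighted arithmetic-geometric mean, with 5/7 close to the optimal 1/√2. The bounds for j = p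
  -- and p + 1 add up to 99/35 (p + 1), below 20/7 (p + 1), and 20/7 · 4/3 < 4.
  have hb : ∀ j, |polyPair (legPoly j) Q * (legPoly j).eval u| ≤
      5 / 7 * ((p : ℝ) + 1) + 7 / 10 * ((2 * j + 1) / 2) := by
    intro j
    have h1 := hcoef j
    have h2 := legPoly_sq_le j hu
    set a := polyPair (legPoly j) Q
    set b := (legPoly j).eval u
    rw [abs_mul]
    nlinarith [sq_nonneg (5 * |a| - 7 * |b|), sq_abs a, sq_abs b]
  have hsum : |u| * |(kerPoly p).eval u| ≤ 3 * (p + 1) - 1 / 7 * (p + 1) := by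
    rw [← abs_mul, hev]
    refine (abs_add_le _ _).trans ((add_le_add (hb p) (hb (p + 1))).trans ?_)
    push_cast; linarith
  nlinarith [abs_nonneg ((kerPoly p).eval u)]

lemma abs_legendreKernel_le (α u : ℝ) : |legendreKernel α u| ≤ 4 * (⌊α⌋₊ + 1) := by
  by_cases hu : |u| ≤ 1
  · rw [legendreKernel_eq α hu]
    rcases le_total |u| (3 / 4) with h | h
    · exact abs_kerPoly_le_of_le _ h
    · exact abs_kerPoly_le_of_ge _ h hu
  · rw [legendreKernel_eq_zero α hu, abs_zero]; positivity

lemma measurable_legendreKernel (α : ℝ) : Measurable (legendreKernel α) := by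
  have : legendreKernel α = fun u => if |u| ≤ 1 then (kerPoly ⌊α⌋₊).eval u else 0 := by
    ext u
    by_cases hu : |u| ≤ 1
    · rw [legendreKernel_eq α hu, if_pos hu]
    · rw [legendreKernel_eq_zero α hu, if_neg hu]
  rw [this]
  exact Measurable.ite (measurableSet_le measurable_id.abs measurable_const)
    (kerPoly _).continuous.measurable measurable_const

/-- The moments of the one-dimensional kernel. -/
lemma integral_legendreKernel_pow (α : ℝ) (s : ℕ) :
    ∫ u, legendreKernel α u * u ^ s = polyPair (kerPoly ⌊α⌋₊) (X ^ s) := by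
  have h1 : (fun u => legendreKernel α u * u ^ s) =
      (Set.Icc (-1 : ℝ) 1).indicator fun u => (kerPoly ⌊α⌋₊).eval u * (X ^ s : ℝ[X]).eval u := by
    ext u
    by_cases hu : |u| ≤ 1
    · rw [legendreKernel_eq α hu, Set.indicator_of_mem (show u ∈ Set.Icc (-1 : ℝ) 1 from abs_le.1 hu)]; simp
    · rw [legendreKernel_eq_zero α hu, Set.indicator_of_notMem (fun h : u ∈ Set.Icc (-1 : ℝ) 1 => hu (abs_le.2 h)), zero_mul]
  rw [h1, integral_indicator measurableSet_Icc, integral_Icc_eq_integral_Ioc,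
    ← intervalIntegral.integral_of_le (by norm_num), polyPair]

lemma integral_legendreKernel_pow_zero (α : ℝ) :
    ∫ u, legendreKernel α u * u ^ 0 = 1 := by
  rw [integral_legendreKernel_pow, polyPair_kerPoly _ _ (by simp)]; simp

lemma integral_legendreKernel_pow_eq_zero (α : ℝ) {s : ℕ} (hs : 0 < s) (hs2 : s ≤ ⌊α⌋₊) :
    ∫ u, legendreKernel α u * u ^ s = 0 := by
  rw [integral_legendreKernel_pow, polyPair_kerPoly _ _ (by simpa using hs2)]; simp; omega

lemma abs_integral_legendreKernel_pow_le (α : ℝ) (hα : 1 ≤ α) (s : ℕ) :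
    |∫ u, legendreKernel α u * u ^ s| ≤ s.factorial := by
  have hp : 0 < ⌊α⌋₊ := Nat.floor_pos.2 hα
  rcases Nat.eq_zero_or_pos s with rfl | h
  · rw [integral_legendreKernel_pow_zero]; simp
  · rcases le_or_gt s ⌊α⌋₊ with h2 | h2
    · rw [integral_legendreKernel_pow_eq_zero α h h2, abs_zero]; positivity
    · rw [integral_legendreKernel_pow]
      exact polyPair_kerPoly_X_pow_le _ s h2 hp

end LegendreBounds

/-! ### Multivariate Taylor formula and consequences of Hölder smoothness. -/

section Taylor
variable {d : ℕ}

lemma partialD_eq_fderiv {g : Pt d → ℝ} (hg : ContDiff ℝ 1 g) (i : Fin d) :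
    partialD i g = fun x => fderiv ℝ g x (EuclideanSpace.single i 1) := by
  ext x
  exact ((hg.differentiable (by norm_num)) x).lineDeriv_eq_fderiv

lemma contDiff_partialD {m : ℕ} {g : Pt d → ℝ} (hg : ContDiff ℝ ((m + 1 : ℕ) : ℕ∞) g)
    (i : Fin d) : ContDiff ℝ (m : ℕ∞) (partialD i g) := by
  rw [partialD_eq_fderiv (hg.of_le (by exact_mod_cast Nat.le_add_left 1 m)) i]
  exact (hg.fderiv_right (m := ((m : ℕ∞) : WithTop ℕ∞)) (by push_cast; exact le_rfl)).clm_apply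
    contDiff_const

lemma contDiff_iterate_partialD {m a : ℕ} {g : Pt d → ℝ} (hg : ContDiff ℝ ((m + a : ℕ) : ℕ∞) g)
    (i : Fin d) : ContDiff ℝ (m : ℕ∞) ((partialD i)^[a] g) := by
  induction a generalizing g with
  | zero => exact hg
  | succ a ih =>
    rw [Function.iterate_succ_apply]
    exact ih (contDiff_partialD (m := m + a) hg i)

lemma partialD_comm {g : Pt d → ℝ} (hg : ContDiff ℝ ((2 : ℕ) : ℕ∞) g) (i j : Fin d) :
    partialD i (partialD j g) = partialD j (partialD i g) := by
  have h1 : ContDiff ℝ 1 g := hg.of_le (by norm_num)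
  have hp : ∀ l, ContDiff ℝ 1 (partialD l g) := fun l => by
    have := contDiff_partialD (m := 1) hg l
    exact this.of_le (by norm_num)
  have key : ∀ (l r : Fin d) x, partialD l (partialD r g) x =
      fderiv ℝ (fderiv ℝ g) x (EuclideanSpace.single l 1) (EuclideanSpace.single r 1) := by
    intro l r x
    have hd : DifferentiableAt ℝ (fderiv ℝ g) x :=
      ((hg.fderiv_right (m := 1) (by norm_num)).differentiable (by norm_num)) x
    rw [partialD_eq_fderiv (hp r) l, partialD_eq_fderiv h1 r]
    simp only
    rw [fderiv_clm_apply hd (differentiableAt_const _)]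
    simp
  ext x
  rw [key, key]
  have hs : IsSymmSndFDerivAt ℝ g x :=
    (hg.contDiffAt (x := x)).isSymmSndFDerivAt (by simp)
  exact hs _ _

lemma partialD_iterate_comm {a : ℕ} {g : Pt d → ℝ} (hg : ContDiff ℝ ((a + 1 : ℕ) : ℕ∞) g)
    (i j : Fin d) : partialD i ((partialD j)^[a] g) = (partialD j)^[a] (partialD i g) := by
  induction a generalizing g with
  | zero => rfl
  | succ a ih =>
    rw [Function.iterate_succ_apply, Function.iterate_succ_apply,
      ih (contDiff_partialD (m := a + 1) hg j),
      partialD_comm (hg.of_le (by exact_mod_cast (by omega : 2 ≤ a + 1 + 1)))]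

lemma contDiff_foldr_partialD (L : List (Fin d)) (s : Fin d → ℕ) {m : ℕ} {g : Pt d → ℝ}
    (hg : ContDiff ℝ ((m + (L.map s).sum : ℕ) : ℕ∞) g) :
    ContDiff ℝ (m : ℕ∞) (L.foldr (fun i f => (partialD i)^[s i] f) g) := by
  induction L generalizing m with
  | nil => simpa using hg
  | cons i L ih =>
    rw [List.foldr_cons]
    refine contDiff_iterate_partialD (ih ?_) i
    rw [List.map_cons, List.sum_cons] at hg
    rwa [add_assoc]

lemma foldr_partialD_congr (L : List (Fin d)) {s r : Fin d → ℕ} (h : ∀ i ∈ L, s i = r i)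
    (g : Pt d → ℝ) : L.foldr (fun i f => (partialD i)^[s i] f) g =
      L.foldr (fun i f => (partialD i)^[r i] f) g := by
  induction L with
  | nil => rfl
  | cons i L ih =>
    rw [List.foldr_cons, List.foldr_cons, ih fun j hj => h j (List.mem_cons_of_mem _ hj),
      h i List.mem_cons_self]

/-- The iterated derivatives are taken in the fixed order of the list; symmetry of second
derivatives lets a further one move to its place. -/
lemma partialD_foldr (L : List (Fin d)) (hL : L.Nodup) (s : Fin d → ℕ) (i : Fin d) (hi : i ∈ L)
    {g : Pt d → ℝ} (hg : ContDiff ℝ (((L.map s).sum + 1 : ℕ) : ℕ∞) g) :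
    partialD i (L.foldr (fun i f => (partialD i)^[s i] f) g) =
      L.foldr (fun j f => (partialD j)^[(s + Pi.single i 1 : Fin d → ℕ) j] f) g := by
  induction L with
  | nil => simp at hi
  | cons j L ih =>
    rw [List.nodup_cons] at hL
    rw [List.map_cons, List.sum_cons] at hg
    rw [List.foldr_cons, List.foldr_cons]
    by_cases hij : i = j
    · subst hij
      rw [← Function.iterate_succ_apply' (partialD i)]
      have : (s + Pi.single i 1 : Fin d → ℕ) i = s i + 1 := by simp
      rw [this]
      congr 1
      refine foldr_partialD_congr L (fun l hl => ?_) g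
      have : l ≠ i := fun h => hL.1 (h ▸ hl)
      simp [this]
    · have : (s + Pi.single i 1 : Fin d → ℕ) j = s j := by simp [Ne.symm hij]
      rw [this, partialD_iterate_comm, ih hL.2]
      · rcases List.mem_cons.1 hi with h | h
        · exact absurd h hij
        · exact h
      · exact hg.of_le (by exact_mod_cast (by omega))
      · refine contDiff_foldr_partialD L s ?_
        exact hg.of_le (by exact_mod_cast (by omega : s j + 1 + (L.map s).sum ≤ _))

lemma contDiff_mixedPartial (s : Fin d → ℕ) {m : ℕ} {g : Pt d → ℝ}
    (hg : ContDiff ℝ ((m + ∑ i, s i : ℕ) : ℕ∞) g) : ContDiff ℝ (m : ℕ∞) (mixedPartial s g) := by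
  refine contDiff_foldr_partialD _ s ?_
  rw [← List.ofFn_eq_map, List.sum_ofFn]
  exact hg

lemma partialD_mixedPartial (s : Fin d → ℕ) (i : Fin d) {g : Pt d → ℝ}
    (hg : ContDiff ℝ ((∑ i, s i + 1 : ℕ) : ℕ∞) g) :
    partialD i (mixedPartial s g) = mixedPartial (s + Pi.single i 1) g := by
  refine partialD_foldr _ (List.nodup_finRange d) s i (List.mem_finRange i) ?_
  rw [← List.ofFn_eq_map, List.sum_ofFn]
  exact hg

lemma mem_multiIndices {j : ℕ} {s : Fin d → ℕ} : s ∈ multiIndices d j ↔ ∑ i, s i = j := by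
  simp [multiIndices]

lemma hasDerivAt_line {g : Pt d → ℝ} (hg : ContDiff ℝ 1 g) (x v : Pt d) (t : ℝ) :
    HasDerivAt (fun t : ℝ => g (x + t • v)) (∑ i, v i * partialD i g (x + t • v)) t := by
  have h1 : HasFDerivAt g (fderiv ℝ g (x + t • v)) (x + t • v) :=
    ((hg.differentiable (by norm_num)) _).hasFDerivAt
  have h2 : HasDerivAt (fun t : ℝ => x + t • v) v t := by
    simpa using ((hasDerivAt_id t).smul_const v).const_add x
  have h3 := h1.comp_hasDerivAt t h2
  refine h3.congr_deriv ?_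
  have hv : v = ∑ i, v i • EuclideanSpace.single i (1 : ℝ) := by
    ext j
    simp [Finset.sum_apply, Pi.single_apply]
  have hP : ∀ i, partialD i g (x + t • v) =
      fderiv ℝ g (x + t • v) (EuclideanSpace.single i 1) := fun i => by
    rw [partialD_eq_fderiv hg]
  simp_rw [hP]
  calc fderiv ℝ g (x + t • v) v =
        fderiv ℝ g (x + t • v) (∑ i, v i • EuclideanSpace.single i (1 : ℝ)) := by rw [← hv]
    _ = _ := by
      rw [map_sum]
      exact Finset.sum_congr rfl fun i _ => by rw [map_smul, smul_eq_mul]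

/-- The coefficient `v^s / s!` of the multivariate Taylor formula. -/
def taylorCoeff (v : Pt d) (s : Fin d → ℕ) : ℝ := ∏ i, v i ^ s i / ((s i).factorial : ℝ)

lemma taylorCoeff_add_single (v : Pt d) (s : Fin d → ℕ) (i : Fin d) :
    ((s i : ℝ) + 1) * taylorCoeff v (s + Pi.single i 1) = v i * taylorCoeff v s := by
  rw [taylorCoeff, taylorCoeff, ← Finset.mul_prod_erase _ _ (Finset.mem_univ i),
    ← Finset.mul_prod_erase _ (fun j => v j ^ s j / ((s j).factorial : ℝ)) (Finset.mem_univ i)]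
  have : ∏ j ∈ Finset.univ.erase i, v j ^ (s + Pi.single i 1 : Fin d → ℕ) j /
      (((s + Pi.single i 1 : Fin d → ℕ) j).factorial : ℝ) =
      ∏ j ∈ Finset.univ.erase i, v j ^ s j / ((s j).factorial : ℝ) :=
    Finset.prod_congr rfl fun j hj => by simp [Finset.ne_of_mem_erase hj]
  rw [this]
  have h2 : (s + Pi.single i 1 : Fin d → ℕ) i = s i + 1 := by simp
  rw [h2, Nat.factorial_succ, pow_succ]
  have : ((s i).factorial : ℝ) ≠ 0 := by exact_mod_cast (s i).factorial_ne_zero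
  push_cast
  field_simp

/-- A multi-index r of degree j + 1 is reached from r - e_i with weight r_i, and these weights add
up to j + 1. Along a line, the degree j part of the Taylor sum thus has j + 1 times the next part as
derivative. -/
lemma sum_taylorCoeff_succ (v : Pt d) (D : (Fin d → ℕ) → ℝ) (j : ℕ) :
    ∑ s ∈ multiIndices d j, taylorCoeff v s * ∑ i, v i * D (s + Pi.single i 1) =
      (j + 1) * ∑ r ∈ multiIndices d (j + 1), taylorCoeff v r * D r := by
  have h1 : ∀ i : Fin d, ∑ s ∈ multiIndices d j, v i * taylorCoeff v s * D (s + Pi.single i 1) =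
      ∑ r ∈ multiIndices d (j + 1), (r i : ℝ) * (taylorCoeff v r * D r) := by
    intro i
    refine Finset.sum_of_injOn (fun s => s + Pi.single i 1) (fun a _ b _ h => ?_)
      (fun s hs => ?_) (fun r hr hr2 => ?_) (fun s _ => ?_)
    · exact add_right_cancel h
    · have hs' := mem_multiIndices.1 hs
      refine mem_multiIndices.2 ?_
      simp [Finset.sum_add_distrib, hs']
    · by_cases h0 : r i = 0
      · simp [h0]
      · exfalso
        apply hr2
        have hle : Pi.single i 1 ≤ r := by
          intro l
          by_cases hl : l = i
          · subst hl; simp; omega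
          · simp [hl]
        refine ⟨r - Pi.single i 1, mem_multiIndices.2 ?_, tsub_add_cancel_of_le hle⟩
        have hr' := mem_multiIndices.1 hr
        have h2 : ∑ l, (r - Pi.single i 1 + Pi.single i 1 : Fin d → ℕ) l = j + 1 := by
          rw [tsub_add_cancel_of_le hle]; exact hr'
        simp only [Pi.add_apply, Finset.sum_add_distrib] at h2
        simp at h2
        simpa using h2
    · have h2 : (((s + Pi.single i 1 : Fin d → ℕ) i : ℕ) : ℝ) = s i + 1 := by simp
      simp only
      rw [h2, ← mul_assoc, taylorCoeff_add_single]
  calc _ = ∑ i, ∑ s ∈ multiIndices d j, v i * taylorCoeff v s * D (s + Pi.single i 1) := by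
        rw [Finset.sum_comm]
        refine Finset.sum_congr rfl fun s _ => ?_
        rw [Finset.mul_sum]
        exact Finset.sum_congr rfl fun i _ => by ring
    _ = ∑ r ∈ multiIndices d (j + 1), ∑ i, (r i : ℝ) * (taylorCoeff v r * D r) := by
        rw [Finset.sum_comm (s := multiIndices d (j + 1))]
        exact Finset.sum_congr rfl fun i _ => h1 i
    _ = _ := by
        rw [Finset.mul_sum]
        refine Finset.sum_congr rfl fun r hr => ?_
        rw [← Finset.sum_mul]
        congr 1
        have := mem_multiIndices.1 hr
        exact_mod_cast this

/-- F j plays the role of the j-th derivative divided by j!. The function ∑_{j<k} (1-t)^j F_j(t) +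
(1-t)^k F_k(0) goes from the Taylor sum at t = 0 to F_0(1) at t = 1, and its derivative telescopes
to k (1-t)^{k-1} (F_k(t) - F_k(0)). The crude factor k only enters `biasConst`. -/
lemma abs_taylor_remainder_le {k : ℕ} (hk : 0 < k) (F : ℕ → ℝ → ℝ)
    (hF : ∀ j < k, ∀ t, HasDerivAt (F j) ((j + 1) * F (j + 1) t) t) {B : ℝ}
    (hB : ∀ t ∈ Set.Icc (0 : ℝ) 1, |F k t - F k 0| ≤ B) :
    |F 0 1 - ∑ j ∈ Finset.range (k + 1), F j 0| ≤ k * B := by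
  have hG : ∀ m ≤ k, ∀ t, HasDerivAt (fun t => ∑ j ∈ Finset.range m, (1 - t) ^ j * F j t)
      (m * (1 - t) ^ (m - 1) * F m t) t := by
    intro m
    induction m with
    | zero => intro _ t; simpa using hasDerivAt_const t (0 : ℝ)
    | succ m ih =>
      intro hm t
      simp only [Finset.sum_range_succ]
      have h1 : HasDerivAt (fun t : ℝ => (1 - t) ^ m) (-(m * (1 - t) ^ (m - 1))) t := by
        exact (((hasDerivAt_id t).const_sub 1).pow m).congr_deriv (by simp)
      have h2 := (ih (by omega) t).add (h1.mul (hF m (by omega) t))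
      refine h2.congr_deriv ?_
      push_cast
      ring
  have hH : ∀ t, HasDerivAt
      (fun t => ∑ j ∈ Finset.range k, (1 - t) ^ j * F j t + (1 - t) ^ k * F k 0)
      (k * (1 - t) ^ (k - 1) * (F k t - F k 0)) t := by
    intro t
    have h1 : HasDerivAt (fun t : ℝ => (1 - t) ^ k) (-(k * (1 - t) ^ (k - 1))) t := by
      exact (((hasDerivAt_id t).const_sub 1).pow k).congr_deriv (by simp)
    have h2 := (hG k le_rfl t).add (h1.mul_const (F k 0))
    refine h2.congr_deriv ?_
    ring
  have hB0 : 0 ≤ B := (abs_nonneg _).trans (hB 0 (by simp))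
  have h := norm_image_sub_le_of_norm_deriv_le_segment_01' (C := k * B)
    (fun t _ => (hH t).hasDerivWithinAt) fun t ht => by
      rw [Real.norm_eq_abs, abs_mul, abs_mul, abs_pow, Nat.abs_cast]
      have h1 : |1 - t| ^ (k - 1) ≤ 1 :=
        pow_le_one₀ (abs_nonneg _) (abs_le.2 ⟨by linarith [ht.2], by linarith [ht.1]⟩)
      have h2 := hB t ⟨ht.1, ht.2.le⟩
      have h3 : (k : ℝ) * |1 - t| ^ (k - 1) ≤ k := mul_le_of_le_one_right (by positivity) h1
      exact mul_le_mul h3 h2 (abs_nonneg _) (by positivity)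
  rw [Real.norm_eq_abs] at h
  convert h using 2
  obtain ⟨m, rfl⟩ : ∃ m, k = m + 1 := ⟨k - 1, by omega⟩
  rw [Finset.sum_range_succ _ (m + 1)]
  simp [Finset.sum_range_succ' _ m]

lemma norm_le_sqrt_mul {v : Pt d} {h : ℝ} (hv : ∀ i, |v i| ≤ h) : ‖v‖ ≤ Real.sqrt d * h := by
  rcases Nat.eq_zero_or_pos d with rfl | hd
  · simp [EuclideanSpace.norm_eq]
  have h0 : 0 ≤ h := (abs_nonneg _).trans (hv ⟨0, hd⟩)
  rw [EuclideanSpace.norm_eq, ← Real.sqrt_sq h0, ← Real.sqrt_mul (by positivity)]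
  refine Real.sqrt_le_sqrt ?_
  calc ∑ i, ‖v i‖ ^ 2 ≤ ∑ _i : Fin d, h ^ 2 := Finset.sum_le_sum fun i _ =>
        pow_le_pow_left₀ (norm_nonneg _) (hv i) 2
    _ = _ := by simp

lemma mixedPartial_zero (g : Pt d → ℝ) : mixedPartial 0 g = g := by
  have : ∀ L : List (Fin d),
      L.foldr (fun i f => (partialD i)^[(0 : Fin d → ℕ) i] f) g = g := fun L => by
    induction L with
    | nil => rfl
    | cons i L ih => rw [List.foldr_cons, ih]; rfl
  exact this _

lemma mixedPartial_single {g : Pt d → ℝ} (hg : ContDiff ℝ 1 g) (i : Fin d) :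
    mixedPartial (Pi.single i 1) g = partialD i g := by
  have h := partialD_mixedPartial 0 i (g := g) (by simpa using hg)
  rw [mixedPartial_zero, zero_add] at h
  exact h.symm

lemma sum_abs_partialD_eq {g : Pt d → ℝ} (hg : ContDiff ℝ 1 g) (x : Pt d) :
    ∑ i, |partialD i g x| ≤ ∑ s ∈ multiIndices d 1, |mixedPartial s g x| := by
  have hinj : Function.Injective fun i : Fin d => (Pi.single i 1 : Fin d → ℕ) := by
    intro i j h
    by_contra hij
    have := congrFun h i
    simp [hij] at this
  calc ∑ i, |partialD i g x| = ∑ s ∈ Finset.univ.image fun i : Fin d => (Pi.single i 1 : Fin d → ℕ),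
        |mixedPartial s g x| := by
        rw [Finset.sum_image hinj.injOn]
        exact Finset.sum_congr rfl fun i _ => by rw [mixedPartial_single hg]
    _ ≤ _ := by
        refine Finset.sum_le_sum_of_subset_of_nonneg (fun s hs => ?_) fun _ _ _ => abs_nonneg _
        obtain ⟨i, -, rfl⟩ := Finset.mem_image.1 hs
        exact mem_multiIndices.2 (by simp)

variable {lam α : ℝ} {η : Pt d → ℝ}

lemma HolderClass.contDiff_one (h : HolderClass lam α η) (hα : 1 < α) : ContDiff ℝ 1 η :=
  (h.2.2 hα).1.of_le (by exact_mod_cast (Nat.one_le_floor_iff α).2 hα.le)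

lemma HolderClass.lipschitz (h : HolderClass lam α η) (hα : 1 < α) (x y : Pt d) :
    |η x - η y| ≤ lam * ‖x - y‖ := by
  have h1 := h.contDiff_one hα
  have hb : ∀ z, ∑ i, |partialD i η z| ≤ lam := fun z =>
    (sum_abs_partialD_eq h1 z).trans ((h.2.2 hα).2.1 1 (by simpa using hα.le) z)
  have hl := norm_image_sub_le_of_norm_deriv_le_segment_01' (C := lam * ‖x - y‖)
    (fun t _ => (hasDerivAt_line h1 y (x - y) t).hasDerivWithinAt) fun t _ => by
      rw [Real.norm_eq_abs]
      refine (Finset.abs_sum_le_sum_abs _ _).trans ?_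
      calc _ ≤ ∑ i, ‖x - y‖ * |partialD i η (y + t • (x - y))| :=
            Finset.sum_le_sum fun i _ => by
              rw [abs_mul]
              exact mul_le_mul_of_nonneg_right (PiLp.norm_apply_le (x - y) i) (abs_nonneg _)
        _ ≤ _ := by
          rw [← Finset.mul_sum, mul_comm]
          exact mul_le_mul_of_nonneg_right (hb _) (norm_nonneg _)
  simpa using hl

/-- At distances up to 1 a smaller exponent weakens the bound; beyond 1, |η x - η y| ≤ 1 ≤ λ. So a
phase run with too small an exponent can keep the same λ. -/
lemma HolderClass.holder_le (h : HolderClass lam α η) (hlam : 1 ≤ lam) {a : ℝ} (ha : 0 < a)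
    (ha1 : a ≤ 1) (haα : a ≤ α) (x y : Pt d) : |η x - η y| ≤ lam * ‖x - y‖ ^ a := by
  have hlam0 : 0 ≤ lam := by linarith
  rcases le_total ‖x - y‖ 1 with h1 | h1
  · rcases le_or_gt α 1 with hα | hα
    · refine (h.2.1 hα x y).trans (mul_le_mul_of_nonneg_left ?_ hlam0)
      exact Real.rpow_le_rpow_of_exponent_ge' (norm_nonneg _) h1 ha.le haα
    · refine (h.lipschitz hα x y).trans (mul_le_mul_of_nonneg_left ?_ hlam0)
      calc ‖x - y‖ = ‖x - y‖ ^ (1 : ℝ) := (Real.rpow_one _).symm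
        _ ≤ _ := Real.rpow_le_rpow_of_exponent_ge' (norm_nonneg _) h1 ha.le ha1
  · have h2 : |η x - η y| ≤ 1 := by
      have hx := h.1 x
      have hy := h.1 y
      exact abs_le.2 ⟨by linarith [hx.1, hy.2], by linarith [hx.2, hy.1]⟩
    have h3 := Real.one_le_rpow h1 ha.le
    nlinarith

lemma HolderClass.continuous (h : HolderClass lam α η) (hα : 0 < α) : Continuous η := by
  rcases le_or_gt α 1 with h1 | h1
  · rw [continuous_iff_continuousAt]
    intro x
    rw [ContinuousAt, tendsto_iff_norm_sub_tendsto_zero]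
    refine squeeze_zero (fun _ => norm_nonneg _) (fun y => h.2.1 h1 y x) ?_
    have : Filter.Tendsto (fun y => lam * ‖y - x‖ ^ α) (nhds x) (nhds (lam * ‖x - x‖ ^ α)) := by
      refine Continuous.tendsto ?_ x
      exact continuous_const.mul ((continuous_id.sub continuous_const).norm.rpow_const
        fun _ => Or.inr hα.le)
    simpa [Real.zero_rpow hα.ne'] using this
  · exact (h.contDiff_one h1).continuous

lemma abs_taylorCoeff_le {v : Pt d} {r : ℝ} (hv : ∀ i, |v i| ≤ r) (s : Fin d → ℕ) :
    |taylorCoeff v s| ≤ r ^ ∑ i, s i := by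
  rw [taylorCoeff, Finset.abs_prod, ← Finset.prod_pow_eq_pow_sum]
  refine Finset.prod_le_prod (fun _ _ => abs_nonneg _) fun i _ => ?_
  rw [abs_div, abs_pow, Nat.abs_cast]
  have h1 : (1 : ℝ) ≤ (s i).factorial := by exact_mod_cast (s i).factorial_pos
  exact (div_le_self (by positivity) h1).trans (pow_le_pow_left₀ (abs_nonneg _) (hv i) _)

lemma HolderClass.taylor_le (h : HolderClass lam α η) (hα : 1 < α) (hd : 0 < d) (hlam : 0 ≤ lam)
    {r : ℝ} (hr : 0 < r) (x v : Pt d) (hv : ∀ i, |v i| ≤ r) :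
    |η (x + v) - ∑ j ∈ Finset.range (⌊α⌋₊ + 1), ∑ s ∈ multiIndices d j,
      taylorCoeff v s * mixedPartial s η x| ≤ ⌊α⌋₊ * (lam * Real.sqrt d * r ^ α) := by
  obtain ⟨hC, -, hH⟩ := h.2.2 hα
  set k := ⌊α⌋₊ with hk
  have hk0 : 0 < k := Nat.floor_pos.2 hα.le
  have hka : (k : ℝ) ≤ α := Nat.floor_le (by linarith)
  have hka1 : α - k ≤ 1 := by have := Nat.lt_floor_add_one α; rw [← hk] at this; linarith
  set F : ℕ → ℝ → ℝ := fun j t => ∑ s ∈ multiIndices d j,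
    taylorCoeff v s * mixedPartial s η (x + t • v) with hF
  have hder : ∀ j < k, ∀ t, HasDerivAt (F j) ((j + 1) * F (j + 1) t) t := by
    intro j hj t
    have h1 : ∀ s ∈ multiIndices d j, HasDerivAt
        (fun t : ℝ => taylorCoeff v s * mixedPartial s η (x + t • v))
        (taylorCoeff v s * ∑ i, v i * mixedPartial (s + Pi.single i 1) η (x + t • v)) t := by
      intro s hs
      have hs' := mem_multiIndices.1 hs
      have hCs : ContDiff ℝ ((∑ i, s i + 1 : ℕ) : ℕ∞) η :=
        hC.of_le (by exact_mod_cast (by omega : ∑ i, s i + 1 ≤ k))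
      have hm : ContDiff ℝ 1 (mixedPartial s η) := by
        have := contDiff_mixedPartial s (m := 1) (g := η) (by rwa [add_comm])
        exact this.of_le (by norm_num)
      have h2 := (hasDerivAt_line hm x v t).const_mul (taylorCoeff v s)
      refine h2.congr_deriv ?_
      congr 1
      exact Finset.sum_congr rfl fun i _ => by rw [partialD_mixedPartial s i hCs]
    have h3 := HasDerivAt.fun_sum h1
    refine h3.congr_deriv ?_
    exact sum_taylorCoeff_succ v (fun s => mixedPartial s η (x + t • v)) j
  have hB : ∀ t ∈ Set.Icc (0 : ℝ) 1, |F k t - F k 0| ≤ lam * Real.sqrt d * r ^ α := by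
    intro t ht
    rw [hF]
    simp only [zero_smul, add_zero]
    rw [← Finset.sum_sub_distrib]
    have hnorm : ‖(x + t • v) - x‖ ≤ Real.sqrt d * r := by
      rw [add_sub_cancel_left, norm_smul, Real.norm_eq_abs, abs_of_nonneg ht.1]
      exact (mul_le_of_le_one_left (norm_nonneg _) ht.2).trans (norm_le_sqrt_mul hv)
    have hd1 : 1 ≤ Real.sqrt d := Real.one_le_sqrt.2 (by exact_mod_cast hd)
    calc _ ≤ ∑ s ∈ multiIndices d k, r ^ k * |mixedPartial s η (x + t • v) - mixedPartial s η x| := by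
          refine (Finset.abs_sum_le_sum_abs _ _).trans (Finset.sum_le_sum fun s hs => ?_)
          rw [← mul_sub, abs_mul]
          refine mul_le_mul_of_nonneg_right ?_ (abs_nonneg _)
          have := abs_taylorCoeff_le hv s
          rwa [mem_multiIndices.1 hs] at this
      _ ≤ r ^ k * (lam * ‖(x + t • v) - x‖ ^ (α - k)) := by
          rw [← Finset.mul_sum]
          exact mul_le_mul_of_nonneg_left (hH _ _) (by positivity)
      _ ≤ r ^ k * (lam * (Real.sqrt d * r ^ (α - k))) := by
          gcongr
          calc ‖(x + t • v) - x‖ ^ (α - k) ≤ (Real.sqrt d * r) ^ (α - k) :=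
                Real.rpow_le_rpow (norm_nonneg _) hnorm (by linarith)
            _ = Real.sqrt d ^ (α - k) * r ^ (α - k) := Real.mul_rpow (by positivity) hr.le
            _ ≤ _ := by
                gcongr
                exact Real.rpow_le_self_of_one_le hd1 hka1
      _ = lam * Real.sqrt d * r ^ α := by
          have : r ^ α = r ^ k * r ^ (α - k) := by
            rw [← Real.rpow_natCast, ← Real.rpow_add hr]; congr 1; ring
          rw [this]; ring
  have := abs_taylor_remainder_le hk0 F hder hB
  have h01 : F 0 1 = η (x + v) := by
    have h0 : multiIndices d 0 = {0} := by
      ext s; rw [mem_multiIndices]; simp [funext_iff]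
    rw [hF]
    simp [h0, mixedPartial_zero, taylorCoeff]
  rw [h01] at this
  simpa [hF] using this

end Taylor

/-! ### Moments of the product kernel and bias of the kernel estimator. -/

section Bias
variable {d : ℕ}

lemma measurableEmbedding_ofLp :
    MeasurableEmbedding (WithLp.ofLp : Pt d → (Fin d → ℝ)) :=
  (MeasurableEquiv.toLp 2 (Fin d → ℝ)).symm.measurableEmbedding

lemma integral_prod_coord (f : Fin d → ℝ → ℝ) :
    ∫ u : Pt d, ∏ i, f i (u i) = ∏ i, ∫ t, f i t := by
  rw [← integral_fintype_prod_volume_eq_prod]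
  exact (PiLp.volume_preserving_ofLp (Fin d)).integral_comp measurableEmbedding_ofLp
    (fun u : Fin d → ℝ => ∏ i, f i (u i))

lemma integrable_prod_coord {f : Fin d → ℝ → ℝ} (hf : ∀ i, Integrable (f i)) :
    Integrable fun u : Pt d => ∏ i, f i (u i) := by
  have h := Integrable.fintype_prod (μ := fun _ : Fin d => (volume : Measure ℝ)) hf
  exact ((PiLp.volume_preserving_ofLp (Fin d)).integrable_comp_emb measurableEmbedding_ofLp).2 h

lemma integrable_legendreKernel_pow (a : ℝ) (s : ℕ) :
    Integrable fun t => legendreKernel a t * t ^ s := by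
  have hI : IntegrableOn (fun t : ℝ => legendreKernel a t * t ^ s) (Set.Icc (-1) 1) := by
    refine Measure.integrableOn_of_bounded (M := 4 * (⌊a⌋₊ + 1)) (by simp)
      ((measurable_legendreKernel a).mul (measurable_id.pow_const s)).aestronglyMeasurable ?_
    refine (ae_restrict_iff' measurableSet_Icc).2 (Filter.Eventually.of_forall fun t ht => ?_)
    rw [Real.norm_eq_abs, abs_mul, abs_pow]
    have h1 := abs_legendreKernel_le a t
    have h2 : |t| ^ s ≤ 1 := pow_le_one₀ (abs_nonneg _) (abs_le.2 ht)
    nlinarith [abs_nonneg (legendreKernel a t), pow_nonneg (abs_nonneg t) s]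
  refine (integrableOn_iff_integrable_of_support_subset fun t ht => ?_).1 hI
  by_contra h
  refine ht ?_
  simp only
  rw [legendreKernel_eq_zero a fun h' => h (abs_le.1 h'), zero_mul]

lemma integral_abs_legendreKernel_le (a : ℝ) :
    ∫ t, |legendreKernel a t| ≤ 8 * (⌊a⌋₊ + 1) := by
  have h0 : ∫ t, |legendreKernel a t| = ∫ t in Set.Icc (-1 : ℝ) 1, |legendreKernel a t| := by
    refine (setIntegral_eq_integral_of_forall_compl_eq_zero fun t ht => ?_).symm
    rw [legendreKernel_eq_zero a fun h' => ht (abs_le.1 h'), abs_zero]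
  rw [h0]
  have h1 := norm_setIntegral_le_of_norm_le_const (μ := volume) (s := Set.Icc (-1 : ℝ) 1)
    (f := fun t => |legendreKernel a t|) (C := 4 * (⌊a⌋₊ + 1)) (by simp) fun t _ => by
      rw [Real.norm_eq_abs, abs_abs]; exact abs_legendreKernel_le a t
  rw [Real.norm_eq_abs, Real.volume_real_Icc_of_le (by norm_num)] at h1
  exact (le_abs_self _).trans (h1.trans (by linarith))

lemma productKernel_eq_zero (a : ℝ) {u : Pt d} {i : Fin d} (hi : 1 < |u i|) :
    productKernel a u = 0 :=
  Finset.prod_eq_zero (Finset.mem_univ i) (legendreKernel_eq_zero a (not_le.2 hi))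

lemma abs_productKernel_le (a : ℝ) (u : Pt d) :
    |productKernel a u| ≤ (4 * (⌊a⌋₊ + 1)) ^ d := by
  rw [productKernel, Finset.abs_prod]
  calc _ ≤ ∏ _i : Fin d, (4 * ((⌊a⌋₊ : ℝ) + 1)) :=
        Finset.prod_le_prod (fun _ _ => abs_nonneg _) fun i _ => abs_legendreKernel_le a _
    _ = _ := by simp

lemma measurable_productKernel (a : ℝ) : Measurable (productKernel a : Pt d → ℝ) := by
  refine Finset.measurable_prod _ fun i _ => (measurable_legendreKernel a).comp ?_
  fun_prop

lemma integrable_legendreKernel (a : ℝ) : Integrable (legendreKernel a) := by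
  simpa using integrable_legendreKernel_pow a 0

lemma integrable_productKernel (a : ℝ) : Integrable (productKernel a : Pt d → ℝ) :=
  integrable_prod_coord fun _ => integrable_legendreKernel a

lemma integral_abs_productKernel_le (a : ℝ) :
    ∫ u : Pt d, |productKernel a u| ≤ (8 * (⌊a⌋₊ + 1)) ^ d := by
  simp only [productKernel, Finset.abs_prod]
  rw [integral_prod_coord (fun _ t => |legendreKernel a t|)]
  calc _ ≤ ∏ _i : Fin d, (8 * ((⌊a⌋₊ : ℝ) + 1)) :=
        Finset.prod_le_prod (fun _ _ => integral_nonneg fun _ => abs_nonneg _)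
          fun i _ => integral_abs_legendreKernel_le a
    _ = _ := by simp

lemma productKernel_mul_taylorCoeff (a h : ℝ) (s : Fin d → ℕ) (u : Pt d) :
    productKernel a u * taylorCoeff (-(h • u)) s =
      ∏ i, legendreKernel a (u i) * u i ^ s i * ((-h) ^ s i / ((s i).factorial : ℝ)) := by
  rw [productKernel, taylorCoeff, ← Finset.prod_mul_distrib]
  refine Finset.prod_congr rfl fun i _ => ?_
  have : (-(h • u)) i = u i * (-h) := by simp; ring
  rw [this, mul_pow]; ring

/-- The normalized moments of the product kernel. -/
def kernelMoment (a : ℝ) (s : Fin d → ℕ) : ℝ :=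
  ∏ i, (∫ t, legendreKernel a t * t ^ s i) / ((s i).factorial : ℝ)

lemma integral_productKernel_mul_taylorCoeff (a h : ℝ) (s : Fin d → ℕ) :
    ∫ u : Pt d, productKernel a u * taylorCoeff (-(h • u)) s =
      (-h) ^ (∑ i, s i) * kernelMoment a s := by
  simp_rw [productKernel_mul_taylorCoeff]
  rw [integral_prod_coord
    (fun i t => legendreKernel a t * t ^ s i * ((-h) ^ s i / ((s i).factorial : ℝ))),
    kernelMoment, ← Finset.prod_pow_eq_pow_sum, ← Finset.prod_mul_distrib]
  refine Finset.prod_congr rfl fun i _ => ?_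
  rw [integral_mul_const]; ring

lemma integrable_productKernel_mul_taylorCoeff (a h : ℝ) (s : Fin d → ℕ) :
    Integrable fun u : Pt d => productKernel a u * taylorCoeff (-(h • u)) s := by
  simp_rw [productKernel_mul_taylorCoeff]
  exact integrable_prod_coord
    (f := fun i t => legendreKernel a t * t ^ s i * ((-h) ^ s i / ((s i).factorial : ℝ)))
    fun i => (integrable_legendreKernel_pow a (s i)).mul_const _

lemma abs_kernelMoment_le (a : ℝ) (ha : 1 ≤ a) (s : Fin d → ℕ) : |kernelMoment a s| ≤ 1 := by
  rw [kernelMoment, Finset.abs_prod]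
  refine Finset.prod_le_one (fun _ _ => abs_nonneg _) fun i _ => ?_
  rw [abs_div, Nat.abs_cast]
  exact div_le_one_of_le₀ (abs_integral_legendreKernel_pow_le a ha _) (by positivity)

lemma kernelMoment_eq_zero (a : ℝ) {s : Fin d → ℕ} (h0 : 0 < ∑ i, s i)
    (h1 : ∑ i, s i ≤ ⌊a⌋₊) : kernelMoment a s = 0 := by
  obtain ⟨i, -, hi⟩ := Finset.exists_ne_zero_of_sum_ne_zero h0.ne'
  refine Finset.prod_eq_zero (Finset.mem_univ i) ?_
  have : s i ≤ ∑ i, s i := Finset.single_le_sum (fun _ _ => Nat.zero_le _) (Finset.mem_univ i)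
  rw [integral_legendreKernel_pow_eq_zero a (Nat.pos_of_ne_zero hi) (this.trans h1), zero_div]

lemma kernelMoment_zero (a : ℝ) : kernelMoment a (0 : Fin d → ℕ) = 1 := by
  refine Finset.prod_eq_one fun i _ => ?_
  have := integral_legendreKernel_pow_zero a
  simp only [Pi.zero_apply, this]; simp

/-- The constant in front of the smoothness remainder in the bias of the kernel estimator. -/
def biasConst (d : ℕ) (α : ℝ) : ℝ := (8 * (⌊α⌋₊ + 1)) ^ d * (⌊α⌋₊ * Real.sqrt d)

lemma sum_pow_Ico_le {h : ℝ} (h0 : 0 < h) (h1 : h ≤ 1 / 2) (m k : ℕ) :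
    ∑ j ∈ Finset.Ico m k, h ^ j ≤ 2 * h ^ m := by
  rcases le_or_gt m k with hmk | hmk
  · rw [geom_sum_Ico' (by linarith) hmk, div_le_iff₀ (by linarith)]
    nlinarith [pow_pos h0 m, pow_pos h0 k]
  · rw [Finset.Ico_eq_empty (by omega), Finset.sum_empty]; positivity

/-- The order of the kernel is governed by a, the smoothness of η by α ≥ a. In Taylor's formula of
order ⌊α⌋ the degrees 1, …, ⌊a⌋ integrate to zero, and the degrees from ⌊a⌋ + 1 to ⌊α⌋ form a
geometric series with an absolute constant. Only the remainder carries a constant depending on α.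
The two are kept apart because the threshold of the algorithm absorbs only the first. -/
lemma HolderClass.kernel_bias_le {lam α a h : ℝ} {η : Pt d → ℝ} (hη : HolderClass lam α η)
    (hd : 0 < d) (hlam : 0 ≤ lam) (ha : 1 < a) (haα : a ≤ α) (h0 : 0 < h) (h1 : h ≤ 1 / 2)
    (x : Pt d) :
    |(∫ u : Pt d, productKernel a u * η (x - h • u)) - η x| ≤
      2 * lam * h ^ a + biasConst d α * lam * h ^ α := by
  have hα : 1 < α := by linarith
  set k := ⌊α⌋₊ with hk
  set p := ⌊a⌋₊ with hp
  have hpk : p ≤ k := Nat.floor_le_floor haα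
  set T : Pt d → ℝ := fun u => ∑ j ∈ Finset.range (k + 1), ∑ s ∈ multiIndices d j,
    taylorCoeff (-(h • u)) s * mixedPartial s η x with hT
  set B := (k : ℝ) * (lam * Real.sqrt d * h ^ α) with hB
  have hB0 : 0 ≤ B := by positivity
  have hKT : (fun u : Pt d => productKernel a u * T u) = fun u => ∑ j ∈ Finset.range (k + 1),
      ∑ s ∈ multiIndices d j, productKernel a u * taylorCoeff (-(h • u)) s * mixedPartial s η x := by
    ext u
    simp only [hT, Finset.mul_sum, mul_assoc]
  have hKTint : Integrable fun u : Pt d => productKernel a u * T u := by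
    rw [hKT]
    exact integrable_finsetSum _ fun j _ => integrable_finsetSum _ fun s _ =>
      (integrable_productKernel_mul_taylorCoeff a h s).mul_const _
  have hKη : Integrable fun u : Pt d => productKernel a u * η (x - h • u) := by
    have hc : Continuous fun u : Pt d => η (x - h • u) :=
      (hη.continuous (by linarith)).comp (by fun_prop)
    have := (integrable_productKernel a (d := d)).bdd_mul (c := 1) hc.aestronglyMeasurable
      (Filter.Eventually.of_forall fun u => by
        rw [Real.norm_eq_abs, abs_of_nonneg (hη.1 _).1]; exact (hη.1 _).2)
    simpa only [mul_comm] using this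
  have hrem : |(∫ u : Pt d, productKernel a u * η (x - h • u)) - ∫ u, productKernel a u * T u| ≤
      biasConst d α * lam * h ^ α := by
    rw [← integral_sub hKη hKTint]
    have hpt : ∀ u : Pt d, ‖productKernel a u * η (x - h • u) - productKernel a u * T u‖ ≤
        |productKernel a u| * B := by
      intro u
      rw [← mul_sub, Real.norm_eq_abs, abs_mul]
      by_cases hu : ∀ i, |u i| ≤ 1
      · refine mul_le_mul_of_nonneg_left ?_ (abs_nonneg _)
        have := hη.taylor_le hα hd hlam h0 x (-(h • u)) fun i => by
          simp only [PiLp.neg_apply, PiLp.smul_apply, smul_eq_mul, abs_neg, abs_mul, abs_of_pos h0]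
          nlinarith [hu i]
        rwa [← sub_eq_add_neg] at this
      · push Not at hu
        obtain ⟨i, hi⟩ := hu
        rw [productKernel_eq_zero a hi]; simp
    rw [← Real.norm_eq_abs]
    refine (norm_integral_le_of_norm_le ((integrable_productKernel a).abs.mul_const B)
      (Filter.Eventually.of_forall hpt)).trans ?_
    rw [integral_mul_const]
    have h2 : ∫ u : Pt d, |productKernel a u| ≤ (8 * ((k : ℝ) + 1)) ^ d := by
      refine (integral_abs_productKernel_le a).trans ?_
      have : (p : ℝ) ≤ k := by exact_mod_cast hpk
      gcongr
    refine (mul_le_mul_of_nonneg_right h2 hB0).trans (le_of_eq ?_)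
    rw [biasConst, hB]; ring
  have hmain : ∫ u, productKernel a u * T u = ∑ j ∈ Finset.range (k + 1),
      ∑ s ∈ multiIndices d j, (-h) ^ j * kernelMoment a s * mixedPartial s η x := by
    rw [hKT, integral_finsetSum _ fun j _ => integrable_finsetSum _ fun s _ =>
      (integrable_productKernel_mul_taylorCoeff a h s).mul_const _]
    refine Finset.sum_congr rfl fun j _ => ?_
    rw [integral_finsetSum _ fun s _ =>
      (integrable_productKernel_mul_taylorCoeff a h s).mul_const _]
    refine Finset.sum_congr rfl fun s hs => ?_
    rw [integral_mul_const, integral_productKernel_mul_taylorCoeff, mem_multiIndices.1 hs]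
  have hzero : ∑ s ∈ multiIndices d 0, (-h) ^ 0 * kernelMoment a s * mixedPartial s η x = η x := by
    have h0 : multiIndices d 0 = {0} := by
      ext s; rw [mem_multiIndices]; simp [funext_iff]
    rw [h0, Finset.sum_singleton, kernelMoment_zero, mixedPartial_zero]; simp
  have hterm : ∀ j ∈ Finset.Ico 1 (k + 1),
      |∑ s ∈ multiIndices d j, (-h) ^ j * kernelMoment a s * mixedPartial s η x| ≤
        if p + 1 ≤ j then lam * h ^ j else 0 := by
    intro j hj
    obtain ⟨hj1, hj2⟩ := Finset.mem_Ico.1 hj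
    split_ifs with hpj
    · refine (Finset.abs_sum_le_sum_abs _ _).trans ?_
      have hjα : (j : ℝ) ≤ α := (Nat.le_floor_iff (by linarith)).1 (by omega)
      calc _ ≤ ∑ s ∈ multiIndices d j, h ^ j * |mixedPartial s η x| :=
            Finset.sum_le_sum fun s _ => by
              rw [abs_mul, abs_mul, abs_pow, abs_neg, abs_of_pos h0]
              have := abs_kernelMoment_le a ha.le s
              gcongr
              exact mul_le_of_le_one_right (by positivity) this
        _ ≤ _ := by
          rw [← Finset.mul_sum, mul_comm]
          exact mul_le_mul_of_nonneg_right ((hη.2.2 hα).2.1 j hjα x) (by positivity)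
    · rw [Finset.sum_eq_zero, abs_zero]
      intro s hs
      have := mem_multiIndices.1 hs
      rw [kernelMoment_eq_zero a (by omega) (by omega)]; ring
  have hmid : |(∫ u, productKernel a u * T u) - η x| ≤ 2 * lam * h ^ a := by
    rw [hmain, Finset.range_eq_Ico, Finset.sum_eq_sum_Ico_succ_bot (by omega), hzero,
      add_sub_cancel_left]
    refine (Finset.abs_sum_le_sum_abs _ _).trans ((Finset.sum_le_sum hterm).trans ?_)
    rw [← Finset.sum_filter]
    have hsub : (Finset.Ico (0 + 1) (k + 1)).filter (fun j => p + 1 ≤ j) =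
        Finset.Ico (p + 1) (k + 1) := by
      ext j; simp only [Finset.mem_filter, Finset.mem_Ico]; omega
    rw [hsub, ← Finset.mul_sum]
    have hle : h ^ (p + 1) ≤ h ^ a := by
      rw [← Real.rpow_natCast]
      refine Real.rpow_le_rpow_of_exponent_ge h0 (by linarith) ?_
      push_cast
      exact (Nat.lt_floor_add_one a).le
    nlinarith [sum_pow_Ico_le h0 h1 (p + 1) (k + 1)]
  calc _ ≤ _ := abs_sub_le _ (∫ u, productKernel a u * T u) _
    _ ≤ _ := by linarith

end Bias

/-! ### Dyadic cells: partition, nesting, centers and inflated cells. -/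

section Geometry
variable {d : ℕ}

lemma mem_grid {l : ℕ} {c : Fin d → ℕ} : c ∈ grid d l ↔ ∀ i, c i < 2 ^ l := by
  simp [grid]

lemma card_grid (l : ℕ) : (grid d l).card = 2 ^ (l * d) := by
  simp [grid, pow_mul]

/-- The index of the cell of `G_l` containing a point of the unit cube. -/
def cellIdx (l : ℕ) (x : Pt d) : Fin d → ℕ := fun i => min ⌊2 ^ l * x i⌋₊ (2 ^ l - 1)

lemma cellIdx_mem_grid (l : ℕ) (x : Pt d) : cellIdx l x ∈ grid d l := by
  rw [mem_grid]
  intro i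
  have : 0 < 2 ^ l := by positivity
  exact (min_le_right _ _).trans_lt (by omega)

lemma mem_cell_cellIdx {l : ℕ} {x : Pt d} (hx : x ∈ unitCube d) : x ∈ cell l (cellIdx l x) := by
  intro i
  obtain ⟨h0, h1⟩ := hx i
  have hpos : (0 : ℝ) < 2 ^ l := by positivity
  have hN : 0 < 2 ^ l := by positivity
  have hnn : 0 ≤ 2 ^ l * x i := by positivity
  rw [div_le_iff₀ hpos, lt_div_iff₀ hpos]
  rcases h1.lt_or_eq with h1 | h1
  · have hlt : ⌊2 ^ l * x i⌋₊ < 2 ^ l := by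
      rw [Nat.floor_lt hnn]; push_cast; nlinarith
    have e : cellIdx l x i = ⌊2 ^ l * x i⌋₊ := min_eq_left (by omega)
    rw [e]
    have h2 := Nat.floor_le hnn
    have h3 := Nat.lt_floor_add_one (2 ^ l * x i)
    exact ⟨by linarith, Or.inl (by linarith)⟩
  -- On the face x i = 1 the floor is 2^l, and the minimum in `cellIdx` selects the last cell.
  · have e : cellIdx l x i + 1 = 2 ^ l := by
      have : ⌊2 ^ l * x i⌋₊ = 2 ^ l := by
        rw [h1, mul_one]; have := Nat.floor_natCast (R := ℝ) (2 ^ l); push_cast at this; exact this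
      simp only [cellIdx]
      rw [this, min_eq_right (by omega)]; omega
    refine ⟨?_, Or.inr ⟨e, h1⟩⟩
    have : ((cellIdx l x i : ℕ) : ℝ) + 1 = 2 ^ l := by exact_mod_cast e
    rw [h1]; linarith

lemma eq_cellIdx_of_mem_cell {l : ℕ} {c : Fin d → ℕ} (hc : c ∈ grid d l) {x : Pt d}
    (hx : x ∈ cell l c) : c = cellIdx l x := by
  ext i
  obtain ⟨h1, h2⟩ := hx i
  have hci := mem_grid.1 hc i
  have hpos : (0 : ℝ) < 2 ^ l := by positivity
  rw [div_le_iff₀ hpos] at h1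
  simp only [cellIdx]
  rcases h2 with h2 | ⟨h2, h3⟩
  · rw [lt_div_iff₀ hpos] at h2
    have : ⌊2 ^ l * x i⌋₊ = c i := by
      rw [Nat.floor_eq_iff (by nlinarith [(c i).cast_nonneg (α := ℝ)])]
      exact ⟨by linarith, by linarith⟩
    rw [this, min_eq_left (by omega)]
  · have : ⌊2 ^ l * x i⌋₊ = 2 ^ l := by
      rw [h3, mul_one]; have := Nat.floor_natCast (R := ℝ) (2 ^ l); push_cast at this; exact this
    rw [this, min_eq_right (by omega)]; omega

lemma mem_unitCube_of_mem_cell {l : ℕ} {c : Fin d → ℕ} (hc : c ∈ grid d l) {x : Pt d}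
    (hx : x ∈ cell l c) : x ∈ unitCube d := by
  intro i
  obtain ⟨h1, h2⟩ := hx i
  have hci : (c i : ℝ) + 1 ≤ 2 ^ l := by exact_mod_cast mem_grid.1 hc i
  have hpos : (0 : ℝ) < 2 ^ l := by positivity
  refine ⟨le_trans (by positivity) h1, ?_⟩
  rcases h2 with h2 | ⟨-, h3⟩
  · exact h2.le.trans ((div_le_one hpos).2 hci)
  · exact h3.le

lemma center_mem_cell (l : ℕ) (c : Fin d → ℕ) : center l c ∈ cell l c := by
  intro i
  have hpos : (0 : ℝ) < 2 ^ l := by positivity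
  simp only [center]
  refine ⟨?_, Or.inl ?_⟩ <;> gcongr <;> linarith

lemma cell_subset_parent (l m : ℕ) (c : Fin d → ℕ) :
    cell (l + m) c ⊆ cell l fun i => c i / 2 ^ m := by
  intro x hx i
  obtain ⟨h1, h2⟩ := hx i
  have hl : (0 : ℝ) < 2 ^ l := by positivity
  have hm : (0 : ℝ) < 2 ^ m := by positivity
  have hmN : 0 < 2 ^ m := by positivity
  have h3 : ((c i / 2 ^ m : ℕ) : ℝ) * 2 ^ m ≤ c i := by exact_mod_cast Nat.div_mul_le_self _ _
  have h4 : (c i : ℝ) + 1 ≤ (((c i / 2 ^ m : ℕ) : ℝ) + 1) * 2 ^ m := by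
    have := Nat.lt_div_mul_add (a := c i) hmN
    have h5 : c i + 1 ≤ (c i / 2 ^ m + 1) * 2 ^ m := by rw [add_mul, one_mul]; omega
    exact_mod_cast h5
  have hlm : (0 : ℝ) < 2 ^ (l + m) := by positivity
  rw [pow_add] at h1
  refine ⟨le_trans ?_ h1, ?_⟩
  · rw [div_le_div_iff₀ hl (by positivity)]; nlinarith
  rcases h2 with h2 | ⟨h2, hx1⟩
  · left
    refine h2.trans_le ?_
    rw [pow_add, div_le_div_iff₀ (by positivity) hl]; nlinarith
  · right
    refine ⟨?_, hx1⟩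
    have e : c i = 2 ^ l * 2 ^ m - 1 := by rw [← pow_add]; omega
    have hlN : 0 < 2 ^ l := by positivity
    have : c i / 2 ^ m = 2 ^ l - 1 := by
      rw [e]
      refine Nat.div_eq_of_lt_le ?_ ?_
      · rw [Nat.sub_mul, one_mul]; omega
      · rw [Nat.sub_add_cancel hlN]
        have : 0 < 2 ^ l * 2 ^ m := by positivity
        omega
    simp only [this]; omega

lemma parent_mem_grid {l m : ℕ} {c : Fin d → ℕ} (hc : c ∈ grid d (l + m)) :
    (fun i => c i / 2 ^ m) ∈ grid d l := by
  rw [mem_grid] at hc ⊢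
  intro i
  rw [Nat.div_lt_iff_lt_mul (by positivity), ← pow_add]
  exact hc i

/-- The center of the small cell lies in both large cells, and cells of one grid are disjoint. -/
lemma eq_parent_of_cell_subset {l m : ℕ} {c c' : Fin d → ℕ} (hc : c ∈ grid d l)
    (hc' : c' ∈ grid d (l + m)) (h : cell (l + m) c' ⊆ cell l c) : c = fun i => c' i / 2 ^ m := by
  have h1 := center_mem_cell (l + m) c'
  rw [eq_cellIdx_of_mem_cell hc (h h1),
    eq_cellIdx_of_mem_cell (parent_mem_grid hc') (cell_subset_parent l m c' h1)]

lemma cell_cellIdx_subset {l m : ℕ} (hlm : l ≤ m) {x : Pt d} (hx : x ∈ unitCube d) :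
    cell m (cellIdx m x) ⊆ cell l (cellIdx l x) := by
  obtain ⟨k, rfl⟩ := Nat.exists_eq_add_of_le hlm
  have h1 := cell_subset_parent l k (cellIdx (l + k) x)
  have h2 := eq_cellIdx_of_mem_cell (parent_mem_grid (cellIdx_mem_grid (l + k) x))
    (h1 (mem_cell_cellIdx hx))
  rwa [h2] at h1

lemma measurableSet_cell (l : ℕ) (c : Fin d → ℕ) : MeasurableSet (cell l c) := by
  have : cell l c = ⋂ i, {x : Pt d | (c i : ℝ) / 2 ^ l ≤ x i ∧
      (x i < ((c i : ℝ) + 1) / 2 ^ l ∨ (c i + 1 = 2 ^ l ∧ x i = 1))} := by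
    ext x; simp [cell]
  rw [this]
  refine MeasurableSet.iInter fun i => ?_
  have hm : Measurable fun x : Pt d => x i := by fun_prop
  refine (measurableSet_le measurable_const hm).inter
    ((measurableSet_lt hm measurable_const).union ?_)
  exact (MeasurableSet.const _).inter (measurableSet_eq_fun hm measurable_const)

lemma abs_sub_center_le {l : ℕ} {c : Fin d → ℕ} {x : Pt d} (hx : x ∈ cell l c) (i : Fin d) :
    |x i - center l c i| ≤ 1 / 2 / 2 ^ l := by
  obtain ⟨h1, h2⟩ := hx i
  have hl : (0 : ℝ) < 2 ^ l := by positivity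
  have h3 : x i ≤ ((c i : ℝ) + 1) / 2 ^ l := by
    rcases h2 with h2 | ⟨h2, h3⟩
    · exact h2.le
    · have : (c i : ℝ) + 1 = 2 ^ l := by exact_mod_cast h2
      rw [this, div_self hl.ne']; exact h3.le
  simp only [center]
  rw [abs_le]
  constructor
  · have : ((c i : ℝ) + 1 / 2) / 2 ^ l - 1 / 2 / 2 ^ l = c i / 2 ^ l := by ring
    linarith
  · have : ((c i : ℝ) + 1 / 2) / 2 ^ l + 1 / 2 / 2 ^ l = (c i + 1) / 2 ^ l := by ring
    linarith

lemma norm_sub_center_le {l : ℕ} {c : Fin d → ℕ} {x : Pt d} (hx : x ∈ cell l c) :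
    ‖x - center l c‖ ≤ Real.sqrt d * (1 / 2 / 2 ^ l) :=
  norm_le_sqrt_mul fun i => abs_sub_center_le hx i

/-- The support of the kernel rescaled by 2^{-l} around x stays in the inflated cell, so sampling
there sees the whole convolution. -/
lemma mem_inflatedCell {l : ℕ} {c : Fin d → ℕ} {x z : Pt d} (hx : x ∈ cell l c)
    (hz : ∀ i, |x i - z i| ≤ 1 / 2 ^ l) : z ∈ inflatedCell l c := by
  intro i
  obtain ⟨h1, h2⟩ := hx i
  obtain ⟨h4, h5⟩ := abs_le.1 (hz i)
  have hl : (0 : ℝ) < 2 ^ l := by positivity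
  have h3 : x i ≤ ((c i : ℝ) + 1) / 2 ^ l := by
    rcases h2 with h2 | ⟨h2, h3⟩
    · exact h2.le
    · have : (c i : ℝ) + 1 = 2 ^ l := by exact_mod_cast h2
      rw [this, div_self hl.ne']; exact h3.le
  constructor
  · rw [sub_div]; linarith
  · have : ((c i : ℝ) + 2) / 2 ^ l = (c i + 1) / 2 ^ l + 1 / 2 ^ l := by ring
    linarith

lemma inflatedCell_eq (l : ℕ) (c : Fin d → ℕ) : inflatedCell l c = WithLp.ofLp ⁻¹'
    Set.Icc (fun i => ((c i : ℝ) - 1) / 2 ^ l) (fun i => ((c i : ℝ) + 2) / 2 ^ l) := by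
  ext x
  simp only [inflatedCell, Set.mem_ofPred_eq, Set.mem_preimage, Set.mem_Icc, Pi.le_def]
  exact forall_and

lemma volume_inflatedCell (l : ℕ) (c : Fin d → ℕ) :
    volume (inflatedCell l c) = ENNReal.ofReal ((3 / 2 ^ l) ^ d) := by
  rw [inflatedCell_eq, (PiLp.volume_preserving_ofLp (Fin d)).measure_preimage
    measurableSet_Icc.nullMeasurableSet, Real.volume_Icc_pi]
  have : ∀ i, ((c i : ℝ) + 2) / 2 ^ l - ((c i : ℝ) - 1) / 2 ^ l = 3 / 2 ^ l := fun i => by ring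
  simp only [this, Finset.prod_const, Finset.card_univ, Fintype.card_fin]
  rw [ENNReal.ofReal_pow (by positivity)]

end Geometry

/-! ### Hoeffding's inequality for the sampling model and the mean of the kernel estimator. -/

section Concentration
variable {d : ℕ} {Ω : Type*} [MeasurableSpace Ω] {μ : Measure Ω}

lemma measureReal_abs_sum_sub_ge_le [IsProbabilityMeasure μ] {X : ℕ → Ω → ℝ}
    (hind : iIndepFun X μ) (hmeas : ∀ j, Measurable (X j)) {a b m : ℝ}
    (hb : ∀ j ω, X j ω ∈ Set.Icc a b) (hm : ∀ j, ∫ ω, X j ω ∂μ = m) (n : ℕ) {ε : ℝ}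
    (hε : 0 ≤ ε) :
    μ.real {ω | ε ≤ |∑ j ∈ Finset.range n, X j ω - n * m|} ≤
      2 * Real.exp (-(2 * ε ^ 2 / (n * (b - a) ^ 2))) := by
  have hsub : ∀ j, HasSubgaussianMGF (fun ω => X j ω - m) ((‖b - a‖₊ / 2) ^ 2) μ := fun j => by
    have := hasSubgaussianMGF_of_mem_Icc (μ := μ) (hmeas j).aemeasurable (Filter.Eventually.of_forall (hb j))
    rwa [hm j] at this
  have hsub' : ∀ j, HasSubgaussianMGF (fun ω => -(X j ω - m)) ((‖b - a‖₊ / 2) ^ 2) μ :=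
    fun j => (hsub j).neg
  have hi1 : iIndepFun (fun j ω => X j ω - m) μ :=
    hind.comp (fun _ x => x - m) fun _ => by fun_prop
  have hi2 : iIndepFun (fun j ω => -(X j ω - m)) μ :=
    hind.comp (fun _ x => -(x - m)) fun _ => by fun_prop
  have h1 := HasSubgaussianMGF.measure_sum_range_ge_le_of_iIndepFun hi1 (n := n)
    (fun j _ => hsub j) hε
  have h2 := HasSubgaussianMGF.measure_sum_range_ge_le_of_iIndepFun hi2 (n := n)
    (fun j _ => hsub' j) hε
  have he : -ε ^ 2 / (2 * n * (((‖b - a‖₊ / 2) ^ 2 : NNReal) : ℝ)) =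
      -(2 * ε ^ 2 / (n * (b - a) ^ 2)) := by
    push_cast
    rw [Real.norm_eq_abs, div_pow, sq_abs]
    -- If n (b - a)² = 0, both sides divide by zero and have the value 0.
    rcases eq_or_ne ((n : ℝ) * (b - a) ^ 2) 0 with h | h
    · rw [h, show (2 : ℝ) * n * ((b - a) ^ 2 / 2 ^ 2) = 0 by
        rw [show (2 : ℝ) * n * ((b - a) ^ 2 / 2 ^ 2) = (n * (b - a) ^ 2) / 2 by ring, h]; simp]
      simp
    · have := left_ne_zero_of_mul h
      have := right_ne_zero_of_mul h
      field_simp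
  rw [he] at h1 h2
  calc μ.real {ω | ε ≤ |∑ j ∈ Finset.range n, X j ω - n * m|}
      ≤ μ.real ({ω | ε ≤ ∑ j ∈ Finset.range n, (X j ω - m)} ∪
        {ω | ε ≤ ∑ j ∈ Finset.range n, -(X j ω - m)}) := by
        refine measureReal_mono fun ω hω => ?_
        simp only [Set.mem_ofPred_eq] at hω
        simp only [Set.mem_union, Set.mem_ofPred_eq, Finset.sum_neg_distrib, Finset.sum_sub_distrib,
          Finset.sum_const, Finset.card_range, nsmul_eq_mul]
        exact le_abs.1 hω
    _ ≤ _ := (measureReal_union_le _ _).trans (by linarith)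

lemma integral_pairLaw {η : Pt d → ℝ} (hη : Measurable η) (h01 : ∀ x, η x ∈ Set.Icc (0 : ℝ) 1)
    (ν : Measure (Pt d)) [IsFiniteMeasure ν] {g : Pt d → ℝ} (hg : Measurable g) {A : ℝ}
    (hA : ∀ x, |g x| ≤ A) :
    ∫ p, g p.1 * (if p.2 = true then 1 else 0) ∂(pairLaw η ν) = ∫ x, g x * η x ∂ν := by
  have hfin : ∀ f : Pt d → ℝ, (∀ x, f x ≤ 1) →
      IsFiniteMeasure (ν.withDensity fun x => ENNReal.ofReal (f x)) := fun f hf =>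
    isFiniteMeasure_withDensity (ne_of_lt (by
      calc ∫⁻ x, ENNReal.ofReal (f x) ∂ν ≤ ∫⁻ _, 1 ∂ν := lintegral_mono fun x => by
            rw [← ENNReal.ofReal_one]; exact ENNReal.ofReal_le_ofReal (hf x)
        _ < ⊤ := by simp))
  have := hfin η fun x => (h01 x).2
  have := hfin (fun x => 1 - η x) fun x => by linarith [(h01 x).1]
  have hG : Measurable fun p : Pt d × Bool => g p.1 * (if p.2 = true then (1 : ℝ) else 0) :=
    (hg.comp measurable_fst).mul (Measurable.ite (measurable_snd (measurableSet_singleton true))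
      measurable_const measurable_const)
  have hGb : ∀ p : Pt d × Bool, ‖g p.1 * (if p.2 = true then (1 : ℝ) else 0)‖ ≤ A := fun p => by
    have h0 := (abs_nonneg _).trans (hA p.1)
    split_ifs
    · simpa using hA p.1
    · simpa using h0
  have hI : ∀ ν' : Measure (Pt d × Bool), IsFiniteMeasure ν' →
      Integrable (fun p : Pt d × Bool => g p.1 * (if p.2 = true then (1 : ℝ) else 0)) ν' :=
    fun ν' _ => Integrable.of_bound hG.aestronglyMeasurable A (Filter.Eventually.of_forall hGb)
  have mt : Measurable fun x : Pt d => (x, true) := by fun_prop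
  have mf : Measurable fun x : Pt d => (x, false) := by fun_prop
  rw [pairLaw, integral_add_measure (hI _ inferInstance) (hI _ inferInstance),
    integral_map mt.aemeasurable hG.aestronglyMeasurable,
    integral_map mf.aemeasurable hG.aestronglyMeasurable]
  simp only [if_true, mul_one, Bool.false_eq_true, if_false, mul_zero, integral_zero, add_zero]
  rw [integral_withDensity_eq_integral_toReal_smul hη.ennreal_ofReal
    (Filter.Eventually.of_forall fun x => ENNReal.ofReal_lt_top)]
  refine integral_congr_ae (Filter.Eventually.of_forall fun x => ?_)
  simp only [smul_eq_mul]
  rw [ENNReal.toReal_ofReal (h01 x).1, mul_comm]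

lemma volume_inflatedCell_ne_zero (l : ℕ) (c : Fin d → ℕ) : volume (inflatedCell l c) ≠ 0 := by
  rw [volume_inflatedCell]; simp

lemma volume_inflatedCell_ne_top (l : ℕ) (c : Fin d → ℕ) : volume (inflatedCell l c) ≠ ⊤ := by
  rw [volume_inflatedCell]; simp

instance isProbabilityMeasure_queryLaw (q : Query d) : IsProbabilityMeasure (queryLaw q) := by
  cases q with
  | atCenter l c j => exact Measure.dirac.isProbabilityMeasure
  | inInflated l c j =>
    exact cond_isProbabilityMeasure_of_finite (volume_inflatedCell_ne_zero l c)
      (volume_inflatedCell_ne_top l c)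

variable {η : Pt d → ℝ} {Z : ℕ × Query d → Ω → Pt d × Bool}

/-- A label 0 makes the summand vanish, hence the requirement that [a, b] contain 0. Injectivity of
`q` makes the summands independent. -/
lemma IsSampling.measure_deviation_le [IsProbabilityMeasure μ] (hZ : IsSampling μ η Z)
    (hη : Measurable η) (h01 : ∀ x, η x ∈ Set.Icc (0 : ℝ) 1) (q : ℕ → ℕ × Query d)
    (hq : Function.Injective q) {ν : Measure (Pt d)} (hν : ∀ j, queryLaw (q j).2 = ν)
    {g : Pt d → ℝ} (hg : Measurable g) {a b : ℝ} (ha : a ≤ 0) (hb : 0 ≤ b)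
    (hab : ∀ x, g x ∈ Set.Icc a b) (n : ℕ) {ε : ℝ} (hε : 0 ≤ ε) :
    μ.real {ω | ε ≤ |∑ j ∈ Finset.range n, g (Z (q j) ω).1 *
        (if (Z (q j) ω).2 = true then 1 else 0) - n * ∫ x, g x * η x ∂ν|} ≤
      2 * Real.exp (-(2 * ε ^ 2 / (n * (b - a) ^ 2))) := by
  have hν1 : IsProbabilityMeasure ν := hν 0 ▸ inferInstance
  have hG : Measurable fun p : Pt d × Bool => g p.1 * (if p.2 = true then (1 : ℝ) else 0) :=
    (hg.comp measurable_fst).mul (Measurable.ite (measurable_snd (measurableSet_singleton true))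
      measurable_const measurable_const)
  refine measureReal_abs_sum_sub_ge_le
    (X := fun j ω => g (Z (q j) ω).1 * (if (Z (q j) ω).2 = true then 1 else 0))
    ((hZ.indep.precomp hq).comp (fun _ p => g p.1 * (if p.2 = true then (1 : ℝ) else 0))
      fun _ => hG)
    (fun j => hG.comp (hZ.measurable _)) (fun j ω => ?_) (fun j => ?_) n hε
  · have := hab (Z (q j) ω).1
    split_ifs
    · simpa using this
    · simpa using ⟨ha, hb⟩
  · rw [← integral_pairLaw hη h01 ν hg (A := max |a| |b|)
      (fun x => abs_le_max_abs_abs (hab x).1 (hab x).2), ← hν j, ← hZ.law,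
      integral_map (hZ.measurable _).aemeasurable hG.aestronglyMeasurable]

/-- Substitution z = x - 2^{-l} u: the factor 3^d over the volume (3 · 2^{-l})^d of the inflated
cell leaves the Jacobian 2^{ld}. Passing to the whole space is free since the kernel vanishes off
the inflated cell. -/
lemma kernel_mean_eq (a : ℝ) (l : ℕ) (c : Fin d → ℕ) {x : Pt d} (hx : x ∈ cell l c) :
    3 ^ d * ∫ z, productKernel a ((2 : ℝ) ^ l • (x - z)) * η z
        ∂(ProbabilityTheory.cond volume (inflatedCell l c)) =
      ∫ u : Pt d, productKernel a u * η (x - ((2 : ℝ) ^ l)⁻¹ • u) := by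
  have h2 : (0 : ℝ) < 2 ^ l := by positivity
  rw [ProbabilityTheory.cond, integral_smul_measure, setIntegral_eq_integral_of_forall_compl_eq_zero fun z hz => ?_]
  · have e1 := integral_sub_left_eq_self
      (fun w : Pt d => productKernel a ((2 : ℝ) ^ l • w) * η (x - w)) volume x
    simp only [sub_sub_cancel] at e1
    rw [e1]
    have e2 := Measure.integral_comp_smul (volume : Measure (Pt d))
      (fun u => productKernel a u * η (x - ((2 : ℝ) ^ l)⁻¹ • u)) ((2 : ℝ) ^ l)
    simp only [smul_smul, inv_mul_cancel₀ h2.ne', one_smul] at e2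
    rw [e2, volume_inflatedCell, finrank_euclideanSpace_fin, ENNReal.toReal_inv,
      ENNReal.toReal_ofReal (by positivity), smul_eq_mul, smul_eq_mul, abs_of_pos (by positivity)]
    rw [div_pow]
    field_simp
  · have : ∃ i, 1 < |((2 : ℝ) ^ l • (x - z)) i| := by
      by_contra hcon
      push Not at hcon
      refine hz (mem_inflatedCell hx fun i => ?_)
      have := hcon i
      simp only [PiLp.smul_apply, PiLp.sub_apply, smul_eq_mul, abs_mul, abs_of_pos h2] at this
      rw [le_div_iff₀ h2]; linarith
    obtain ⟨i, hi⟩ := this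
    rw [productKernel_eq_zero a hi, zero_mul]

end Concentration

/-! ### The events on which all estimates are accurate, and their probability. -/

section GoodEvents
variable {d : ℕ} {Ω : Type*} [MeasurableSpace Ω] {μ : Measure Ω}

/-- The deviation of the empirical means at the centers allowed on the good event. -/
def centerDev (P : SubInput) (d l : ℕ) : ℝ :=
  Real.sqrt (Real.log (1 / deltaLevel d P.δ (min P.α 1) l) / (2 * (P.tCenter d l : ℝ)))

/-- All empirical means at centers are close to their expectations. -/
def GoodCenter (P : SubInput) (Z : Tape d) (η : Pt d → ℝ) : Prop :=
  ∀ l, 1 ≤ l → ∀ c ∈ grid d l, |P.etaHat Z l c - η (center l c)| ≤ centerDev P d l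

/-- All kernel estimates are close to their expectations. -/
def GoodKernel (P : SubInput) (Z : Tape d) (η : Pt d → ℝ) : Prop :=
  1 < P.α → ∀ l : ℕ, 1 ≤ l → ∀ c ∈ grid d l, ∀ c' ∈ grid d ⌊(l : ℝ) * P.α⌋₊,
    cell ⌊(l : ℝ) * P.α⌋₊ c' ⊆ cell l c →
    |P.kernelEstimate Z l c (center ⌊(l : ℝ) * P.α⌋₊ c') -
      ∫ u : Pt d, productKernel P.α u * η (center ⌊(l : ℝ) * P.α⌋₊ c' - ((2 : ℝ) ^ l)⁻¹ • u)| ≤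
      2 * 4 ^ d * P.lam * (2 : ℝ) ^ (-(P.α * l))

/-- Admissible inputs of the subroutine. -/
structure ValidInput (P : SubInput) : Prop where
  δ_pos : 0 < P.δ
  δ_lt : P.δ < 1
  α_pos : 0 < P.α
  one_le_lam : 1 ≤ P.lam

lemma deltaLevel_pos {δ : ℝ} (hδ : 0 < δ) (α : ℝ) (l : ℕ) : 0 < deltaLevel d δ α l := by
  unfold deltaLevel; positivity

lemma deltaLevel_lt_one {δ : ℝ} (hδ : 0 < δ) (hδ1 : δ < 1) (α : ℝ) (l : ℕ) :
    deltaLevel d δ α l < 1 := by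
  have : (2 : ℝ) ^ (-((l : ℝ) * ((d : ℝ) + 1) * max α 1)) ≤ 1 := by
    refine Real.rpow_le_one_of_one_le_of_nonpos (by norm_num) ?_
    have : (0 : ℝ) ≤ max α 1 := le_max_of_le_right zero_le_one
    have : 0 ≤ (l : ℝ) * ((d : ℝ) + 1) * max α 1 := by positivity
    linarith
  unfold deltaLevel
  calc _ ≤ δ * 1 := by gcongr
    _ < 1 := by linarith

lemma log_deltaLevel_pos {δ : ℝ} (hδ : 0 < δ) (hδ1 : δ < 1) (α : ℝ) (l : ℕ) :
    0 < Real.log (1 / deltaLevel d δ α l) := by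
  refine Real.log_pos ?_
  rw [lt_div_iff₀ (deltaLevel_pos hδ α l)]
  linarith [deltaLevel_lt_one (d := d) hδ hδ1 α l]

lemma bLevel_pos (hd : 0 < d) {lam : ℝ} (hlam : 1 ≤ lam) (α : ℝ) (l : ℕ) :
    0 < bLevel d lam α l := by
  unfold bLevel
  have : (0 : ℝ) < d := by exact_mod_cast hd
  positivity

lemma numSamples_pos (hd : 0 < d) {δ lam α : ℝ} (hδ : 0 < δ) (hδ1 : δ < 1) (hlam : 1 ≤ lam)
    (hα : 0 < α) (l : ℕ) : 0 < numSamples d δ lam α l := by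
  have h1 := log_deltaLevel_pos (d := d) hδ hδ1 α l
  have h2 := bLevel_pos hd hlam α l
  unfold numSamples
  split_ifs <;> · rw [Nat.ceil_pos]; positivity

lemma ValidInput.tCenter_pos {P : SubInput} (hP : ValidInput P) (hd : 0 < d) (l : ℕ) :
    0 < P.tCenter d l :=
  numSamples_pos hd hP.δ_pos hP.δ_lt hP.one_le_lam (lt_min hP.α_pos one_pos) l

lemma ValidInput.tFull_pos {P : SubInput} (hP : ValidInput P) (hd : 0 < d) (l : ℕ) :
    0 < P.tFull d l :=
  numSamples_pos hd hP.δ_pos hP.δ_lt hP.one_le_lam hP.α_pos l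

lemma exp_neg_le_deltaLevel {δ : ℝ} (hδ : 0 < δ) (α : ℝ) (l : ℕ) {x : ℝ}
    (hx : Real.log (1 / deltaLevel d δ α l) ≤ x) : Real.exp (-x) ≤ deltaLevel d δ α l := by
  have h := deltaLevel_pos (d := d) hδ α l
  calc Real.exp (-x) ≤ Real.exp (-Real.log (1 / deltaLevel d δ α l)) :=
        Real.exp_le_exp.2 (by linarith)
    _ = _ := by rw [one_div, Real.log_inv, neg_neg, Real.exp_log h]

variable {η : Pt d → ℝ} {Z : ℕ × Query d → Ω → Pt d × Bool} [IsProbabilityMeasure μ]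
  {P : SubInput}

lemma IsSampling.measure_center_le (hZ : IsSampling μ η Z) (hP : ValidInput P) (hd : 0 < d)
    (hη : Measurable η) (h01 : ∀ x, η x ∈ Set.Icc (0 : ℝ) 1) (i l : ℕ) (c : Fin d → ℕ) :
    μ.real {ω | centerDev P d l < |P.etaHat (fun q => Z (i, q) ω) l c - η (center l c)|} ≤
      2 * deltaLevel d P.δ (min P.α 1) l := by
  set t := P.tCenter d l with ht
  have ht0 : (0 : ℝ) < t := by exact_mod_cast hP.tCenter_pos hd l
  have hlog := log_deltaLevel_pos (d := d) hP.δ_pos hP.δ_lt (min P.α 1) l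
  have h := hZ.measure_deviation_le hη h01 (fun j => (i, Query.atCenter l c j))
    (fun j k h => by simpa using h) (ν := Measure.dirac (center l c)) (fun _ => rfl)
    (g := fun _ => 1) measurable_const (a := 0) (b := 1) le_rfl zero_le_one
    (fun _ => ⟨zero_le_one, le_rfl⟩) t (ε := t * centerDev P d l)
    (by unfold centerDev; positivity)
  refine le_trans (measureReal_mono fun ω hω => ?_) (h.trans ?_)
  · simp only [Set.mem_ofPred_eq] at hω ⊢
    rw [integral_dirac' _ _ (by simpa using hη.stronglyMeasurable)]
    simp only [one_mul]
    have e : ∑ j ∈ Finset.range t, (if (Z (i, Query.atCenter l c j) ω).2 = true then (1 : ℝ) else 0)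
        - t * η (center l c) =
        t * (P.etaHat (fun q => Z (i, q) ω) l c - η (center l c)) := by
      rw [SubInput.etaHat, ← ht]; field_simp
    rw [e, abs_mul, abs_of_pos ht0]
    exact mul_le_mul_of_nonneg_left hω.le ht0.le
  · refine mul_le_mul_of_nonneg_left (exp_neg_le_deltaLevel hP.δ_pos _ _ ?_) (by norm_num)
    rw [mul_pow, centerDev, Real.sq_sqrt (by positivity), ← ht]
    apply le_of_eq
    field_simp
    ring

/-- What remains of the numerical constants in the Hoeffding exponent of the kernel step, with 144 =
9 · 16 and 256 = 16 · 16. -/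
lemma nat_le_eight_mul_pow (d : ℕ) : (d : ℝ) * 144 ^ d ≤ 8 * 256 ^ d := by
  induction d with
  | zero => simp
  | succ d ih =>
    have h1 : (144 : ℝ) ^ d ≤ 256 ^ d := pow_le_pow_left₀ (by norm_num) (by norm_num) d
    rw [pow_succ, pow_succ]
    push_cast
    nlinarith [pow_pos (show (0 : ℝ) < 256 by norm_num) d]

/-- Hoeffding with kernel values in [-A, A], A = (4(⌊a⌋ + 1))^d. The factor (a + 1)^{2d} of the
sample size pays for A², which is why the one-dimensional kernel must grow only linearly in a. -/
lemma IsSampling.measure_kernel_le (hZ : IsSampling μ η Z) (hP : ValidInput P) (hd : 0 < d)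
    (hα : 1 < P.α) (hη : Measurable η) (h01 : ∀ x, η x ∈ Set.Icc (0 : ℝ) 1) (i l : ℕ)
    (c : Fin d → ℕ) {x : Pt d} (hx : x ∈ cell l c) :
    μ.real {ω | 2 * 4 ^ d * P.lam * (2 : ℝ) ^ (-(P.α * l)) <
      |P.kernelEstimate (fun q => Z (i, q) ω) l c x -
        ∫ u : Pt d, productKernel P.α u * η (x - ((2 : ℝ) ^ l)⁻¹ • u)|} ≤
      2 * deltaLevel d P.δ P.α l := by
  set t := P.tFull d l with ht
  have ht0 : (0 : ℝ) < t := by exact_mod_cast hP.tFull_pos hd l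
  have hlog := log_deltaLevel_pos (d := d) hP.δ_pos hP.δ_lt P.α l
  have hlam : 0 < P.lam := by linarith [hP.one_le_lam]
  have hd0 : (0 : ℝ) < d := by exact_mod_cast hd
  set A : ℝ := (4 * (⌊P.α⌋₊ + 1)) ^ d with hA
  have hA0 : 0 < A := by positivity
  set r : ℝ := (2 : ℝ) ^ (-(P.α * l)) with hr
  have hr0 : 0 < r := by positivity
  have hgm : Measurable fun z : Pt d => productKernel P.α ((2 : ℝ) ^ l • (x - z)) :=
    (measurable_productKernel P.α).comp (by fun_prop)
  have h := hZ.measure_deviation_le hη h01 (fun j => (i, Query.inInflated l c j))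
    (fun j k h => by simpa using h) (ν := ProbabilityTheory.cond volume (inflatedCell l c))
    (fun _ => rfl) hgm (a := -A) (b := A) (by linarith) hA0.le
    (fun z => abs_le.1 (abs_productKernel_le P.α _)) t (ε := t * (2 * 4 ^ d * P.lam * r) / 3 ^ d)
    (by positivity)
  refine le_trans (measureReal_mono fun ω hω => ?_) (h.trans ?_)
  · simp only [Set.mem_ofPred_eq] at hω ⊢
    have e : ∑ j ∈ Finset.range t, productKernel P.α
          ((2 : ℝ) ^ l • (x - (Z (i, Query.inInflated l c j) ω).1)) *
          (if (Z (i, Query.inInflated l c j) ω).2 = true then (1 : ℝ) else 0) -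
        t * ∫ z, productKernel P.α ((2 : ℝ) ^ l • (x - z)) * η z
          ∂(ProbabilityTheory.cond volume (inflatedCell l c)) =
        t / 3 ^ d * (P.kernelEstimate (fun q => Z (i, q) ω) l c x -
          ∫ u : Pt d, productKernel P.α u * η (x - ((2 : ℝ) ^ l)⁻¹ • u)) := by
      rw [SubInput.kernelEstimate, ← ht, ← kernel_mean_eq P.α l c hx]; field_simp
    rw [e, abs_mul, abs_of_pos (by positivity), mul_div_right_comm]
    exact mul_le_mul_of_nonneg_left hω.le (by positivity)
  · refine mul_le_mul_of_nonneg_left (exp_neg_le_deltaLevel hP.δ_pos _ _ ?_) (by norm_num)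
    have hb : bLevel d P.lam P.α l ^ 2 = P.lam ^ 2 * d * r ^ 2 := by
      have : ((d : ℝ) ^ (min P.α 1 / 2)) ^ 2 = d := by
        rw [min_eq_right hα.le, ← Real.rpow_natCast, ← Real.rpow_mul hd0.le]; norm_num
      rw [bLevel, mul_pow, mul_pow, this, hr, mul_comm (l : ℝ)]
    have htl : (4 : ℝ) ^ (2 * d + 1) * (P.α + 1) ^ (2 * d) *
        (Real.log (1 / deltaLevel d P.δ P.α l) / (P.lam ^ 2 * d * r ^ 2)) ≤ t := by
      rw [ht, SubInput.tFull, numSamples, if_neg (not_le.2 hα), hb]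
      exact Nat.le_ceil _
    set lg := Real.log (1 / deltaLevel d P.δ P.α l) with hlg
    have hAle : A ^ 2 ≤ 16 ^ d * (P.α + 1) ^ (2 * d) := by
      have h1 : (⌊P.α⌋₊ : ℝ) ≤ P.α := Nat.floor_le (by linarith)
      calc A ^ 2 ≤ ((4 * (P.α + 1)) ^ d) ^ 2 := by rw [hA]; gcongr
        _ = _ := by
          rw [mul_pow, mul_pow, ← pow_mul, ← pow_mul, mul_comm d 2, pow_mul]; norm_num
    rw [mul_div_assoc', div_le_iff₀ (by positivity)] at htl
    rw [le_div_iff₀ (mul_pos ht0 (pow_pos (by linarith) 2))]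
    have hnum := nat_le_eight_mul_pow d
    have e1 : (t * (2 * 4 ^ d * P.lam * r) / 3 ^ d) ^ 2 * 9 ^ d =
        t * (4 * 16 ^ d * (t * (P.lam ^ 2 * r ^ 2))) := by
      have : (9 : ℝ) ^ d = (3 ^ d) ^ 2 := by rw [← pow_mul, mul_comm, pow_mul]; norm_num
      rw [this, div_pow, div_mul_cancel₀ _ (by positivity)]
      have : (16 : ℝ) ^ d = (4 ^ d) ^ 2 := by rw [← pow_mul, mul_comm, pow_mul]; norm_num
      rw [this]; ring
    have h9 : (0 : ℝ) < 9 ^ d := by positivity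
    have hpa : (0 : ℝ) < (P.α + 1) ^ (2 * d) := by have := hP.α_pos; positivity
    refine le_of_mul_le_mul_right ?_ (mul_pos h9 hd0)
    calc lg * (t * (A - -A) ^ 2) * (9 ^ d * d) = 4 * (lg * t * 9 ^ d * d) * A ^ 2 := by ring
      _ ≤ 4 * (lg * t * 9 ^ d * d) * (16 ^ d * (P.α + 1) ^ (2 * d)) := by gcongr
      _ = 4 * lg * t * (P.α + 1) ^ (2 * d) * (d * 144 ^ d) := by
          rw [show (144 : ℝ) = 9 * 16 by norm_num, mul_pow]; ring
      _ ≤ 4 * lg * t * (P.α + 1) ^ (2 * d) * (8 * 256 ^ d) := by gcongr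
      _ = (8 * 16 ^ d * t) * (4 ^ (2 * d + 1) * (P.α + 1) ^ (2 * d) * lg) := by
          have h4 : (4 : ℝ) ^ (2 * d) = 16 ^ d := by rw [pow_mul]; norm_num
          rw [show (256 : ℝ) = 16 * 16 by norm_num, mul_pow, pow_succ, h4]
          ring
      _ ≤ (8 * 16 ^ d * t) * (t * (P.lam ^ 2 * d * r ^ 2)) := by gcongr
      _ = 2 * (t * (4 * 16 ^ d * (t * (P.lam ^ 2 * r ^ 2)))) * d := by ring
      _ = 2 * (t * (2 * 4 ^ d * P.lam * r) / 3 ^ d) ^ 2 * (9 ^ d * d) := by rw [← e1]; ring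

lemma tsum_ofReal_geometric {C : ℝ} (hC : 0 ≤ C) :
    ∑' l : ℕ, ENNReal.ofReal (C * (1 / 2) ^ (l + 1)) = ENNReal.ofReal C := by
  rw [← ENNReal.ofReal_tsum_of_nonneg (fun l => by positivity)]
  · congr 1
    have : ∀ l : ℕ, C * (1 / 2 : ℝ) ^ (l + 1) = C / 2 * (1 / 2) ^ l := fun l => by
      rw [pow_succ]; ring
    simp_rw [this]
    rw [tsum_mul_left, tsum_geometric_two]; ring
  · exact ((summable_geometric_two).comp_injective (Nat.succ_injective)).mul_left C

/-- The union runs over all depths and cells: the cells visited by the algorithm depend on the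
labels themselves. -/
lemma measure_exists_level_le {ι : Type*} (s : ℕ → Finset ι) (bad : ℕ → ι → Set Ω) {C : ℝ}
    (hC : 0 ≤ C) (q : ℕ → ℝ) (hq : ∀ l, 1 ≤ l → ∀ c ∈ s l, μ.real (bad l c) ≤ q l)
    (hcard : ∀ l, 1 ≤ l → ((s l).card : ℝ) * q l ≤ C * (1 / 2) ^ l) :
    μ {ω | ∃ l, 1 ≤ l ∧ ∃ c ∈ s l, ω ∈ bad l c} ≤ ENNReal.ofReal C := by
  have hsub : {ω | ∃ l, 1 ≤ l ∧ ∃ c ∈ s l, ω ∈ bad l c} ⊆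
      ⋃ l : ℕ, ⋃ c ∈ s (l + 1), bad (l + 1) c := by
    rintro ω ⟨l, hl, c, hc, hω⟩
    obtain ⟨m, rfl⟩ : ∃ m, l = m + 1 := ⟨l - 1, by omega⟩
    simp only [Set.mem_iUnion]
    exact ⟨m, c, hc, hω⟩
  refine (measure_mono hsub).trans ((measure_iUnion_le _).trans ?_)
  rw [← tsum_ofReal_geometric hC]
  refine ENNReal.tsum_le_tsum fun l => ?_
  refine (measure_biUnion_finset_le _ _).trans ?_
  calc ∑ c ∈ s (l + 1), μ (bad (l + 1) c) ≤ ∑ c ∈ s (l + 1), ENNReal.ofReal (q (l + 1)) :=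
        Finset.sum_le_sum fun c hc => by
          rw [← ofReal_measureReal]
          exact ENNReal.ofReal_le_ofReal (hq _ (by omega) c hc)
    _ = ENNReal.ofReal (((s (l + 1)).card : ℝ) * q (l + 1)) := by
        rw [Finset.sum_const, nsmul_eq_mul, ENNReal.ofReal_mul (by positivity),
          ENNReal.ofReal_natCast]
    _ ≤ _ := ENNReal.ofReal_le_ofReal (hcard _ (by omega))

/-- There are 2^{ld} cells, each failing with probability at most 2δ 2^{-l(d+1)}; the surplus 2^{-l}
is summable. -/
lemma IsSampling.measure_not_goodCenter_le (hZ : IsSampling μ η Z) (hP : ValidInput P) (hd : 0 < d)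
    (hη : Measurable η) (h01 : ∀ x, η x ∈ Set.Icc (0 : ℝ) 1) (i : ℕ) :
    μ {ω | ¬ GoodCenter P (fun q => Z (i, q) ω) η} ≤ ENNReal.ofReal (2 * P.δ) := by
  refine le_trans (measure_mono fun ω hω => ?_) (measure_exists_level_le (fun l => grid d l)
    (fun l c => {ω | centerDev P d l < |P.etaHat (fun q => Z (i, q) ω) l c - η (center l c)|})
    (C := 2 * P.δ) (by linarith [hP.δ_pos]) (fun l => 2 * deltaLevel d P.δ (min P.α 1) l)
    (fun l _ c _ => hZ.measure_center_le hP hd hη h01 i l c) fun l _ => ?_)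
  · simp only [Set.mem_ofPred_eq, GoodCenter, not_forall, not_le] at hω ⊢
    obtain ⟨l, hl, c, hc, h⟩ := hω
    exact ⟨l, hl, c, hc, h⟩
  · rw [card_grid, deltaLevel, max_eq_right (min_le_right _ _), mul_one]
    apply le_of_eq
    have : (2 : ℝ) ^ (-((l : ℝ) * ((d : ℝ) + 1))) = ((2 : ℝ) ^ (l * d))⁻¹ * (1 / 2) ^ l := by
      rw [Real.rpow_neg (by norm_num), mul_add, mul_one, Real.rpow_add (by norm_num), mul_inv,
        one_div, inv_pow, Real.rpow_natCast, ← Nat.cast_mul, Real.rpow_natCast]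
    rw [this]
    push_cast
    have : (2 : ℝ) ^ (l * d) ≠ 0 := by positivity
    field_simp

/-- The union is over fine cells only, since the coarse cell is the parent. There are 2^{⌊la⌋d} of
them against 2δ 2^{-l(d+1)a}; this is what the factor α ∨ 1 in `deltaLevel` is for. -/
lemma IsSampling.measure_not_goodKernel_le (hZ : IsSampling μ η Z) (hP : ValidInput P) (hd : 0 < d)
    (hη : Measurable η) (h01 : ∀ x, η x ∈ Set.Icc (0 : ℝ) 1) (i : ℕ) :
    μ {ω | ¬ GoodKernel P (fun q => Z (i, q) ω) η} ≤ ENNReal.ofReal (2 * P.δ) := by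
  by_cases hα : 1 < P.α
  swap
  · simp [GoodKernel, hα]
  have hfl : ∀ l : ℕ, l ≤ ⌊(l : ℝ) * P.α⌋₊ := fun l =>
    Nat.le_floor (le_mul_of_one_le_right (Nat.cast_nonneg l) hα.le)
  refine le_trans (measure_mono fun ω hω => ?_) (measure_exists_level_le
    (fun l => grid d ⌊(l : ℝ) * P.α⌋₊)
    (fun l c' => {ω | 2 * 4 ^ d * P.lam * (2 : ℝ) ^ (-(P.α * l)) <
      |P.kernelEstimate (fun q => Z (i, q) ω) l (fun j => c' j / 2 ^ (⌊(l : ℝ) * P.α⌋₊ - l))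
          (center ⌊(l : ℝ) * P.α⌋₊ c') - ∫ u : Pt d, productKernel P.α u *
          η (center ⌊(l : ℝ) * P.α⌋₊ c' - ((2 : ℝ) ^ l)⁻¹ • u)|})
    (C := 2 * P.δ) (by linarith [hP.δ_pos]) (fun l => 2 * deltaLevel d P.δ P.α l)
    (fun l _ c' _ => hZ.measure_kernel_le hP hd hα hη h01 i l _ ?_) fun l hl => ?_)
  · simp only [Set.mem_ofPred_eq, GoodKernel, not_forall, not_le] at hω ⊢
    obtain ⟨-, l, hl, c, hc, c', hc', hsub, h⟩ := hω
    refine ⟨l, hl, c', hc', ?_⟩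
    obtain ⟨m, hm⟩ := Nat.exists_eq_add_of_le (hfl l)
    rw [hm] at hc' hsub
    rw [eq_parent_of_cell_subset hc hc' hsub] at h
    have : ⌊(l : ℝ) * P.α⌋₊ - l = m := by omega
    rw [this]; exact h
  · obtain ⟨m, hm⟩ := Nat.exists_eq_add_of_le (hfl l)
    have e : ⌊(l : ℝ) * P.α⌋₊ - l = m := by omega
    rw [e, hm]
    exact cell_subset_parent l m c' (center_mem_cell _ _)
  · rw [card_grid, deltaLevel, max_eq_left hα.le]
    push_cast
    have hl0 : (0 : ℝ) ≤ l := l.cast_nonneg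
    have hf : ((⌊(l : ℝ) * P.α⌋₊ : ℕ) : ℝ) ≤ l * P.α := Nat.floor_le (by positivity)
    have h1 : (2 : ℝ) ^ (⌊(l : ℝ) * P.α⌋₊ * d) ≤ (2 : ℝ) ^ ((l : ℝ) * P.α * d) := by
      rw [← Real.rpow_natCast]
      refine Real.rpow_le_rpow_of_exponent_le (by norm_num) ?_
      push_cast; gcongr
    have h2 : (2 : ℝ) ^ ((l : ℝ) * P.α * d) * (2 : ℝ) ^ (-((l : ℝ) * ((d : ℝ) + 1) * P.α)) ≤
        (1 / 2) ^ l := by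
      rw [← Real.rpow_add (by norm_num), one_div, inv_pow, ← Real.rpow_natCast,
        ← Real.rpow_neg (by norm_num)]
      refine Real.rpow_le_rpow_of_exponent_le (by norm_num) ?_
      nlinarith
    have := hP.δ_pos
    calc _ ≤ (2 : ℝ) ^ ((l : ℝ) * P.α * d) *
          (2 * (P.δ * (2 : ℝ) ^ (-((l : ℝ) * ((d : ℝ) + 1) * P.α)))) := by gcongr
      _ = 2 * P.δ * ((2 : ℝ) ^ ((l : ℝ) * P.α * d) *
          (2 : ℝ) ^ (-((l : ℝ) * ((d : ℝ) + 1) * P.α))) := by ring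
      _ ≤ _ := by gcongr

end GoodEvents

/-! ### Deterministic analysis of one run of the subroutine on the good events. -/

section Phase
variable {d : ℕ} {P : SubInput} {Z : Tape d} {η : Pt d → ℝ} {α : ℝ}

open Classical in
lemma active_subset_grid (P : SubInput) (Z : Tape d) (l : ℕ) : P.active Z l ⊆ grid d l := by
  match l with
  | 0 => simp [SubInput.active]
  | 1 => simp [SubInput.active]
  | l + 2 => rw [SubInput.active]; exact Finset.filter_subset _ _

lemma card_active_le (P : SubInput) (Z : Tape d) (l : ℕ) :
    (P.active Z l).card ≤ 2 ^ (l * d) := by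
  rw [← card_grid]; exact Finset.card_le_card (active_subset_grid P Z l)

open Classical in
lemma cellIdx_succ_mem_active {l : ℕ} {x : Pt d} (hx : x ∈ unitCube d)
    (h1 : cellIdx (l + 1) x ∈ P.active Z (l + 1))
    (h2 : |P.etaHat Z (l + 1) (cellIdx (l + 1) x) - 1 / 2| ≤ P.threshold d (l + 1)) :
    cellIdx (l + 2) x ∈ P.active Z (l + 2) := by
  rw [SubInput.active, Finset.mem_filter]
  exact ⟨cellIdx_mem_grid _ _, _, h1, h2, cell_cellIdx_subset (by omega) hx⟩

open Classical in
lemma exists_parent_of_mem_active {l : ℕ} {x : Pt d} (hx : x ∈ unitCube d)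
    (h1 : cellIdx (l + 2) x ∈ P.active Z (l + 2)) :
    cellIdx (l + 1) x ∈ P.active Z (l + 1) ∧
      |P.etaHat Z (l + 1) (cellIdx (l + 1) x) - 1 / 2| ≤ P.threshold d (l + 1) := by
  rw [SubInput.active, Finset.mem_filter] at h1
  obtain ⟨-, c, hc, hthr, hsub⟩ := h1
  have := eq_cellIdx_of_mem_cell (active_subset_grid P Z _ hc) (hsub (mem_cell_cellIdx hx))
  rw [← this]
  exact ⟨hc, hthr⟩

/-- The half-width `b_{l, α ∧ 1}`. -/
def centerB (P : SubInput) (d l : ℕ) : ℝ := bLevel d P.lam (min P.α 1) l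

lemma ValidInput.centerB_pos (hP : ValidInput P) (hd : 0 < d) (l : ℕ) : 0 < centerB P d l :=
  bLevel_pos hd hP.one_le_lam _ _

lemma centerB_eq (P : SubInput) (d l : ℕ) :
    centerB P d l = P.lam * (d : ℝ) ^ (min P.α 1 / 2) * (2 : ℝ) ^ (-((l : ℝ) * min P.α 1)) := by
  rw [centerB, bLevel, min_assoc, min_self]

lemma ValidInput.centerDev_le (hP : ValidInput P) (hd : 0 < d) (l : ℕ) :
    centerDev P d l ≤ centerB P d l := by
  have hb := hP.centerB_pos hd l
  have ht0 : (0 : ℝ) < P.tCenter d l := by exact_mod_cast hP.tCenter_pos hd l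
  have ht : Real.log (1 / deltaLevel d P.δ (min P.α 1) l) / (2 * centerB P d l ^ 2) ≤
      P.tCenter d l := by
    rw [SubInput.tCenter, numSamples, if_pos (min_le_right _ _)]
    exact Nat.le_ceil _
  rw [div_le_iff₀ (by positivity)] at ht
  refine Real.sqrt_le_iff.2 ⟨hb.le, ?_⟩
  rw [div_le_iff₀ (by positivity)]
  linarith

lemma threshold_eq (P : SubInput) (d l : ℕ) :
    P.threshold d l = 2 * (centerDev P d l + centerB P d l) := rfl

lemma HolderClass.abs_sub_center_le (hη : HolderClass P.lam α η) (hP : ValidInput P)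
    (hPα : P.α ≤ α) {l : ℕ} {c : Fin d → ℕ} {x : Pt d} (hx : x ∈ cell l c) :
    |η x - η (center l c)| ≤ centerB P d l := by
  have ha : 0 < min P.α 1 := lt_min hP.α_pos one_pos
  refine (hη.holder_le hP.one_le_lam ha (min_le_right _ _) ((min_le_left _ _).trans hPα) _ _).trans ?_
  rw [centerB_eq, mul_assoc]
  refine mul_le_mul_of_nonneg_left ?_ (by linarith [hP.one_le_lam])
  calc ‖x - center l c‖ ^ min P.α 1 ≤ (Real.sqrt d * ((2 : ℝ) ^ l)⁻¹) ^ min P.α 1 := by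
        refine Real.rpow_le_rpow (norm_nonneg _) ((norm_sub_center_le hx).trans ?_) ha.le
        refine mul_le_mul_of_nonneg_left ?_ (by positivity)
        rw [div_eq_mul_inv]
        have : (0 : ℝ) < ((2 : ℝ) ^ l)⁻¹ := by positivity
        linarith
    _ = _ := by
        rw [Real.mul_rpow (by positivity) (by positivity), Real.sqrt_eq_rpow, ← Real.rpow_mul
          (by positivity), ← Real.rpow_natCast, ← Real.rpow_neg (by norm_num), ← Real.rpow_mul
          (by norm_num)]
        congr 2 <;> ring

/-- The threshold is twice the total error `centerDev + centerB` at a point of the cell, so more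
than one such error is left, on the correct side of 1/2. -/
lemma labelled_correct (hη : HolderClass P.lam α η) (hP : ValidInput P) (hPα : P.α ≤ α)
    (hG : GoodCenter P Z η) {l : ℕ} (hl : 1 ≤ l) {c : Fin d → ℕ}
    (hc : c ∈ grid d l) (hthr : P.threshold d l < |P.etaHat Z l c - 1 / 2|) {x : Pt d}
    (hx : x ∈ cell l c) :
    centerB P d l < |η x - 1 / 2| ∧ decide (1 / 2 ≤ P.etaHat Z l c) = bayes η x := by
  have h1 := hG l hl c hc
  have h2 := hη.abs_sub_center_le hP hPα hx
  rw [threshold_eq] at hthr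
  have hdev : 0 ≤ centerDev P d l := Real.sqrt_nonneg _
  have hB : 0 ≤ centerB P d l := (abs_nonneg _).trans h2
  have h3 : |P.etaHat Z l c - η x| ≤ centerDev P d l + centerB P d l := by
    calc _ ≤ _ := abs_sub_le _ (η (center l c)) _
      _ ≤ _ := add_le_add h1 (by rwa [abs_sub_comm])
  obtain ⟨h4, h5⟩ := abs_le.1 h3
  rw [bayes]
  rcases le_total (1 / 2) (P.etaHat Z l c) with h | h
  · rw [abs_of_nonneg (by linarith)] at hthr
    refine ⟨?_, ?_⟩
    · rw [abs_of_nonneg (by linarith)]; linarith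
    · rw [decide_eq_decide]; exact ⟨fun _ => by linarith, fun _ => h⟩
  · rw [abs_of_nonpos (by linarith)] at hthr
    refine ⟨?_, ?_⟩
    · rw [abs_of_nonpos (by linarith)]; linarith
    · rw [decide_eq_decide]; constructor <;> intro h' <;> linarith

/-- Threshold plus error is three times `centerDev + centerB`, and the sample size is chosen so that
the deviation is at most the oscillation. -/
lemma unlabelled_le (hη : HolderClass P.lam α η) (hP : ValidInput P) (hPα : P.α ≤ α)
    (hd : 0 < d) (hG : GoodCenter P Z η) {l : ℕ} (hl : 1 ≤ l) {c : Fin d → ℕ} (hc : c ∈ grid d l)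
    (hthr : |P.etaHat Z l c - 1 / 2| ≤ P.threshold d l) {x : Pt d} (hx : x ∈ cell l c) :
    |η x - 1 / 2| ≤ 6 * centerB P d l := by
  have h1 := hG l hl c hc
  have h2 := hη.abs_sub_center_le hP hPα hx
  have h3 := hP.centerDev_le hd l
  rw [threshold_eq] at hthr
  rw [abs_le] at *
  constructor <;> linarith

lemma bayes_of_mem_loopLabelled (hη : HolderClass P.lam α η) (hP : ValidInput P) (hPα : P.α ≤ α)
    (hG : GoodCenter P Z η) {x : Pt d} {y : Bool} (hx : x ∈ P.loopLabelled Z y) :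
    y = bayes η x := by
  obtain ⟨l, hl, c, hc, hxc, hthr, hy⟩ := hx
  rw [hy]
  have := (labelled_correct hη hP hPα hG (Finset.mem_Icc.1 hl).1
    (active_subset_grid P Z l hc) hthr hxc).2
  convert this

/-- The lower bound on |η x - 1/2| at the labelling depth is recorded because the aggregation
argument compares it with the band in which the kernel step can err. -/
lemma mem_loopLabelled_or (hη : HolderClass P.lam α η) (hP : ValidInput P) (hPα : P.α ≤ α)
    (hG : GoodCenter P Z η) {x : Pt d} (hx : x ∈ unitCube d) (m : ℕ) (hm : m ≤ P.finalDepth Z) :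
    (x ∈ P.loopLabelled Z (bayes η x) ∧ ∃ l ∈ Finset.Icc 1 m, centerB P d l < |η x - 1 / 2|) ∨
      cellIdx (m + 1) x ∈ P.active Z (m + 1) := by
  induction m with
  | zero => right; exact cellIdx_mem_grid 1 x
  | succ m ih =>
    rcases ih (by omega) with ⟨h, l, hl, hl2⟩ | h
    · refine Or.inl ⟨h, l, ?_, hl2⟩
      rw [Finset.mem_Icc] at hl ⊢; omega
    · by_cases hthr : |P.etaHat Z (m + 1) (cellIdx (m + 1) x) - 1 / 2| ≤ P.threshold d (m + 1)
      · exact Or.inr (cellIdx_succ_mem_active hx h hthr)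
      · left
        rw [not_le] at hthr
        have hc := labelled_correct hη hP hPα hG (by omega) (cellIdx_mem_grid _ x) hthr
          (mem_cell_cellIdx hx)
        refine ⟨⟨m + 1, Finset.mem_Icc.2 ⟨by omega, hm⟩, _, h, mem_cell_cellIdx hx, hthr, ?_⟩,
          m + 1, Finset.mem_Icc.2 ⟨by omega, le_rfl⟩, hc.1⟩
        rw [← hc.2]

lemma abs_sub_half_le_of_mem_active (hη : HolderClass P.lam α η) (hP : ValidInput P)
    (hPα : P.α ≤ α) (hd : 0 < d) (hG : GoodCenter P Z η) {x : Pt d} (hx : x ∈ unitCube d) {l : ℕ}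
    (hl : 1 ≤ l) (h : cellIdx (l + 1) x ∈ P.active Z (l + 1)) :
    |η x - 1 / 2| ≤ 6 * centerB P d l := by
  obtain ⟨m, rfl⟩ : ∃ m, l = m + 1 := ⟨l - 1, by omega⟩
  obtain ⟨h1, h2⟩ := exists_parent_of_mem_active hx h
  exact unlabelled_le hη hP hPα hd hG hl (cellIdx_mem_grid _ _) h2 (mem_cell_cellIdx hx)

lemma inv_two_pow_rpow (L : ℕ) (a : ℝ) : (((2 : ℝ) ^ L)⁻¹) ^ a = (2 : ℝ) ^ (-(a * L)) := by
  rw [← Real.rpow_natCast, ← Real.rpow_neg (by norm_num), ← Real.rpow_mul (by norm_num)]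
  congr 1; ring

lemma sqrt_natCast_le_four_pow (d : ℕ) : Real.sqrt d ≤ 4 ^ d := by
  refine Real.sqrt_le_iff.2 ⟨by positivity, ?_⟩
  have h1 : (d : ℝ) ≤ 4 ^ d := by exact_mod_cast (Nat.lt_pow_self (by norm_num)).le
  have h2 : (1 : ℝ) ≤ 4 ^ d := one_le_pow₀ (by norm_num)
  nlinarith

/-- Of the four shares in 4^{d+1} = 4 · 4^d, two go to the deviation, one to the Taylor terms of
degree between a and α (as 2 ≤ 4^d), one to the oscillation over the fine cell, whose half side is
at most 2^{-aL}. The Taylor remainder stays separate. -/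
lemma abs_kernelEstimate_sub_le (hη : HolderClass P.lam α η) (hP : ValidInput P) (hPα : P.α ≤ α)
    (hd : 0 < d) (hα : 1 < P.α) (hG : GoodKernel P Z η) {L : ℕ} (hL : 1 ≤ L) {c c' : Fin d → ℕ}
    (hc : c ∈ grid d L) (hc' : c' ∈ grid d ⌊(L : ℝ) * P.α⌋₊)
    (hsub : cell ⌊(L : ℝ) * P.α⌋₊ c' ⊆ cell L c) {x : Pt d}
    (hx : x ∈ cell ⌊(L : ℝ) * P.α⌋₊ c') :
    |P.kernelEstimate Z L c (center ⌊(L : ℝ) * P.α⌋₊ c') - η x| ≤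
      4 ^ (d + 1) * P.lam * (2 : ℝ) ^ (-(P.α * L)) +
        biasConst d α * P.lam * (2 : ℝ) ^ (-(α * L)) := by
  set m := ⌊(L : ℝ) * P.α⌋₊ with hm
  have hlam := hP.one_le_lam
  have h1 := hG hα L hL c hc c' hc' hsub
  have hh : ((2 : ℝ) ^ L)⁻¹ ≤ 1 / 2 := by
    rw [one_div]
    refine inv_anti₀ (by norm_num) ?_
    calc (2 : ℝ) = 2 ^ 1 := by norm_num
      _ ≤ 2 ^ L := pow_le_pow_right₀ (by norm_num) hL
  have h2 := hη.kernel_bias_le hd (by linarith) hα hPα (h := ((2 : ℝ) ^ L)⁻¹) (by positivity) hh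
    (center m c')
  rw [inv_two_pow_rpow, inv_two_pow_rpow] at h2
  have h3 : |η x - η (center m c')| ≤ P.lam * (4 ^ d * (2 : ℝ) ^ (-(P.α * L))) := by
    refine (hη.lipschitz (hα.trans_le hPα) x _).trans
      (mul_le_mul_of_nonneg_left ((norm_sub_center_le hx).trans ?_) (by linarith))
    refine mul_le_mul (sqrt_natCast_le_four_pow d) ?_ (by positivity) (by positivity)
    have e : (1 / 2 / (2 : ℝ) ^ m) = (2 : ℝ) ^ (-((m : ℝ) + 1)) := by
      rw [Real.rpow_neg (by norm_num), Real.rpow_add (by norm_num), Real.rpow_natCast,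
        Real.rpow_one, mul_inv]; ring
    rw [e]
    refine Real.rpow_le_rpow_of_exponent_le (by norm_num) ?_
    have := Nat.lt_floor_add_one ((L : ℝ) * P.α)
    rw [← hm] at this
    linarith
  set r := (2 : ℝ) ^ (-(P.α * L)) with hr
  have hr0 : 0 < r := by positivity
  have h4 : (2 : ℝ) ≤ 4 ^ d := by
    calc (2 : ℝ) ≤ 4 ^ 1 := by norm_num
      _ ≤ 4 ^ d := pow_le_pow_right₀ (by norm_num) hd
  have h5 : 2 * P.lam * r ≤ 4 ^ d * P.lam * r := by gcongr
  have h6 : (4 : ℝ) ^ (d + 1) * P.lam * r = 4 * (4 ^ d * P.lam * r) := by rw [pow_succ]; ring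
  rw [h6]
  rw [abs_le] at *
  constructor <;> nlinarith

/-- The threshold absorbs every error but the Taylor remainder. The band of possible errors
therefore shrinks with the true exponent α and not with the parameter of the phase. -/
lemma abs_sub_half_le_of_mem_kernelLabelled (hη : HolderClass P.lam α η) (hP : ValidInput P)
    (hPα : P.α ≤ α) (hd : 0 < d) (hG : GoodKernel P Z η) {x : Pt d} {y : Bool}
    (hx : x ∈ P.kernelLabelled Z y) :
    1 < P.α ∧ 1 ≤ P.finalDepth Z ∧ x ∈ unitCube d ∧ (y ≠ bayes η x →
      |η x - 1 / 2| ≤ biasConst d α * P.lam * (2 : ℝ) ^ (-(α * P.finalDepth Z))) := by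
  obtain ⟨hα, c, hc, c', hc', hsub, hxc, hthr⟩ := hx
  have hL : 1 ≤ P.finalDepth Z := by
    by_contra hcon
    have h0 : P.finalDepth Z = 0 := by omega
    rw [h0] at hc
    simp [SubInput.active] at hc
  have hcg := active_subset_grid P Z _ hc
  refine ⟨hα, hL, mem_unitCube_of_mem_cell hcg (hsub hxc), fun hy => ?_⟩
  have h := abs_kernelEstimate_sub_le hη hP hPα hd hα hG hL hcg hc' hsub hxc
  obtain ⟨h1, h2⟩ := abs_le.1 h
  rw [bayes] at hy
  by_cases hb : 1 / 2 ≤ η x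
  · rw [decide_eq_true hb] at hy
    rw [if_neg hy] at hthr
    rw [abs_of_nonneg (by linarith)]; linarith
  · rw [decide_eq_false hb] at hy
    rw [if_pos (by simpa using hy)] at hthr
    rw [abs_of_nonpos (by linarith)]; linarith

/-- Constant in the bound at the points that a phase leaves unlabelled. -/
def coverConst (d : ℕ) (α : ℝ) : ℝ := 2 * 4 ^ (d + 1) + biasConst d α + 6 * Real.sqrt d

lemma biasConst_nonneg (d : ℕ) (α : ℝ) : 0 ≤ biasConst d α := by unfold biasConst; positivity

lemma mem_output_or (hη : HolderClass P.lam α η) (hP : ValidInput P) (hPα : P.α ≤ α)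
    (hd : 0 < d) (hG : GoodCenter P Z η) (hK : GoodKernel P Z η) {x : Pt d}
    (hx : x ∈ unitCube d) :
    (∃ y, x ∈ P.output Z y) ∨
      |η x - 1 / 2| ≤ coverConst d α * P.lam * (2 : ℝ) ^ (-(P.α * P.finalDepth Z)) := by
  set L := P.finalDepth Z with hL
  have hlam := hP.one_le_lam
  have hM := biasConst_nonneg d α
  have hd1 : 1 ≤ Real.sqrt d := Real.one_le_sqrt.2 (by exact_mod_cast hd)
  rcases Nat.eq_zero_or_pos L with h0 | hL1
  · right
    rw [h0]
    have h1 : |η x - 1 / 2| ≤ 1 := by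
      have := hη.1 x
      exact abs_le.2 ⟨by linarith [this.1], by linarith [this.2]⟩
    have h2 : 1 ≤ coverConst d α := by
      have : (0 : ℝ) < 2 * 4 ^ (d + 1) := by positivity
      rw [coverConst]; linarith
    simp only [Nat.cast_zero, mul_zero, neg_zero, Real.rpow_zero, mul_one]
    nlinarith
  rcases mem_loopLabelled_or hη hP hPα hG hx L le_rfl with ⟨h, -⟩ | h
  · exact Or.inl ⟨_, Or.inl h⟩
  have hr0 : 0 < (2 : ℝ) ^ (-(P.α * L)) := by positivity
  rcases le_or_gt P.α 1 with hα | hα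
  · right
    have h1 := abs_sub_half_le_of_mem_active hη hP hPα hd hG hx hL1 h
    rw [centerB_eq, min_eq_left hα] at h1
    refine h1.trans ?_
    have h2 : (d : ℝ) ^ (P.α / 2) ≤ Real.sqrt d := by
      rw [Real.sqrt_eq_rpow]
      exact Real.rpow_le_rpow_of_exponent_le (by exact_mod_cast hd) (by linarith)
    rw [mul_comm (L : ℝ)]
    calc _ ≤ 6 * (P.lam * Real.sqrt d * (2 : ℝ) ^ (-(P.α * L))) := by gcongr
      _ = 6 * Real.sqrt d * P.lam * (2 : ℝ) ^ (-(P.α * L)) := by ring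
      _ ≤ _ := by
        gcongr
        have : (0 : ℝ) < 2 * 4 ^ (d + 1) := by positivity
        rw [coverConst]; linarith
  -- A cell active at depth L + 1 has an active parent at depth L, and the kernel step treats all
  -- cells active at depth L.
  · obtain ⟨m, hm⟩ : ∃ m, L = m + 1 := ⟨L - 1, by omega⟩
    have hact : cellIdx L x ∈ P.active Z L := by
      rw [hm] at h ⊢
      exact (exists_parent_of_mem_active hx h).1
    set k := ⌊(L : ℝ) * P.α⌋₊ with hk
    have hLk : L ≤ k := Nat.le_floor (le_mul_of_one_le_right (Nat.cast_nonneg L) hα.le)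
    have hsub := cell_cellIdx_subset hLk hx
    have hxk := mem_cell_cellIdx (l := k) hx
    have hest := abs_kernelEstimate_sub_le hη hP hPα hd hα hK hL1 (cellIdx_mem_grid L x)
      (cellIdx_mem_grid k x) hsub hxk
    set E := P.kernelEstimate Z L (cellIdx L x) (center k (cellIdx k x)) with hE
    set T := (4 : ℝ) ^ (d + 1) * P.lam * (2 : ℝ) ^ (-(P.α * L)) with hT
    by_cases h1 : T < E - 1 / 2
    · refine Or.inl ⟨true, Or.inr ⟨hα, _, hact, _, cellIdx_mem_grid k x, hsub, hxk, ?_⟩⟩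
      simpa using h1
    by_cases h2 : T < -(E - 1 / 2)
    · refine Or.inl ⟨false, Or.inr ⟨hα, _, hact, _, cellIdx_mem_grid k x, hsub, hxk, ?_⟩⟩
      rw [if_neg (by simp), neg_one_mul]
      exact h2
    · right
      have h3 : biasConst d α * P.lam * (2 : ℝ) ^ (-(α * L)) ≤
          biasConst d α * P.lam * (2 : ℝ) ^ (-(P.α * L)) := by
        have : (2 : ℝ) ^ (-(α * L)) ≤ (2 : ℝ) ^ (-(P.α * L)) := by
          refine Real.rpow_le_rpow_of_exponent_le (by norm_num) ?_
          have : P.α * L ≤ α * L := by gcongr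
          linarith
        gcongr
      have h4 : |η x - 1 / 2| ≤ 2 * T + biasConst d α * P.lam * (2 : ℝ) ^ (-(P.α * L)) := by
        rw [abs_le] at hest ⊢
        constructor <;> linarith
      refine h4.trans ?_
      rw [coverConst, hT]
      have : 0 ≤ 6 * Real.sqrt d * P.lam * (2 : ℝ) ^ (-(P.α * L)) := by positivity
      linarith

lemma finalDepth_spec (P : SubInput) (Z : Tape d) :
    ∀ l ∈ Finset.Icc 1 (P.finalDepth Z), P.LoopCond Z l := by
  exact @Nat.findGreatest_spec 0 (fun L => ∀ l ∈ Finset.Icc 1 L, P.LoopCond Z l)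
    (fun _ => Classical.propDecidable _) ⌊P.n⌋₊ (Nat.zero_le ⌊P.n⌋₊) (by simp)

lemma le_used (hP : ValidInput P) (hd : 0 < d) {m : ℕ}
    (h : ∀ l ∈ Finset.Icc 1 m, (P.active Z l).Nonempty) : m ≤ P.used Z m := by
  rw [SubInput.used]
  calc m = ∑ _l ∈ Finset.Icc 1 m, 1 := by simp
    _ ≤ _ := Finset.sum_le_sum fun l hl => Nat.mul_pos (h l hl).card_pos (hP.tCenter_pos hd l)

/-- Every treated depth costs at least one label, so the bound ⌊n⌋ on the search defining
`finalDepth` never binds and the loop ends only when its condition fails. -/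
lemma not_loopCond_finalDepth_succ (hP : ValidInput P) (hd : 0 < d) :
    ¬ P.LoopCond Z (P.finalDepth Z + 1) := by
  classical
  intro hcon
  have hall : ∀ l ∈ Finset.Icc 1 (P.finalDepth Z + 1), P.LoopCond Z l := by
    intro l hl
    rcases eq_or_ne l (P.finalDepth Z + 1) with h | h
    · rw [h]; exact hcon
    · refine finalDepth_spec P Z l ?_
      rw [Finset.mem_Icc] at hl ⊢; omega
  have hle : P.finalDepth Z + 1 ≤ ⌊P.n⌋₊ := by
    refine Nat.le_floor ?_
    have h1 := le_used hP hd fun l hl => (hall l hl).1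
    have h2 := hcon.2
    have h3 : ((P.finalDepth Z + 1 : ℕ) : ℝ) ≤ P.used Z (P.finalDepth Z + 1) := by exact_mod_cast h1
    have : (0 : ℝ) ≤ ((P.active Z (P.finalDepth Z + 1)).card : ℝ) *
      (P.tFull d (P.finalDepth Z + 1) : ℝ) := by positivity
    linarith
  have h4 : P.finalDepth Z + 1 ≤ P.finalDepth Z := by
    exact @Nat.le_findGreatest _ (fun L => ∀ l ∈ Finset.Icc 1 L, P.LoopCond Z l)
      (fun _ => Classical.propDecidable _) ⌊P.n⌋₊ hle hall
  omega

lemma requests_le (P : SubInput) (Z : Tape d) (hn : 0 ≤ P.n) : (P.requests Z : ℝ) ≤ P.n := by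
  rcases Nat.eq_zero_or_pos (P.finalDepth Z) with h | h
  · rw [SubInput.requests, h]
    simpa [SubInput.used, SubInput.active] using hn
  · have h1 := (finalDepth_spec P Z (P.finalDepth Z) (Finset.mem_Icc.2 ⟨h, le_rfl⟩)).2
    refine le_trans ?_ h1
    rw [SubInput.requests]
    split_ifs
    · push_cast; exact le_rfl
    · push_cast
      have : (0 : ℝ) ≤ ((P.active Z (P.finalDepth Z)).card : ℝ) *
        (P.tFull d (P.finalDepth Z) : ℝ) := by positivity
      simpa using this

/-- Active cells are counted by the whole grid: with an arbitrary marginal, the margin condition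
gives no control on their number. -/
lemma active_eq_empty_or_budget (hP : ValidInput P) (hd : 0 < d) :
    P.active Z (P.finalDepth Z + 1) = ∅ ∨ P.n <
      ∑ l ∈ Finset.Icc 1 (P.finalDepth Z + 1), (2 : ℝ) ^ (l * d) * P.tCenter d l +
        (2 : ℝ) ^ ((P.finalDepth Z + 1) * d) * P.tFull d (P.finalDepth Z + 1) := by
  have h := not_loopCond_finalDepth_succ (Z := Z) hP hd
  rw [SubInput.LoopCond, not_and_or, Finset.not_nonempty_iff_eq_empty, not_le] at h
  refine h.imp_right fun h => h.trans_le ?_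
  have hc : ∀ l, ((P.active Z l).card : ℝ) ≤ 2 ^ (l * d) := fun l => by
    exact_mod_cast card_active_le P Z l
  refine add_le_add ?_ (mul_le_mul_of_nonneg_right (hc _) (by positivity))
  rw [SubInput.used]
  push_cast
  exact Finset.sum_le_sum fun l _ => mul_le_mul_of_nonneg_right (hc l) (by positivity)

end Phase

/-! ### Comparison of powers of λ, of n and of cell sides with the rate. -/

section Rate

/-- The rate of estimation of the regression function near the level `1/2`. -/
def rate (d : ℕ) (α : ℝ) (n : ℕ) (δ lam : ℝ) : ℝ :=
  lam ^ (d / (2 * α + d)) *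
    (Real.log n ^ 3 * Real.log (lam * n / δ) / n) ^ (α / (2 * α + d))

/-- The standing assumptions on the input of the adaptive algorithm. -/
structure ValidParams (α : ℝ) (n : ℕ) (δ lam : ℝ) : Prop where
  α_pos : 0 < α
  δ_pos : 0 < δ
  δ_lt : δ < 1
  one_le_lam : 1 ≤ lam
  flog_pos : 0 < flog n
  inv_le : 1 / (flog n : ℝ) ≤ α
  le_flog : α ≤ flog n

variable {d n : ℕ} {α δ lam : ℝ}

namespace ValidParams

lemma one_le_flog (h : ValidParams α n δ lam) : (1 : ℝ) ≤ flog n := by exact_mod_cast h.flog_pos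

lemma flog_le_log (h : ValidParams α n δ lam) : (flog n : ℝ) ≤ Real.log n := by
  refine Nat.floor_le ?_
  by_contra hcon
  have := h.flog_pos
  rw [flog, Nat.floor_of_nonpos (by linarith)] at this
  omega

lemma one_le_log (h : ValidParams α n δ lam) : 1 ≤ Real.log n := h.one_le_flog.trans h.flog_le_log

lemma log_le (h : ValidParams α n δ lam) : Real.log n ≤ 2 * flog n := by
  have h1 : Real.log n < flog n + 1 := Nat.lt_floor_add_one _
  linarith [h.one_le_flog]

lemma n_pos (h : ValidParams α n δ lam) : (0 : ℝ) < n := by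
  rcases Nat.eq_zero_or_pos n with h0 | h0
  · have := h.one_le_log
    rw [h0] at this; norm_num at this
  · exact_mod_cast h0

lemma one_le_n (h : ValidParams α n δ lam) : (1 : ℝ) ≤ n := by
  have := h.n_pos
  exact_mod_cast (by exact_mod_cast this : 0 < n)

lemma n_le_eight_pow (h : ValidParams α n δ lam) : (n : ℝ) ≤ 8 ^ flog n := by
  have he : Real.exp 2 ≤ 8 := by
    have h1 := Real.exp_one_lt_d9
    have h2 : Real.exp 2 = Real.exp 1 * Real.exp 1 := by rw [← Real.exp_add]; norm_num
    nlinarith [Real.exp_pos 1]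
  calc (n : ℝ) = Real.exp (Real.log n) := (Real.exp_log h.n_pos).symm
    _ ≤ Real.exp (flog n * 2) := Real.exp_le_exp.2 (by linarith [h.log_le])
    _ = Real.exp 2 ^ flog n := by rw [← Real.exp_nat_mul]
    _ ≤ _ := pow_le_pow_left₀ (Real.exp_pos _).le he _

lemma log_le_logRatio (h : ValidParams α n δ lam) : Real.log n ≤ Real.log (lam * n / δ) := by
  have h1 := h.δ_pos
  refine Real.log_le_log h.n_pos ?_
  rw [le_div_iff₀ h1]
  have := h.n_pos
  nlinarith [h.δ_lt, h.one_le_lam]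

lemma log_inv_δ_le (h : ValidParams α n δ lam) : Real.log (1 / δ) ≤ Real.log (lam * n / δ) := by
  have h1 := h.δ_pos
  refine Real.log_le_log (by positivity) ?_
  gcongr
  nlinarith [h.one_le_lam, h.one_le_n]

lemma one_le_logs (h : ValidParams α n δ lam) :
    1 ≤ Real.log n ^ 3 * Real.log (lam * n / δ) :=
  one_le_mul_of_one_le_of_one_le (one_le_pow₀ h.one_le_log) (h.one_le_log.trans h.log_le_logRatio)

lemma rate_pos (h : ValidParams α n δ lam) : 0 < rate d α n δ lam := by
  have h1 := h.one_le_logs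
  have h2 := h.n_pos
  have h3 := h.one_le_lam
  unfold rate; positivity

/-- A lower bound on the rate from a lower bound on the quotient in its definition. -/
lemma rate_ge (h : ValidParams α n δ lam) (hd : 0 < d) {C y : ℝ} (hC : 1 ≤ C) (hy : 0 < y)
    (hle : y / C ≤ Real.log n ^ 3 * Real.log (lam * n / δ) / n) :
    lam ^ (d / (2 * α + d)) * y ^ (α / (2 * α + d)) ≤ C * rate d α n δ lam := by
  have hα := h.α_pos
  have hd0 : (0 : ℝ) < d := by exact_mod_cast hd
  have hlam : 0 < lam := by linarith [h.one_le_lam]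
  have he : 0 < α / (2 * α + d) := by positivity
  have he1 : α / (2 * α + d) ≤ 1 := by rw [div_le_one (by positivity)]; linarith
  have h1 : y ^ (α / (2 * α + d)) ≤ C *
      (Real.log n ^ 3 * Real.log (lam * n / δ) / n) ^ (α / (2 * α + d)) := by
    calc y ^ (α / (2 * α + d)) = (C * (y / C)) ^ (α / (2 * α + d)) := by
          rw [mul_div_cancel₀ _ (by positivity)]
      _ = C ^ (α / (2 * α + d)) * (y / C) ^ (α / (2 * α + d)) :=
          Real.mul_rpow (by positivity) (by positivity)
      _ ≤ _ := by
          gcongr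
          exact Real.rpow_le_self_of_one_le hC he1
  unfold rate
  calc _ ≤ lam ^ (d / (2 * α + d)) * (C *
      (Real.log n ^ 3 * Real.log (lam * n / δ) / n) ^ (α / (2 * α + d))) := by gcongr
    _ = _ := by ring

lemma mul_rpow_le_rate (h : ValidParams α n δ lam) (hd : 0 < d) {C y : ℝ} (hC : 1 ≤ C)
    (hy : 0 < y)
    (hle : lam ^ 2 / y ^ (2 * α + d) / C ≤ Real.log n ^ 3 * Real.log (lam * n / δ) / n) :
    lam * y ^ (-α) ≤ C * rate d α n δ lam := by
  have hα := h.α_pos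
  have hd0 : (0 : ℝ) < d := by exact_mod_cast hd
  have hlam : 0 < lam := by linarith [h.one_le_lam]
  refine le_trans (le_of_eq ?_) (h.rate_ge hd hC (by positivity) hle)
  rw [Real.div_rpow (by positivity) (by positivity), ← Real.rpow_natCast, ← Real.rpow_mul hlam.le,
    ← Real.rpow_mul hy.le, mul_div_assoc', ← Real.rpow_add hlam, Real.rpow_neg hy.le,
    div_eq_mul_inv]
  congr 1
  · nth_rewrite 1 [← Real.rpow_one lam]
    congr 1; push_cast; field_simp; ring
  · congr 2; field_simp

lemma one_le_mul_rate (h : ValidParams α n δ lam) (hd : 0 < d) {C : ℝ} (hC : 1 ≤ C)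
    (hle : lam ^ (-(d / α)) / C ≤ Real.log n ^ 3 * Real.log (lam * n / δ) / n) :
    1 ≤ C * rate d α n δ lam := by
  have hα := h.α_pos
  have hd0 : (0 : ℝ) < d := by exact_mod_cast hd
  have hlam : 0 < lam := by linarith [h.one_le_lam]
  refine le_trans (le_of_eq ?_) (h.rate_ge hd hC (by positivity) hle)
  rw [← Real.rpow_mul hlam.le, ← Real.rpow_add hlam]
  have : (d : ℝ) / (2 * α + d) + -(d / α) * (α / (2 * α + d)) = 0 := by field_simp; ring
  rw [this, Real.rpow_zero]

lemma one_le_or_rpow_le_rate (h : ValidParams α n δ lam) (hd : 0 < d) :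
    1 ≤ rate d α n δ lam ∨ lam * (n : ℝ) ^ (-α) ≤ rate d α n δ lam := by
  have hα := h.α_pos
  have hn := h.n_pos
  have hd1 : (1 : ℝ) ≤ d := by exact_mod_cast hd
  have hd0 : (0 : ℝ) < d := by linarith
  have hlam : 0 < lam := by linarith [h.one_le_lam]
  have hQ : (n : ℝ)⁻¹ ≤ Real.log n ^ 3 * Real.log (lam * n / δ) / n := by
    rw [inv_eq_one_div]; gcongr; exact h.one_le_logs
  rcases le_total ((n : ℝ) ^ α) (lam ^ (d : ℝ)) with hc | hc
  · left
    have := h.one_le_mul_rate hd le_rfl (C := 1) (by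
      rw [div_one]
      refine le_trans ?_ hQ
      rw [Real.rpow_neg hlam.le]
      refine inv_anti₀ hn ?_
      calc (n : ℝ) = ((n : ℝ) ^ α) ^ (1 / α) := by
            rw [← Real.rpow_mul hn.le, mul_one_div_cancel hα.ne', Real.rpow_one]
        _ ≤ (lam ^ (d : ℝ)) ^ (1 / α) := by gcongr
        _ = _ := by rw [← Real.rpow_mul hlam.le]; congr 1; ring)
    linarith
  · right
    have hl : lam ≤ (n : ℝ) ^ (α / d) := by
      calc lam = (lam ^ (d : ℝ)) ^ (1 / (d : ℝ)) := by
            rw [← Real.rpow_mul hlam.le, mul_one_div_cancel hd0.ne', Real.rpow_one]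
        _ ≤ ((n : ℝ) ^ α) ^ (1 / (d : ℝ)) := by gcongr
        _ = _ := by rw [← Real.rpow_mul hn.le]; congr 1; ring
    have h1 := h.mul_rpow_le_rate hd le_rfl (C := 1) (y := (n : ℝ) ^ (1 / (d : ℝ)))
      (by positivity) (by
        rw [div_one]
        refine le_trans ?_ hQ
        rw [← Real.rpow_mul hn.le, div_le_iff₀ (by positivity)]
        have e : (n : ℝ) ^ (1 / (d : ℝ) * (2 * α + d)) = ((n : ℝ) ^ (α / d)) ^ 2 * n := by
          rw [← Real.rpow_natCast, ← Real.rpow_mul hn.le]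
          nth_rewrite 3 [← Real.rpow_one (n : ℝ)]
          rw [← Real.rpow_add hn]
          congr 1; push_cast; field_simp
        rw [e, mul_comm, mul_assoc, mul_inv_cancel₀ hn.ne', mul_one]
        gcongr)
    rw [one_mul] at h1
    refine le_trans ?_ h1
    rw [← Real.rpow_mul hn.le]
    gcongr
    · exact h.one_le_n
    · rw [mul_neg, neg_le_neg_iff, one_div_mul_eq_div]
      exact div_le_self hα.le hd1

lemma two_rpow_le (h : ValidParams α n δ lam) {L : ℕ} (hL : 6 * flog n ≤ L) {a : ℝ}
    (ha : α / 2 ≤ a) : (2 : ℝ) ^ (-(a * L)) ≤ (n : ℝ) ^ (-α) := by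
  have hα := h.α_pos
  have hn := h.n_pos
  have h6 : 6 * (flog n : ℝ) ≤ L := by exact_mod_cast hL
  have hfl : (0 : ℝ) ≤ flog n := Nat.cast_nonneg _
  calc (2 : ℝ) ^ (-(a * L)) ≤ (2 : ℝ) ^ (-(3 * flog n * α)) := by
        refine Real.rpow_le_rpow_of_exponent_le (by norm_num) ?_
        nlinarith
    _ = ((8 : ℝ) ^ flog n) ^ (-α) := by
        rw [← Real.rpow_natCast, show (8 : ℝ) = 2 ^ (3 : ℝ) by norm_num,
          ← Real.rpow_mul (by norm_num), ← Real.rpow_mul (by norm_num)]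
        congr 1; ring
    _ ≤ _ := Real.rpow_le_rpow_of_nonpos hn h.n_le_eight_pow (by linarith)

end ValidParams

end Rate

/-! ### Label counts and the depth reached by a phase. -/

section Budget
variable {d n : ℕ} {α δ lam : ℝ}

lemma ValidParams.validInput (h : ValidParams α n δ lam) {i : ℕ} (hi : 1 ≤ i) :
    ValidInput (phaseInput n δ lam i) where
  δ_pos := div_pos h.δ_pos (pow_pos (by linarith [h.one_le_flog]) 3)
  δ_lt := (div_le_self h.δ_pos.le (one_le_pow₀ h.one_le_flog)).trans_lt h.δ_lt
  α_pos := div_pos (by exact_mod_cast hi) (pow_pos (by linarith [h.one_le_flog]) 2)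
  one_le_lam := h.one_le_lam

/-- Constant in the bound on the number of samples per cell. -/
def samplesConst (d : ℕ) (α : ℝ) : ℝ :=
  (4 : ℝ) ^ (2 * d + 1) * (α + 1) ^ (2 * d) * (4 + 6 * (d + 1) * (α + 1))

/-- log(1/δ_l) grows linearly in l, so depths must be of order log n. The 4 is 1 for log(1/δ) plus 3
for the division of δ by ⌊log n⌋³. -/
lemma ValidParams.log_deltaLevel_le (h : ValidParams α n δ lam) {a : ℝ} (ha : a ≤ α) {l : ℕ}
    (hl : l ≤ 6 * flog n) :
    Real.log (1 / deltaLevel d (δ / (flog n : ℝ) ^ 3) a l) ≤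
      (4 + 6 * (d + 1) * (α + 1)) * Real.log (lam * n / δ) := by
  have hf := h.one_le_flog
  have hf0 : (0 : ℝ) < flog n := by linarith
  have hδ := h.δ_pos
  set x : ℝ := (l : ℝ) * ((d : ℝ) + 1) * max a 1 with hx
  have e : 1 / deltaLevel d (δ / (flog n : ℝ) ^ 3) a l = 1 / δ * (flog n : ℝ) ^ 3 * (2 : ℝ) ^ x := by
    rw [deltaLevel, ← hx, Real.rpow_neg (by norm_num)]
    have : (2 : ℝ) ^ x ≠ 0 := by positivity
    field_simp
  rw [e, Real.log_mul (by positivity) (by positivity), Real.log_mul (by positivity) (by positivity),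
    Real.log_pow, Real.log_rpow (by norm_num)]
  have h1 := h.log_inv_δ_le
  have h2 := h.log_le_logRatio
  have h3 := h.flog_le_log
  have h4 : Real.log (flog n : ℝ) ≤ flog n := (Real.log_le_sub_one_of_pos hf0).trans (by linarith)
  have h5 : x ≤ 6 * flog n * ((d : ℝ) + 1) * (α + 1) := by
    have hl' : (l : ℝ) ≤ 6 * flog n := by exact_mod_cast hl
    have hm : max a 1 ≤ α + 1 := max_le (by linarith) (by linarith [h.α_pos])
    have : 0 ≤ max a 1 := le_max_of_le_right zero_le_one
    rw [hx]; gcongr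
  have h6 : x * Real.log 2 ≤ x := by
    have : Real.log 2 ≤ 1 := by linarith [Real.log_two_lt_d9]
    have hx0 : 0 ≤ x := by
      have : 0 ≤ max a 1 := le_max_of_le_right zero_le_one
      positivity
    exact mul_le_of_le_one_right hx0 this
  have h7 : 6 * flog n * ((d : ℝ) + 1) * (α + 1) ≤
      6 * ((d : ℝ) + 1) * (α + 1) * Real.log (lam * n / δ) := by
    have : 0 ≤ 6 * ((d : ℝ) + 1) * (α + 1) := by have := h.α_pos; positivity
    nlinarith
  push_cast
  nlinarith

lemma one_le_samplesFactor (hα : 0 < α) (d : ℕ) :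
    1 ≤ (4 : ℝ) ^ (2 * d + 1) * (α + 1) ^ (2 * d) :=
  one_le_mul_of_one_le_of_one_le (one_le_pow₀ (by norm_num)) (one_le_pow₀ (by linarith))

lemma one_le_samplesConst (hα : 0 < α) (d : ℕ) : 1 ≤ samplesConst d α := by
  refine one_le_mul_of_one_le_of_one_le (one_le_samplesFactor hα d) ?_
  have : 0 ≤ 6 * ((d : ℝ) + 1) * (α + 1) := by positivity
  linarith

/-- One bound serves all depths up to m and all parameters up to α. The summand 1 is the rounding,
which matters when λ is large compared with 2^{αm}. -/
lemma ValidParams.numSamples_le (h : ValidParams α n δ lam) (hd : 0 < d) {a : ℝ} (ha0 : 0 < a)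
    (ha : a ≤ α) {l m : ℕ} (hl : l ≤ 6 * flog n) (hlm : l ≤ m) :
    (numSamples d (δ / (flog n : ℝ) ^ 3) lam a l : ℝ) ≤
      1 + samplesConst d α * Real.log (lam * n / δ) * ((2 : ℝ) ^ (α * m)) ^ 2 / lam ^ 2 := by
  have hα := h.α_pos
  have hlam := h.one_le_lam
  have hlam0 : 0 < lam := by linarith
  have hf : (0 : ℝ) < flog n := by linarith [h.one_le_flog]
  have hδ' : 0 < δ / (flog n : ℝ) ^ 3 := div_pos h.δ_pos (by positivity)
  have hδ1 : δ / (flog n : ℝ) ^ 3 < 1 :=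
    (div_le_self h.δ_pos.le (one_le_pow₀ h.one_le_flog)).trans_lt h.δ_lt
  have hlog := log_deltaLevel_pos (d := d) hδ' hδ1 a l
  have hlogle := h.log_deltaLevel_le (d := d) ha hl
  set lg := Real.log (1 / deltaLevel d (δ / (flog n : ℝ) ^ 3) a l)
  set Lg := Real.log (lam * n / δ)
  have hd1 : (1 : ℝ) ≤ d := by exact_mod_cast hd
  have hb : lam * ((2 : ℝ) ^ (α * m))⁻¹ ≤ bLevel d lam a l := by
    rw [bLevel, ← Real.rpow_neg (by norm_num)]
    have h1 : 1 ≤ (d : ℝ) ^ (min a 1 / 2) :=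
      Real.one_le_rpow hd1 (div_nonneg (le_min ha0.le zero_le_one) (by norm_num))
    have h2 : (2 : ℝ) ^ (-(α * m)) ≤ (2 : ℝ) ^ (-((l : ℝ) * a)) := by
      refine Real.rpow_le_rpow_of_exponent_le (by norm_num) ?_
      have : (l : ℝ) ≤ m := by exact_mod_cast hlm
      have : (l : ℝ) * a ≤ m * α := by gcongr
      linarith
    calc lam * (2 : ℝ) ^ (-(α * m)) ≤ lam * (2 : ℝ) ^ (-((l : ℝ) * a)) := by gcongr
      _ ≤ _ := by
        gcongr
        exact le_mul_of_one_le_right hlam0.le h1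
  have hb2 : lg / bLevel d lam a l ^ 2 ≤ (4 + 6 * (d + 1) * (α + 1)) * Lg *
      ((2 : ℝ) ^ (α * m)) ^ 2 / lam ^ 2 := by
    calc lg / bLevel d lam a l ^ 2 ≤ lg / (lam * ((2 : ℝ) ^ (α * m))⁻¹) ^ 2 := by gcongr
      _ = lg * ((2 : ℝ) ^ (α * m)) ^ 2 / lam ^ 2 := by
        have : (2 : ℝ) ^ (α * m) ≠ 0 := by positivity
        field_simp
      _ ≤ _ := by gcongr
  have hbpos := bLevel_pos hd hlam a l
  have hq : 0 ≤ lg / bLevel d lam a l ^ 2 := by positivity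
  have key : (numSamples d (δ / (flog n : ℝ) ^ 3) lam a l : ℝ) ≤
      1 + (4 : ℝ) ^ (2 * d + 1) * (α + 1) ^ (2 * d) * (lg / bLevel d lam a l ^ 2) := by
    rw [numSamples]
    split_ifs with hc
    · refine (Nat.ceil_lt_add_one (by positivity)).le.trans ?_
      have h1 := one_le_samplesFactor hα d
      have h2 : lg / (2 * bLevel d lam a l ^ 2) ≤ lg / bLevel d lam a l ^ 2 := by
        gcongr
        nlinarith [sq_nonneg (bLevel d lam a l)]
      nlinarith
    · refine (Nat.ceil_lt_add_one (by positivity)).le.trans ?_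
      rw [add_comm]
      gcongr
  refine key.trans ?_
  have := one_le_samplesFactor hα d
  rw [samplesConst]
  calc _ ≤ 1 + (4 : ℝ) ^ (2 * d + 1) * (α + 1) ^ (2 * d) * ((4 + 6 * (d + 1) * (α + 1)) * Lg *
      ((2 : ℝ) ^ (α * m)) ^ 2 / lam ^ 2) := by gcongr
    _ = _ := by ring

lemma sum_two_pow_mul_le (hd : 0 < d) (m : ℕ) :
    ∑ l ∈ Finset.Icc 1 m, (2 : ℝ) ^ (l * d) ≤ 2 * 2 ^ (m * d) := by
  induction m with
  | zero => simp
  | succ m ih =>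
    rw [Finset.sum_Icc_succ_top (by omega)]
    have h1 : (2 : ℝ) ^ ((m + 1) * d) = 2 ^ (m * d) * 2 ^ d := by rw [← pow_add]; congr 1; ring
    have h2 : (2 : ℝ) ≤ 2 ^ d := by
      calc (2 : ℝ) = 2 ^ 1 := by norm_num
        _ ≤ 2 ^ d := pow_le_pow_right₀ (by norm_num) hd
    rw [h1]
    nlinarith [pow_pos (show (0 : ℝ) < 2 by norm_num) (m * d)]

/-- Constant in the bound on the depth reached by a phase. -/
def budgetConst (d : ℕ) (α : ℝ) : ℝ :=
  3 * 2 ^ d * (1 + samplesConst d α * ((2 : ℝ) ^ α) ^ 2)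

lemma one_le_budgetConst (hα : 0 < α) (d : ℕ) : 1 ≤ budgetConst d α := by
  have h1 := one_le_samplesConst hα d
  have h2 : (1 : ℝ) ≤ 2 ^ d := one_le_pow₀ (by norm_num)
  have h3 : 0 ≤ samplesConst d α * ((2 : ℝ) ^ α) ^ 2 := by positivity
  rw [budgetConst]
  nlinarith

/-- If the budget of a phase does not suffice for the depth `L + 1`, then `L` is large. -/
lemma ValidParams.depth_bound (h : ValidParams α n δ lam) (hd : 0 < d) {i L : ℕ} (hi : 1 ≤ i)
    (hiα : (phaseInput n δ lam i).α ≤ α)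
    (hN : (phaseInput n δ lam i).n <
      ∑ l ∈ Finset.Icc 1 (L + 1), (2 : ℝ) ^ (l * d) * (phaseInput n δ lam i).tCenter d l +
        (2 : ℝ) ^ ((L + 1) * d) * (phaseInput n δ lam i).tFull d (L + 1)) (hL : L + 1 ≤ 6 * flog n) :
    1 ≤ budgetConst d α * rate d α n δ lam ∨
      lam * (2 : ℝ) ^ (-(α * L)) ≤ budgetConst d α * rate d α n δ lam := by
  have hα := h.α_pos
  have hlam0 : 0 < lam := by linarith [h.one_le_lam]
  have hn := h.n_pos
  have hlog1 := h.one_le_log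
  have hf : (0 : ℝ) < flog n := by linarith [h.one_le_flog]
  have hLg : 1 ≤ Real.log (lam * n / δ) := hlog1.trans h.log_le_logRatio
  have hpα := (h.validInput hi).α_pos
  have hK := one_le_samplesConst hα d
  have hC := one_le_budgetConst hα d
  have hd0 : (0 : ℝ) < d := by exact_mod_cast hd
  set Lg := Real.log (lam * n / δ) with hLgdef
  set y : ℝ := (2 : ℝ) ^ L with hy
  have hy0 : 0 < y := by positivity
  set T : ℝ := 1 + samplesConst d α * Lg * ((2 : ℝ) ^ (α * (L + 1 : ℕ))) ^ 2 / lam ^ 2 with hT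
  have hT0 : 0 < T := by positivity
  have ht : ∀ l ∈ Finset.Icc 1 (L + 1), ((phaseInput n δ lam i).tCenter d l : ℝ) ≤ T := by
    intro l hl
    have hl2 := (Finset.mem_Icc.1 hl).2
    exact h.numSamples_le hd (lt_min hpα one_pos) ((min_le_left _ _).trans hiα) (by omega) hl2
  have htf : ((phaseInput n δ lam i).tFull d (L + 1) : ℝ) ≤ T :=
    h.numSamples_le hd hpα hiα hL le_rfl
  have h1 : (n : ℝ) / (flog n : ℝ) ^ 3 ≤ 3 * 2 ^ ((L + 1) * d) * T := by
    refine hN.le.trans ?_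
    calc _ ≤ ∑ l ∈ Finset.Icc 1 (L + 1), (2 : ℝ) ^ (l * d) * T + 2 ^ ((L + 1) * d) * T := by
          refine add_le_add (Finset.sum_le_sum fun l hl => ?_) ?_
          · exact mul_le_mul_of_nonneg_left (ht l hl) (by positivity)
          · exact mul_le_mul_of_nonneg_left htf (by positivity)
      _ ≤ 2 * 2 ^ ((L + 1) * d) * T + 2 ^ ((L + 1) * d) * T := by
          rw [← Finset.sum_mul]
          gcongr
          exact sum_two_pow_mul_le hd (L + 1)
      _ = _ := by ring
  have hyα : (2 : ℝ) ^ (α * (L + 1 : ℕ)) = y ^ α * 2 ^ α := by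
    rw [hy, ← Real.rpow_natCast, ← Real.rpow_mul (by norm_num), ← Real.rpow_add (by norm_num)]
    congr 1; push_cast; ring
  have hyd : (2 : ℝ) ^ ((L + 1) * d) = y ^ (d : ℝ) * 2 ^ d := by
    rw [hy, Real.rpow_natCast, ← pow_mul, ← pow_add]; congr 1; ring
  rw [hyd] at h1
  rw [hyα] at hT
  have h2 : (n : ℝ) ≤ 3 * (y ^ (d : ℝ) * 2 ^ d) * T * Real.log n ^ 3 := by
    rw [div_le_iff₀ (by positivity)] at h1
    refine h1.trans ?_
    have := h.flog_le_log
    gcongr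
  -- W dominates both the rounding and the main term of the sample size; it is taken to be 1 or
  -- λ^{-2} 2^{2αL} below.
  have hTle : ∀ W : ℝ, 1 ≤ W → y ^ α * y ^ α / lam ^ 2 ≤ W →
      T ≤ (1 + samplesConst d α * ((2 : ℝ) ^ α) ^ 2) * Lg * W := by
    intro W hW1 hW
    have e : T = 1 + samplesConst d α * ((2 : ℝ) ^ α) ^ 2 * Lg * (y ^ α * y ^ α / lam ^ 2) := by
      rw [hT]; ring
    rw [e]
    have h3 : samplesConst d α * ((2 : ℝ) ^ α) ^ 2 * Lg * (y ^ α * y ^ α / lam ^ 2) ≤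
        samplesConst d α * ((2 : ℝ) ^ α) ^ 2 * Lg * W := by gcongr
    have h4 : 1 ≤ Lg * W := one_le_mul_of_one_le_of_one_le hLg hW1
    nlinarith
  have hfin : ∀ W : ℝ, 1 ≤ W → y ^ α * y ^ α / lam ^ 2 ≤ W →
      (y ^ (d : ℝ) * W)⁻¹ / budgetConst d α ≤ Real.log n ^ 3 * Lg / n := by
    intro W hW1 hW
    have h3 := hTle W hW1 hW
    rw [div_le_div_iff₀ (by linarith) hn, inv_mul_le_iff₀ (by positivity)]
    refine h2.trans ?_
    calc _ ≤ 3 * (y ^ (d : ℝ) * 2 ^ d) * ((1 + samplesConst d α * ((2 : ℝ) ^ α) ^ 2) * Lg * W) *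
          Real.log n ^ 3 := by gcongr
      _ = _ := by rw [budgetConst]; ring
  -- If 2^{αL} ≤ λ, then up to logarithms n is at most of order λ^{d/α}, the degenerate regime.
  -- Otherwise the main term dominates.
  rcases le_total (y ^ α) lam with hc | hc
  · left
    refine h.one_le_mul_rate hd hC (le_trans ?_ (hfin 1 le_rfl ?_))
    · rw [mul_one, Real.rpow_neg hlam0.le]
      gcongr
      calc y ^ (d : ℝ) = (y ^ α) ^ (d / α) := by
            rw [← Real.rpow_mul hy0.le]; congr 1; field_simp
        _ ≤ lam ^ (d / α) := by gcongr
    · rw [div_le_one (by positivity), sq]; gcongr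
  · right
    have e : (2 : ℝ) ^ (-(α * L)) = y ^ (-α) := by
      rw [hy, ← Real.rpow_natCast, ← Real.rpow_mul (by norm_num)]; congr 1; ring
    rw [e]
    refine h.mul_rpow_le_rate hd hC hy0 (le_trans ?_ (hfin _ ?_ le_rfl))
    · apply le_of_eq
      congr 1
      rw [two_mul, Real.rpow_add hy0, Real.rpow_add hy0]
      have : y ^ α ≠ 0 := by positivity
      have : y ^ (d : ℝ) ≠ 0 := by positivity
      field_simp
    · rw [le_div_iff₀ (by positivity), one_mul, sq]; gcongr

/-- If the budget of a phase does not suffice for the depth `L + 1`, then the resolution at the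
depth `L` is of the order of the rate. -/
lemma ValidParams.resolution_le (h : ValidParams α n δ lam) (hd : 0 < d) {i L : ℕ} (hi : 1 ≤ i)
    (hiα : (phaseInput n δ lam i).α ≤ α)
    (hN : (phaseInput n δ lam i).n <
      ∑ l ∈ Finset.Icc 1 (L + 1), (2 : ℝ) ^ (l * d) * (phaseInput n δ lam i).tCenter d l +
        (2 : ℝ) ^ ((L + 1) * d) * (phaseInput n δ lam i).tFull d (L + 1)) :
    1 ≤ 64 * budgetConst d α * rate d α n δ lam ∨
      (lam * (2 : ℝ) ^ (-(α * L)) ≤ 64 * budgetConst d α * rate d α n δ lam ∧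
        (α / 2 ≤ (phaseInput n δ lam i).α → α ≤ (phaseInput n δ lam i).α + 1 / (flog n : ℝ) ^ 2 →
          lam * (2 : ℝ) ^ (-((phaseInput n δ lam i).α * L)) ≤
            64 * budgetConst d α * rate d α n δ lam)) := by
  have hα := h.α_pos
  have hlam0 : 0 < lam := by linarith [h.one_le_lam]
  have hC := one_le_budgetConst hα d
  have hr := h.rate_pos (d := d)
  set a := (phaseInput n δ lam i).α with ha
  -- Very deep phases have resolution below λ n^{-α}, and no label count is needed.
  rcases le_or_gt (6 * flog n) L with hL | hL
  · have hCr : rate d α n δ lam ≤ 64 * budgetConst d α * rate d α n δ lam := by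
      nlinarith
    rcases h.one_le_or_rpow_le_rate hd with h1 | h1
    · exact Or.inl (h1.trans hCr)
    · refine Or.inr ⟨?_, fun h2 _ => ?_⟩
      · refine le_trans (mul_le_mul_of_nonneg_left ?_ hlam0.le) (h1.trans hCr)
        exact h.two_rpow_le hL (by linarith)
      · exact le_trans (mul_le_mul_of_nonneg_left (h.two_rpow_le hL h2) hlam0.le) (h1.trans hCr)
  · have hB0 : 0 < budgetConst d α * rate d α n δ lam := by positivity
    rcases h.depth_bound hd hi hiα hN hL with h1 | h1
    · left; nlinarith
    · refine Or.inr ⟨by nlinarith, fun _ h2 => ?_⟩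
      have hf := h.one_le_flog
      -- The parameters are spaced by ⌊log n⌋^{-2}, so over fewer than 6⌊log n⌋ levels replacing α
      -- by a costs at most 2^6 = 64.
      have h3 : (α - a) * L ≤ 6 := by
        have h4 : (L : ℝ) ≤ 6 * flog n := by exact_mod_cast hL.le
        have h5 : α - a ≤ 1 / (flog n : ℝ) ^ 2 := by linarith
        calc (α - a) * L ≤ 1 / (flog n : ℝ) ^ 2 * (6 * flog n) :=
              mul_le_mul h5 h4 (by positivity) (by positivity)
          _ = 6 / flog n := by field_simp
          _ ≤ 6 := div_le_self (by norm_num) hf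
      have h6 : (2 : ℝ) ^ (-(a * L)) ≤ 64 * (2 : ℝ) ^ (-(α * L)) := by
        rw [show (64 : ℝ) = 2 ^ (6 : ℝ) by norm_num, ← Real.rpow_add (by norm_num)]
        refine Real.rpow_le_rpow_of_exponent_le (by norm_num) ?_
        linarith
      calc _ ≤ lam * (64 * (2 : ℝ) ^ (-(α * L))) := by gcongr
        _ = 64 * (lam * (2 : ℝ) ^ (-(α * L))) := by ring
        _ ≤ 64 * (budgetConst d α * rate d α n δ lam) := by gcongr
        _ = _ := by ring

end Budget

/-! ### The aggregated classifier is correct away from the decision boundary. -/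

section Aggregation

variable {d n : ℕ} {α δ lam : ℝ} {η : Pt d → ℝ} {x : Pt d}

lemma mem_aggregate_succ {Z : ℕ → Tape d} {i : ℕ} {y : Bool} :
    x ∈ aggregate n δ lam Z (i + 1) y ↔ x ∈ aggregate n δ lam Z i y ∨
      (x ∈ (phaseInput n δ lam (i + 1)).output (Z (i + 1)) y ∧
        x ∉ aggregate n δ lam Z i (!y)) := by
  rw [aggregate]; rfl

lemma aggregate_mono {Z : ℕ → Tape d} {i j : ℕ} (hij : i ≤ j) {y : Bool}
    (hx : x ∈ aggregate n δ lam Z i y) : x ∈ aggregate n δ lam Z j y := by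
  induction hij with
  | refl => exact hx
  | step _ ih => exact mem_aggregate_succ.2 (Or.inl ih)

/-- A phase adds to one set only points outside the other, so a settled label is never contradicted.
-/
lemma not_mem_aggregate_of_le {Z : ℕ → Tape d} {i j : ℕ} (hij : i ≤ j) {y : Bool}
    (hx : x ∈ aggregate n δ lam Z i y) (hx' : x ∉ aggregate n δ lam Z i (!y)) :
    x ∉ aggregate n δ lam Z j (!y) := by
  induction hij with
  | refl => exact hx'
  | step hk ih =>
    rw [mem_aggregate_succ, Bool.not_not]
    rintro (h | ⟨-, h⟩)
    · exact ih h
    · exact h (aggregate_mono hk hx)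

lemma mem_or_mem_aggregate_of_mem_output {Z : ℕ → Tape d} {i : ℕ} {y : Bool}
    (hx : x ∈ (phaseInput n δ lam (i + 1)).output (Z (i + 1)) y) :
    x ∈ aggregate n δ lam Z (i + 1) y ∨ x ∈ aggregate n δ lam Z (i + 1) (!y) := by
  by_cases h : x ∈ aggregate n δ lam Z i (!y)
  · exact Or.inr (aggregate_mono (Nat.le_succ i) h)
  · exact Or.inl (mem_aggregate_succ.2 (Or.inr ⟨hx, h⟩))

/-- A wrong label is never aggregated if, whenever a phase proposes one, an earlier phase has
proposed the right one. -/
lemma not_mem_aggregate_not {Z : ℕ → Tape d} {y : Bool} {m : ℕ}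
    (h : ∀ i, 1 ≤ i → i ≤ m → x ∈ (phaseInput n δ lam i).output (Z i) (!y) →
      ∃ j, 1 ≤ j ∧ j < i ∧ x ∈ (phaseInput n δ lam j).output (Z j) y) :
    x ∉ aggregate n δ lam Z m (!y) := by
  suffices H : ∀ i ≤ m, x ∉ aggregate n δ lam Z i (!y) from H m le_rfl
  intro i
  induction i using Nat.strong_induction_on with
  | _ i ih =>
    intro him
    cases i with
    | zero => simp [aggregate]
    | succ k =>
      rw [mem_aggregate_succ, Bool.not_not]
      rintro (h1 | ⟨h1, h2⟩)
      · exact ih k (Nat.lt_succ_self k) (by omega) h1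
      · obtain ⟨j, hj1, hj, hxj⟩ := h (k + 1) (by omega) him h1
        obtain ⟨j, rfl⟩ : ∃ j', j = j' + 1 := ⟨j - 1, by omega⟩
        rcases mem_or_mem_aggregate_of_mem_output hxj with h3 | h3
        · exact h2 (aggregate_mono (by omega) h3)
        · exact ih (j + 1) hj (by omega) h3

/-- From depth L₀ on, the gain 2^{l(α-1)} of order α over order 1 beats `biasConst`. This depth
depends on d and α only, so it may enter the constants. -/
lemma exists_depth (d : ℕ) (α : ℝ) :
    ∃ L₀ : ℕ, 1 < α → biasConst d α ≤ (2 : ℝ) ^ ((L₀ : ℝ) * (α - 1)) := by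
  by_cases hα : 1 < α
  · have h1 : 1 < (2 : ℝ) ^ (α - 1) := Real.one_lt_rpow (by norm_num) (by linarith)
    obtain ⟨L, hL⟩ := pow_unbounded_of_one_lt (biasConst d α) h1
    refine ⟨L, fun _ => hL.le.trans (le_of_eq ?_)⟩
    rw [← Real.rpow_natCast, ← Real.rpow_mul (by norm_num), mul_comm]
  · exact ⟨0, fun h => absurd h hα⟩

/-- The constant in front of the rate. -/
def marginConst (d : ℕ) (α : ℝ) (L₀ : ℕ) : ℝ :=
  (coverConst d α + 2 ^ (α * (L₀ + 3))) * (64 * budgetConst d α)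

lemma biasConst_le_coverConst (d : ℕ) (α : ℝ) : biasConst d α ≤ coverConst d α := by
  unfold coverConst
  have : (0 : ℝ) ≤ 2 * 4 ^ (d + 1) := by positivity
  have := Real.sqrt_nonneg d
  linarith

lemma one_le_coverConst (d : ℕ) (α : ℝ) : 1 ≤ coverConst d α := by
  unfold coverConst
  have : (1 : ℝ) ≤ 4 ^ (d + 1) := one_le_pow₀ (by norm_num)
  have := Real.sqrt_nonneg d
  linarith [biasConst_nonneg d α]

lemma one_le_marginConst (hα : 0 < α) (L₀ : ℕ) : 1 ≤ marginConst d α L₀ := by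
  unfold marginConst
  have h1 := one_le_coverConst d α
  have h2 := one_le_budgetConst hα d
  have h3 : (0 : ℝ) < 2 ^ (α * (L₀ + 3)) := by positivity
  nlinarith

lemma HolderClass.abs_sub_half_le (hη : HolderClass lam α η) (x : Pt d) : |η x - 1 / 2| ≤ 1 / 2 := by
  have := hη.1 x
  rw [abs_le]; constructor <;> linarith [this.1, this.2]

lemma ValidParams.const_mul_lt (h : ValidParams α n δ lam) {L₀ : ℕ}
    (hxE : marginConst d α L₀ * rate d α n δ lam < |η x - 1 / 2|) {c y : ℝ} (hc0 : 0 ≤ c)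
    (hc : c ≤ coverConst d α + 2 ^ (α * (L₀ + 3)))
    (hy : y ≤ 64 * budgetConst d α * rate d α n δ lam) : c * y < |η x - 1 / 2| := by
  have h1 := h.rate_pos (d := d)
  have h2 := one_le_budgetConst h.α_pos d
  refine lt_of_le_of_lt ?_ hxE
  unfold marginConst
  calc c * y ≤ c * (64 * budgetConst d α * rate d α n δ lam) := by gcongr
    _ ≤ (coverConst d α + 2 ^ (α * (L₀ + 3))) * (64 * budgetConst d α * rate d α n δ lam) := by
        gcongr
    _ = _ := by ring

lemma ValidParams.not_one_le (h : ValidParams α n δ lam) (hη : HolderClass lam α η) {L₀ : ℕ}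
    (hxE : marginConst d α L₀ * rate d α n δ lam < |η x - 1 / 2|) :
    ¬ 1 ≤ 64 * budgetConst d α * rate d α n δ lam := by
  intro h1
  have h2 := h.const_mul_lt hxE (c := 1) zero_le_one (by
    have := one_le_coverConst d α
    have : (0 : ℝ) < 2 ^ (α * (L₀ + 3)) := by positivity
    linarith) h1
  linarith [hη.abs_sub_half_le x]

/-- The phase with smoothness parameter `1` labels the points that lie well above the bias of the
first levels. -/
lemma ValidParams.mem_loopLabelled_one {L₀ : ℕ} {Z : ℕ → Tape d} (h : ValidParams α n δ lam)
    (hd : 0 < d) (hη : HolderClass lam α η) (hx : x ∈ unitCube d)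
    (hxE : marginConst d α L₀ * rate d α n δ lam < |η x - 1 / 2|) (hα1 : 1 < α)
    (hG : GoodCenter (phaseInput n δ lam (flog n ^ 2)) (Z (flog n ^ 2)) η) {l : ℕ} (hl : l ≤ L₀)
    (hlx : lam * (d : ℝ) ^ (1 / 2 : ℝ) * 2 ^ (-(l : ℝ)) < |η x - 1 / 2|) :
    x ∈ (phaseInput n δ lam (flog n ^ 2)).loopLabelled (Z (flog n ^ 2)) (bayes η x) := by
  have hf := h.flog_pos
  have h1 : 1 ≤ flog n ^ 2 := Nat.one_le_pow _ _ hf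
  have hP := h.validInput h1
  have ha : (phaseInput n δ lam (flog n ^ 2)).α = 1 := by
    have : (0 : ℝ) < flog n := by exact_mod_cast hf
    simp only [phaseInput]; push_cast; field_simp
  have hlam : 0 < lam := by linarith [h.one_le_lam]
  have hd0 : (0 : ℝ) < d := by exact_mod_cast hd
  set P := phaseInput n δ lam (flog n ^ 2) with hPdef
  have hη' : HolderClass P.lam α η := hη
  have hPα : P.α ≤ α := by rw [ha]; exact hα1.le
  have hB : ∀ m : ℕ, centerB P d m = lam * (d : ℝ) ^ (1 / 2 : ℝ) * 2 ^ (-(m : ℝ)) := by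
    intro m; rw [centerB_eq, ha, min_self, mul_one]; rfl
  have hpow : (2 : ℝ) ^ (-(L₀ : ℝ)) ≤ 2 ^ (-(l : ℝ)) :=
    Real.rpow_le_rpow_of_exponent_le (by norm_num) (by
      have : (l : ℝ) ≤ L₀ := by exact_mod_cast hl
      linarith)
  -- Three further levels suffice: an open cell of depth L₀ + 3 has |η - 1/2| ≤ 6 · 2^{-3} λ √d
  -- 2^{-L₀}, and 6/8 < 1.
  rcases le_or_gt (L₀ + 3) (P.finalDepth (Z (flog n ^ 2))) with hL | hL
  · rcases mem_loopLabelled_or hη' hP hPα hG hx _ hL with h2 | h2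
    · exact h2.1
    · exfalso
      have h3 := abs_sub_half_le_of_mem_active hη' hP hPα hd hG hx (by omega) h2
      rw [hB] at h3
      have e : (2 : ℝ) ^ (-((L₀ + 3 : ℕ) : ℝ)) = 2 ^ (-(L₀ : ℝ)) / 8 := by
        push_cast
        rw [neg_add, Real.rpow_add (by norm_num), Real.rpow_neg (x := 2) (y := 3) (by norm_num)]
        norm_num [div_eq_mul_inv]
      rw [e] at h3
      have h5 : 0 < lam * (d : ℝ) ^ (1 / 2 : ℝ) := by positivity
      have h6 : (0 : ℝ) < 2 ^ (-(L₀ : ℝ)) := by positivity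
      nlinarith
  · rcases mem_loopLabelled_or hη' hP hPα hG hx _ le_rfl with h2 | h2
    · exact h2.1
    · exfalso
      rcases active_eq_empty_or_budget hP hd (Z := Z (flog n ^ 2)) with h3 | h3
      · rw [h3] at h2; simp at h2
      · rcases h.resolution_le hd h1 hPα h3 with h4 | ⟨h4, -⟩
        · exact h.not_one_le hη hxE h4
        -- Running out of budget before depth L₀ + 3 would force |η x - 1/2| > λ ≥ 1; the summand
        -- 2^{α(L₀+3)} of `marginConst` is there for this.
        · have h5 := h.const_mul_lt hxE (c := 2 ^ (α * (L₀ + 3))) (by positivity)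
            (by linarith [one_le_coverConst d α]) h4
          have h6 : (1 : ℝ) ≤ 2 ^ (α * (L₀ + 3)) *
              2 ^ (-(α * P.finalDepth (Z (flog n ^ 2)))) := by
            rw [← Real.rpow_add (by norm_num)]
            refine Real.one_le_rpow (by norm_num) ?_
            have : (P.finalDepth (Z (flog n ^ 2)) : ℝ) ≤ L₀ + 3 := by exact_mod_cast hL.le
            nlinarith [h.α_pos]
          have h7 := h.one_le_lam
          have h8 := hη.abs_sub_half_le x
          nlinarith

/-- If a phase proposes a wrong label, then the phase with smoothness parameter `1` precedes it and
proposes the right one. -/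
lemma ValidParams.mem_output_of_mem_output_not {L₀ : ℕ} {Z : ℕ → Tape d} (h : ValidParams α n δ lam)
    (hd : 0 < d) (hη : HolderClass lam α η) (hx : x ∈ unitCube d)
    (hxE : marginConst d α L₀ * rate d α n δ lam < |η x - 1 / 2|)
    (hL₀ : 1 < α → biasConst d α ≤ (2 : ℝ) ^ ((L₀ : ℝ) * (α - 1)))
    (hgood : ∀ i, 1 ≤ i → (phaseInput n δ lam i).α ≤ α →
      GoodCenter (phaseInput n δ lam i) (Z i) η ∧ GoodKernel (phaseInput n δ lam i) (Z i) η)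
    {i : ℕ} (hi : 1 ≤ i) (hiα : (phaseInput n δ lam i).α ≤ α)
    (hxi : x ∈ (phaseInput n δ lam i).output (Z i) (!bayes η x)) :
    ∃ j, 1 ≤ j ∧ j < i ∧ x ∈ (phaseInput n δ lam j).output (Z j) (bayes η x) := by
  have hf := h.flog_pos
  have hf0 : (0 : ℝ) < flog n := by exact_mod_cast hf
  have hP := h.validInput hi
  obtain ⟨hG, hK⟩ := hgood i hi hiα
  have hlam : 0 < lam := by linarith [h.one_le_lam]
  have hd1 : (1 : ℝ) ≤ d := by exact_mod_cast hd
  rcases hxi with hxi | hxi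
  · have := bayes_of_mem_loopLabelled (α := α) hη hP hiα hG hxi
    simp at this
  obtain ⟨ha1, -, -, hle⟩ := abs_sub_half_le_of_mem_kernelLabelled (α := α) hη hP hiα hd hK hxi
  replace hle := hle (by simp)
  have hα1 : 1 < α := ha1.trans_le hiα
  -- The kernel step runs only for parameters above 1, hence strictly after the phase of index ⌊log
  -- n⌋², whose parameter is 1.
  have h1i : flog n ^ 2 < i := by
    have : (1 : ℝ) < (i : ℝ) / (flog n : ℝ) ^ 2 := ha1
    rw [one_lt_div (by positivity)] at this
    exact_mod_cast this
  have h1 : 1 ≤ flog n ^ 2 := Nat.one_le_pow _ _ hf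
  have hle' : |η x - 1 / 2| ≤ biasConst d α *
      (lam * 2 ^ (-(α * (phaseInput n δ lam i).finalDepth (Z i)))) := by
    rw [← mul_assoc]; exact hle
  refine ⟨flog n ^ 2, h1, h1i, Or.inl ?_⟩
  -- If no cell stayed active, the loop of this phase also labelled x, correctly, at some depth l.
  -- Its lower bound on |η x - 1/2| and the upper bound from the wrong kernel label are compatible
  -- only for l ≤ L₀.
  rcases active_eq_empty_or_budget hP hd (Z := Z i) with h2 | h2
  · rcases mem_loopLabelled_or (α := α) hη hP hiα hG hx _ le_rfl with ⟨-, l, hl, hlt⟩ | h3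
    swap
    · rw [h2] at h3; simp at h3
    rw [centerB_eq, min_eq_right ha1.le, mul_one] at hlt
    have hlt' : lam * (d : ℝ) ^ (1 / 2 : ℝ) * 2 ^ (-(l : ℝ)) < |η x - 1 / 2| := hlt
    refine h.mem_loopLabelled_one hd hη hx hxE hα1 (hgood _ h1 ?_).1 (l := l) ?_ hlt'
    · refine le_trans (le_of_eq ?_) hα1.le
      simp only [phaseInput]; push_cast; field_simp
    · by_contra hcon
      have hlL : (l : ℝ) ≤ (phaseInput n δ lam i).finalDepth (Z i) := by
        exact_mod_cast (Finset.mem_Icc.1 hl).2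
      set L := (phaseInput n δ lam i).finalDepth (Z i)
      have hL₀L : (L₀ : ℝ) ≤ L := by
        have : (L₀ : ℝ) < l := by exact_mod_cast not_le.1 hcon
        linarith
      have h4 : biasConst d α ≤ (2 : ℝ) ^ ((L : ℝ) * (α - 1)) :=
        (hL₀ hα1).trans (Real.rpow_le_rpow_of_exponent_le (by norm_num) (by nlinarith))
      have h5 : biasConst d α * (lam * 2 ^ (-(α * L))) ≤ lam * 2 ^ (-(L : ℝ)) := by
        calc _ ≤ (2 : ℝ) ^ ((L : ℝ) * (α - 1)) * (lam * 2 ^ (-(α * L))) := by gcongr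
          _ = lam * ((2 : ℝ) ^ ((L : ℝ) * (α - 1)) * 2 ^ (-(α * L))) := by ring
          _ = _ := by rw [← Real.rpow_add (by norm_num)]; congr 2; ring
      have h6 : (2 : ℝ) ^ (-(L : ℝ)) ≤ 2 ^ (-(l : ℝ)) :=
        Real.rpow_le_rpow_of_exponent_le (by norm_num) (by linarith)
      have h7 : (1 : ℝ) ≤ (d : ℝ) ^ (1 / 2 : ℝ) := Real.one_le_rpow hd1 (by norm_num)
      have h8 : lam * 2 ^ (-(L : ℝ)) ≤ lam * (d : ℝ) ^ (1 / 2 : ℝ) * 2 ^ (-(l : ℝ)) := by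
        calc lam * 2 ^ (-(L : ℝ)) = lam * 1 * 2 ^ (-(L : ℝ)) := by ring
          _ ≤ _ := by gcongr
      linarith
  -- If the budget ran out, the band where the kernel step can err lies below E.
  · exfalso
    rcases h.resolution_le hd hi hiα h2 with h3 | ⟨h3, -⟩
    · exact h.not_one_le hη hxE h3
    · have h4 := h.const_mul_lt hxE (biasConst_nonneg d α) (by
        have := biasConst_le_coverConst d α
        have : (0 : ℝ) < 2 ^ (α * (L₀ + 3)) := by positivity
        linarith) h3
      linarith

/-- On the event that all estimates are accurate, the adaptive classifier agrees with the Bayes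
classifier away from the decision boundary. -/
lemma ValidParams.adaptiveClassifier_eq {L₀ : ℕ} {Z : ℕ → Tape d} (h : ValidParams α n δ lam)
    (hd : 0 < d) (hη : HolderClass lam α η) (hx : x ∈ unitCube d)
    (hxE : marginConst d α L₀ * rate d α n δ lam < |η x - 1 / 2|)
    (hL₀ : 1 < α → biasConst d α ≤ (2 : ℝ) ^ ((L₀ : ℝ) * (α - 1)))
    (hgood : ∀ i, 1 ≤ i → (phaseInput n δ lam i).α ≤ α →
      GoodCenter (phaseInput n δ lam i) (Z i) η ∧ GoodKernel (phaseInput n δ lam i) (Z i) η) :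
    adaptiveClassifier n δ lam Z x = bayes η x := by
  have hα := h.α_pos
  have hf := h.flog_pos
  have hf0 : (0 : ℝ) < flog n := by exact_mod_cast hf
  have hf1 := h.one_le_flog
  -- Phase m has the largest parameter not exceeding α. The assumed range of α is what gives 1 ≤ m ≤
  -- ⌊log n⌋³.
  set m := ⌊α * (flog n : ℝ) ^ 2⌋₊ with hm
  have hαf : 1 ≤ α * flog n := by
    have := h.inv_le
    rwa [div_le_iff₀ hf0] at this
  have h1 : 1 ≤ α * (flog n : ℝ) ^ 2 := by nlinarith
  have hm1 : 1 ≤ m := Nat.le_floor (by exact_mod_cast h1)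
  have hmle : (m : ℝ) ≤ α * (flog n : ℝ) ^ 2 := Nat.floor_le (by positivity)
  have hmlt : α * (flog n : ℝ) ^ 2 < m + 1 := Nat.lt_floor_add_one _
  have hm3 : m ≤ flog n ^ 3 := by
    have : (m : ℝ) ≤ (flog n : ℝ) ^ 3 := by
      refine hmle.trans ?_
      rw [pow_succ' _ 2]
      exact mul_le_mul_of_nonneg_right h.le_flog (by positivity)
    exact_mod_cast this
  have hle : ∀ i ≤ m, (phaseInput n δ lam i).α ≤ α := by
    intro i hi
    have : (i : ℝ) ≤ m := by exact_mod_cast hi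
    simp only [phaseInput]
    rw [div_le_iff₀ (by positivity)]
    linarith
  have hnot : x ∉ aggregate n δ lam Z m (!bayes η x) :=
    not_mem_aggregate_not fun i hi him hxi =>
      h.mem_output_of_mem_output_not hd hη hx hxE hL₀ hgood hi (hle i him) hxi
  have hmem : x ∈ aggregate n δ lam Z m (bayes η x) := by
    obtain ⟨k, hk⟩ : ∃ k, m = k + 1 := ⟨m - 1, by omega⟩
    have hP := h.validInput hm1
    obtain ⟨hG, hK⟩ := hgood m hm1 (hle m le_rfl)
    have hout : ∃ y, x ∈ (phaseInput n δ lam m).output (Z m) y := by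
      rcases active_eq_empty_or_budget hP hd (Z := Z m) with h2 | h2
      · rcases mem_loopLabelled_or (α := α) hη hP (hle m le_rfl) hG hx _ le_rfl with h3 | h3
        · exact ⟨_, Or.inl h3.1⟩
        · rw [h2] at h3; simp at h3
      · rcases mem_output_or (α := α) hη hP (hle m le_rfl) hd hG hK hx with h3 | h3
        · exact h3
        · exfalso
          rcases h.resolution_le hd hm1 (hle m le_rfl) h2 with h4 | ⟨-, h4⟩
          · exact h.not_one_le hη hxE h4
          -- As m ≥ 1, one has α ⌊log n⌋² < m + 1 ≤ 2m, so the parameter of phase m is at least α/2.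
          · have h5 := h4 (by
              have hm1' : (1 : ℝ) ≤ m := by exact_mod_cast hm1
              simp only [phaseInput]
              rw [le_div_iff₀ (by positivity)]
              linarith) (by
              simp only [phaseInput]
              rw [← add_div, le_div_iff₀ (by positivity)]
              exact hmlt.le)
            have h6 := h.const_mul_lt hxE
              (zero_le_one.trans (one_le_coverConst d α)) (by
                have : (0 : ℝ) < 2 ^ (α * (L₀ + 3)) := by positivity
                linarith) h5
            have h7 : |η x - 1 / 2| ≤ coverConst d α * (lam * 2 ^
              (-((phaseInput n δ lam m).α * (phaseInput n δ lam m).finalDepth (Z m)))) := by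
              rw [← mul_assoc]; exact h3
            linarith
    obtain ⟨y, hy⟩ := hout
    have h3 : x ∈ aggregate n δ lam Z m y ∨ x ∈ aggregate n δ lam Z m (!y) := by
      rw [hk] at hy ⊢
      exact mem_or_mem_aggregate_of_mem_output hy
    cases y <;> cases hb : bayes η x <;> simp_all
  have hmem3 := aggregate_mono hm3 hmem
  have hnot3 := not_mem_aggregate_of_le hm3 hmem hnot
  unfold adaptiveClassifier
  cases hb : bayes η x <;> rw [hb] at hmem3 hnot3 <;> simpa using by assumption

end Aggregation

/-! ### From pointwise agreement with the Bayes classifier to the excess risk. -/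

section Risk

variable {d : ℕ} {η : Pt d → ℝ} {PX : Measure (Pt d)} {f : Pt d → Bool}

lemma measurable_bayes (hη : Measurable η) : Measurable (bayes η) := by
  refine measurable_to_bool ?_
  have : bayes η ⁻¹' {true} = {x | 1 / 2 ≤ η x} := by ext x; simp [bayes]
  rw [this]
  exact measurableSet_le measurable_const hη

/-- The conditional probability of a misclassification given the feature. -/
def condRisk (η : Pt d → ℝ) (f : Pt d → Bool) (x : Pt d) : ℝ :=
  if f x = true then 1 - η x else η x

lemma measurable_condRisk (hη : Measurable η) (hf : Measurable f) : Measurable (condRisk η f) :=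
  Measurable.ite (hf (measurableSet_singleton true)) (measurable_const.sub hη) hη

lemma condRisk_mem_Icc (h01 : ∀ x, η x ∈ Set.Icc (0 : ℝ) 1) (x : Pt d) :
    condRisk η f x ∈ Set.Icc (0 : ℝ) 1 := by
  have := h01 x
  rw [condRisk]
  split_ifs
  · exact ⟨by linarith [this.2], by linarith [this.1]⟩
  · exact this

lemma integrable_condRisk [IsFiniteMeasure PX] (hη : Measurable η)
    (h01 : ∀ x, η x ∈ Set.Icc (0 : ℝ) 1) (hf : Measurable f) : Integrable (condRisk η f) PX :=
  Integrable.of_bound (measurable_condRisk hη hf).aestronglyMeasurable 1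
    (Filter.Eventually.of_forall fun x => by
      rw [Real.norm_eq_abs, abs_of_nonneg (condRisk_mem_Icc h01 x).1]
      exact (condRisk_mem_Icc h01 x).2)

lemma risk_eq_integral (hη : Measurable η)
    (h01 : ∀ x, η x ∈ Set.Icc (0 : ℝ) 1) (hf : Measurable f) :
    risk η PX f = ∫ x, condRisk η f x ∂PX := by
  have mt : Measurable fun x : Pt d => (x, true) := by fun_prop
  have mf : Measurable fun x : Pt d => (x, false) := by fun_prop
  have hT : MeasurableSet {x | f x = true} := hf (measurableSet_singleton true)
  have hS : MeasurableSet {p : Pt d × Bool | p.2 ≠ f p.1} :=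
    (measurableSet_eq_fun measurable_snd (hf.comp measurable_fst)).compl
  have et : (fun x : Pt d => (x, true)) ⁻¹' {p : Pt d × Bool | p.2 ≠ f p.1} =
      {x | f x = true}ᶜ := by
    ext x; cases h : f x <;> simp [h]
  have ef : (fun x : Pt d => (x, false)) ⁻¹' {p : Pt d × Bool | p.2 ≠ f p.1} =
      {x | f x = true} := by
    ext x; cases h : f x <;> simp [h]
  rw [integral_eq_lintegral_of_nonneg_ae
    (Filter.Eventually.of_forall fun x => (condRisk_mem_Icc h01 x).1)
    (measurable_condRisk hη hf).aestronglyMeasurable, risk, Measure.real, pairLaw,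
    Measure.add_apply, Measure.map_apply mt hS, Measure.map_apply mf hS, et, ef,
    withDensity_apply _ hT, withDensity_apply _ hT.compl]
  congr 1
  rw [← lintegral_add_compl (fun x => ENNReal.ofReal (condRisk η f x)) hT, add_comm]
  congr 1
  · refine setLIntegral_congr_fun hT fun x hx => ?_
    have hx' : f x = true := hx
    simp only [condRisk, if_pos hx']
  · refine setLIntegral_congr_fun hT.compl fun x hx => ?_
    have hx' : ¬ f x = true := hx
    simp only [condRisk, if_neg hx']

/-- A disagreement costs |2η - 1|, at most 2E, and occurs only where |η - 1/2| ≤ E. -/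
lemma condRisk_sub_bayes_le {E : ℝ} (x : Pt d)
    (hfx : E < |η x - 1 / 2| → f x = bayes η x) :
    condRisk η f x - condRisk η (bayes η) x ≤
      {x | |η x - 1 / 2| ≤ E}.indicator (fun _ => 2 * E) x := by
  by_cases hx : |η x - 1 / 2| ≤ E
  · rw [Set.indicator_of_mem (show x ∈ {x | |η x - 1 / 2| ≤ E} from hx)]
    obtain ⟨h1, h2⟩ := abs_le.1 hx
    unfold condRisk
    split_ifs <;> linarith
  · rw [Set.indicator_of_notMem (show x ∉ {x | |η x - 1 / 2| ≤ E} from hx), condRisk, condRisk,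
      hfx (not_le.1 hx), sub_self]

variable {α β Δ₀ lam c₃ E : ℝ}

lemma ProblemClass.excessRisk_eq (h : ProblemClass α β Δ₀ lam c₃ η PX) (hα : 0 < α)
    (hf : Measurable f) :
    excessRisk η PX f = ∫ x, (condRisk η f x - condRisk η (bayes η) x) ∂PX := by
  have := h.prob
  have hη := (h.smooth.continuous hα).measurable
  have hb := measurable_bayes hη
  rw [excessRisk, risk_eq_integral hη h.smooth.1 hf, risk_eq_integral hη h.smooth.1 hb,
    integral_sub (integrable_condRisk hη h.smooth.1 hf) (integrable_condRisk hη h.smooth.1 hb)]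

/-- The excess risk of a classifier that agrees with the Bayes classifier where the regression
function is away from `1/2`. -/
lemma ProblemClass.excessRisk_le (h : ProblemClass α β Δ₀ lam c₃ η PX) (hα : 0 < α) (hΔ : 0 ≤ Δ₀)
    (hf : Measurable f) (hE : 0 < E)
    (hfE : ∀ x ∈ unitCube d, E < |η x - 1 / 2| → f x = bayes η x) :
    excessRisk η PX f ≤ 2 * c₃ * E ^ (β + 1) := by
  have := h.prob
  have hη := (h.smooth.continuous hα).measurable
  have hb := measurable_bayes hη
  have hcube : ∀ᵐ x ∂PX, x ∈ unitCube d := h.support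
  have hm : MeasurableSet {x | |η x - 1 / 2| ≤ E} :=
    measurableSet_le ((hη.sub_const _).abs) measurable_const
  rw [h.excessRisk_eq hα hf]
  calc _ ≤ ∫ x, {x | |η x - 1 / 2| ≤ E}.indicator (fun _ => 2 * E) x ∂PX := by
        refine integral_mono_ae ((integrable_condRisk hη h.smooth.1 hf).sub
          (integrable_condRisk hη h.smooth.1 hb)) ((integrable_const _).indicator hm) ?_
        filter_upwards [hcube] with x hx using condRisk_sub_bayes_le x (hfE x hx)
    _ = PX.real {x | |η x - 1 / 2| ≤ E} * (2 * E) := by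
        rw [integral_indicator_const _ hm, smul_eq_mul]
    _ ≤ PX.real {x | |η x - 1 / 2| ≤ Δ₀ + E} * (2 * E) := by
        gcongr
        · exact measure_ne_top _ _
        · linarith
    _ ≤ c₃ * E ^ β * (2 * E) := by
        gcongr
        exact h.margin.2 E hE
    _ = _ := by rw [Real.rpow_add_one hE.ne']; ring

lemma ProblemClass.excessRisk_eq_zero (h : ProblemClass α β Δ₀ lam c₃ η PX) (hα : 0 < α)
    (hf : Measurable f) (hE : E < Δ₀)
    (hfE : ∀ x ∈ unitCube d, E < |η x - 1 / 2| → f x = bayes η x) :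
    excessRisk η PX f = 0 := by
  have hcube : ∀ᵐ x ∂PX, x ∈ unitCube d := h.support
  have hmargin : ∀ᵐ x ∂PX, x ∉ {x | |η x - 1 / 2| < Δ₀} := measure_eq_zero_iff_ae_notMem.1 h.margin.1
  rw [h.excessRisk_eq hα hf]
  refine integral_eq_zero_of_ae ?_
  filter_upwards [hcube, hmargin] with x hx hx2
  have h1 : Δ₀ ≤ |η x - 1 / 2| := not_lt.1 hx2
  rw [condRisk, condRisk, hfE x hx (hE.trans_le h1), sub_self, Pi.zero_apply]

end Risk

/-! ### Measurability of the classifier in the feature, for a fixed tape. -/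

section Measurability

variable {d : ℕ}

lemma SubInput.measurableSet_loopLabelled (P : SubInput) (Z : Tape d) (y : Bool) :
    MeasurableSet (P.loopLabelled Z y) := by
  have : P.loopLabelled Z y = ⋃ l ∈ Finset.Icc 1 (P.finalDepth Z), ⋃ c ∈ P.active Z l,
      ({x | x ∈ cell l c} ∩ {_x | P.threshold d l < |P.etaHat Z l c - 1 / 2| ∧
        y = decide (1 / 2 ≤ P.etaHat Z l c)}) := by
    ext x
    simp only [SubInput.loopLabelled, Set.mem_ofPred_eq, Set.mem_iUnion, Set.mem_inter_iff,
      exists_prop]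
  rw [this]
  exact Finset.measurableSet_biUnion _ fun l _ => Finset.measurableSet_biUnion _ fun c _ =>
    (measurableSet_cell l c).inter (MeasurableSet.const _)

lemma SubInput.measurableSet_kernelLabelled (P : SubInput) (Z : Tape d) (y : Bool) :
    MeasurableSet (P.kernelLabelled Z y) := by
  set L := P.finalDepth Z with hL
  set m := ⌊(L : ℝ) * P.α⌋₊ with hm
  have : P.kernelLabelled Z y = ⋃ c ∈ P.active Z L, ⋃ c' ∈ grid d m, (cell m c' ∩
      {_x | 1 < P.α ∧ cell (d := d) m c' ⊆ cell L c ∧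
        (4 : ℝ) ^ (d + 1) * P.lam * (2 : ℝ) ^ (-(P.α * (L : ℝ))) <
          (if y = true then 1 else -1) * (P.kernelEstimate Z L c (center m c') - 1 / 2)}) := by
    ext x
    simp only [SubInput.kernelLabelled, Set.mem_ofPred_eq, Set.mem_iUnion, Set.mem_inter_iff,
      exists_prop]
    tauto
  rw [this]
  exact Finset.measurableSet_biUnion _ fun c _ => Finset.measurableSet_biUnion _ fun c' _ =>
    (measurableSet_cell m c').inter (MeasurableSet.const _)

lemma measurableSet_aggregate (n : ℕ) (δ lam : ℝ) (Z : ℕ → Tape d) (i : ℕ) (y : Bool) :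
    MeasurableSet (aggregate n δ lam Z i y) := by
  induction i generalizing y with
  | zero => exact MeasurableSet.empty
  | succ i ih =>
    exact (ih y).union ((((phaseInput n δ lam (i + 1)).measurableSet_loopLabelled _ y).union
      ((phaseInput n δ lam (i + 1)).measurableSet_kernelLabelled _ y)).diff (ih _))

lemma measurable_adaptiveClassifier (n : ℕ) (δ lam : ℝ) (Z : ℕ → Tape d) :
    Measurable (adaptiveClassifier n δ lam Z) := by
  refine measurable_to_bool ?_
  have : adaptiveClassifier n δ lam Z ⁻¹' {true} = aggregate n δ lam Z (flog n ^ 3) true := by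
    ext x; simp [adaptiveClassifier]
  rw [this]
  exact measurableSet_aggregate _ _ _ _ _ _

end Measurability

/-! ### Total budget, total failure probability and the zero-risk regime. -/

section UpperBound

variable {d n : ℕ} {α β δ lam Δ₀ : ℝ} {η : Pt d → ℝ}

lemma ValidParams.totalRequests_le (h : ValidParams α n δ lam) (Z : ℕ → Tape d) :
    totalRequests n δ lam Z ≤ n := by
  have hf : (0 : ℝ) < flog n := by linarith [h.one_le_flog]
  have hn : (0 : ℝ) ≤ n / (flog n : ℝ) ^ 3 := by positivity
  have : (totalRequests n δ lam Z : ℝ) ≤ n := by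
    rw [totalRequests, Nat.cast_sum]
    calc _ ≤ ∑ _i ∈ Finset.Icc 1 (flog n ^ 3), (n : ℝ) / (flog n : ℝ) ^ 3 :=
          Finset.sum_le_sum fun i _ => requests_le (phaseInput n δ lam i) (Z i) hn
      _ = n := by
          rw [Finset.sum_const, Nat.card_Icc, Nat.add_sub_cancel, nsmul_eq_mul]
          push_cast; field_simp
  exact_mod_cast this

/-- Two events per phase, each failing with probability at most 2δ/⌊log n⌋³, over ⌊log n⌋³ phases. A
parameter a ≤ α ≤ ⌊log n⌋ keeps the index of the phase in that range. -/
lemma ValidParams.measure_not_good_le (h : ValidParams α n δ lam) (hd : 0 < d)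
    (hη : Measurable η) (h01 : ∀ x, η x ∈ Set.Icc (0 : ℝ) 1) {Ω : Type*} [MeasurableSpace Ω]
    {μ : Measure Ω} [IsProbabilityMeasure μ] {Z : ℕ × Query d → Ω → Pt d × Bool}
    (hZ : IsSampling μ η Z) :
    μ {ω | ¬ ∀ i, 1 ≤ i → (phaseInput n δ lam i).α ≤ α →
      GoodCenter (phaseInput n δ lam i) (fun q => Z (i, q) ω) η ∧
      GoodKernel (phaseInput n δ lam i) (fun q => Z (i, q) ω) η} ≤ ENNReal.ofReal (4 * δ) := by
  have hf : (0 : ℝ) < flog n := by linarith [h.one_le_flog]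
  have hδ := h.δ_pos
  have hsub : {ω | ¬ ∀ i, 1 ≤ i → (phaseInput n δ lam i).α ≤ α →
      GoodCenter (phaseInput n δ lam i) (fun q => Z (i, q) ω) η ∧
      GoodKernel (phaseInput n δ lam i) (fun q => Z (i, q) ω) η} ⊆
      ⋃ i ∈ Finset.Icc 1 (flog n ^ 3),
        ({ω | ¬ GoodCenter (phaseInput n δ lam i) (fun q => Z (i, q) ω) η} ∪
          {ω | ¬ GoodKernel (phaseInput n δ lam i) (fun q => Z (i, q) ω) η}) := by
    intro ω hω
    have hω' : ¬ ∀ i, 1 ≤ i → (phaseInput n δ lam i).α ≤ α →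
      GoodCenter (phaseInput n δ lam i) (fun q => Z (i, q) ω) η ∧
      GoodKernel (phaseInput n δ lam i) (fun q => Z (i, q) ω) η := hω
    push Not at hω'
    obtain ⟨i, hi, hiα, hbad⟩ := hω'
    have hi3 : i ≤ flog n ^ 3 := by
      have h1 : (i : ℝ) / (flog n : ℝ) ^ 2 ≤ flog n := hiα.trans h.le_flog
      rw [div_le_iff₀ (by positivity), ← pow_succ'] at h1
      exact_mod_cast h1
    refine Set.mem_biUnion (Finset.mem_coe.2 (Finset.mem_Icc.2 ⟨hi, hi3⟩)) ?_
    by_cases hc : GoodCenter (phaseInput n δ lam i) (fun q => Z (i, q) ω) η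
    · exact Or.inr (hbad hc)
    · exact Or.inl hc
  have hδ3 : 0 ≤ δ / (flog n : ℝ) ^ 3 := by positivity
  calc _ ≤ _ := measure_mono hsub
    _ ≤ ∑ i ∈ Finset.Icc 1 (flog n ^ 3), _ := measure_biUnion_finset_le _ _
    _ ≤ ∑ _i ∈ Finset.Icc 1 (flog n ^ 3), ENNReal.ofReal (4 * (δ / (flog n : ℝ) ^ 3)) := by
        refine Finset.sum_le_sum fun i hi => (measure_union_le _ _).trans ?_
        have hP := h.validInput (Finset.mem_Icc.1 hi).1
        refine (add_le_add (hZ.measure_not_goodCenter_le hP hd hη h01 i)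
          (hZ.measure_not_goodKernel_le hP hd hη h01 i)).trans (le_of_eq ?_)
        have : (phaseInput n δ lam i).δ = δ / (flog n : ℝ) ^ 3 := rfl
        rw [this, ← ENNReal.ofReal_add (by linarith) (by linarith)]
        congr 1; ring
    _ = ENNReal.ofReal (4 * δ) := by
        rw [Finset.sum_const, Nat.card_Icc, Nat.add_sub_cancel, ← ENNReal.ofReal_nsmul,
          nsmul_eq_mul]
        congr 1
        push_cast; field_simp

lemma ValidParams.rate_rpow (h : ValidParams α n δ lam) (s : ℝ) :
    rate d α n δ lam ^ s = lam ^ (d / (2 * α + d) * s) *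
      (Real.log n ^ 3 * Real.log (lam * n / δ) / n) ^ (α / (2 * α + d) * s) := by
  have h1 := h.one_le_logs
  have h2 := h.n_pos
  have h3 : 0 ≤ lam := by linarith [h.one_le_lam]
  rw [rate, Real.mul_rpow (by positivity) (by positivity), Real.rpow_mul h3,
    Real.rpow_mul (by positivity)]

/-- The power (2α + d)/α makes the rate linear in 1/n. The factor 2 pays for ⌊log³ n⌋, which is at
least half of log³ n. -/
lemma ValidParams.mul_rate_lt (h : ValidParams α n δ lam) {C : ℝ} (hC : 0 < C) (hΔ : 0 < Δ₀)
    (hn : 2 * C ^ ((2 * α + d) / α) * lam ^ (d / α) * Real.log (lam * n / δ) *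
      (1 / Δ₀) ^ ((2 * α + d) / α) < n / (⌊Real.log n ^ 3⌋₊ : ℝ)) :
    C * rate d α n δ lam < Δ₀ := by
  have hα := h.α_pos
  have hn0 := h.n_pos
  have hl := h.one_le_log
  have hlam : 0 < lam := by linarith [h.one_le_lam]
  have hr := h.rate_pos (d := d)
  have hl3 : 1 ≤ Real.log n ^ 3 := one_le_pow₀ hl
  have hfl : Real.log n ^ 3 / 2 ≤ (⌊Real.log n ^ 3⌋₊ : ℝ) := by
    have h1 : Real.log n ^ 3 < ⌊Real.log n ^ 3⌋₊ + 1 := Nat.lt_floor_add_one _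
    have h2 : (1 : ℝ) ≤ (⌊Real.log n ^ 3⌋₊ : ℝ) := by
      exact_mod_cast Nat.le_floor (by exact_mod_cast hl3)
    linarith
  have he : 0 < (2 * α + d) / α := by positivity
  have hn' := hn.trans_le (div_le_div_of_nonneg_left hn0.le (by positivity) hfl)
  rw [← Real.rpow_lt_rpow_iff (by positivity) hΔ.le he, Real.mul_rpow hC.le hr.le, h.rate_rpow]
  have e1 : (d : ℝ) / (2 * α + d) * ((2 * α + d) / α) = d / α := by field_simp
  have e2 : α / (2 * α + d) * ((2 * α + d) / α) = 1 := by field_simp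
  rw [e1, e2, Real.rpow_one]
  rw [one_div, Real.inv_rpow hΔ.le, lt_div_iff₀ (by positivity)] at hn'
  have hD : 0 < Δ₀ ^ ((2 * α + d) / α) := by positivity
  rw [← sub_pos] at hn' ⊢
  have : 0 < Δ₀ ^ ((2 * α + d) / α) / (n : ℝ) := by positivity
  refine lt_of_lt_of_eq (mul_pos this hn') ?_
  field_simp

end UpperBound
end ActiveLearning

end

/-! ### The upper bound. -/

open ActiveLearning MeasureTheory in
theorem mainTheorem3 (d : ℕ) (hd : 0 < d) (α β c₃ : ℝ) (hα : 0 < α) (hβ : 0 ≤ β) (hc₃ : 0 ≤ c₃) :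
    ∃ C₁ > (0 : ℝ), ∃ C₂ > (0 : ℝ),
      ∀ (n : ℕ) (δ lam Δ₀ : ℝ), 0 < n → 0 < δ → δ < 1 → 1 ≤ lam → 0 ≤ Δ₀ →
      1 / (⌊Real.log n⌋₊ : ℝ) ≤ α → α ≤ (⌊Real.log n⌋₊ : ℝ) →
      ∀ (η : Pt d → ℝ) (PX : Measure (Pt d)), ProblemClass α β Δ₀ lam c₃ η PX →
      ∀ {Ω : Type*} [MeasurableSpace Ω] (μ : Measure Ω) [IsProbabilityMeasure μ]
        (Z : ℕ × Query d → Ω → Pt d × Bool), IsSampling μ η Z →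
      (∀ ω, totalRequests n δ lam (fun i q => Z (i, q) ω) ≤ n) ∧
      ENNReal.ofReal (1 - 8 * δ) ≤ μ {ω |
        excessRisk η PX (adaptiveClassifier n δ lam fun i q => Z (i, q) ω) ≤
          C₁ * lam ^ (d * (β + 1) / (2 * α + d)) *
            (Real.log n ^ 3 * Real.log (lam * n / δ) / n) ^ (α * (β + 1) / (2 * α + d)) ∧
        (0 < Δ₀ →
          C₂ * lam ^ (d / α) * Real.log (lam * n / δ) * (1 / Δ₀) ^ ((2 * α + d) / α) <
            n / (⌊Real.log n ^ 3⌋₊ : ℝ) →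
          excessRisk η PX (adaptiveClassifier n δ lam fun i q => Z (i, q) ω) = 0)} := by
  obtain ⟨L₀, hL₀⟩ := exists_depth d α
  have hC : 0 < marginConst d α L₀ := zero_lt_one.trans_le (one_le_marginConst hα L₀)
  -- The summand 1 keeps C₁ positive when c₃ = 0.
  refine ⟨2 * c₃ * marginConst d α L₀ ^ (β + 1) + 1, by positivity,
    2 * marginConst d α L₀ ^ ((2 * α + d) / α), by positivity, ?_⟩
  intro n δ lam Δ₀ _ hδ hδ1 hlam hΔ hα1 hα2 η PX hclass Ω _ μ _ Z hZ
  have h : ValidParams α n δ lam := by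
    refine ⟨hα, hδ, hδ1, hlam, ?_, hα1, hα2⟩
    have : (0 : ℝ) < flog n := hα.trans_le hα2
    exact_mod_cast this
  have hr := h.rate_pos (d := d)
  refine ⟨fun ω => h.totalRequests_le _, ?_⟩
  have hbad := h.measure_not_good_le hd (hclass.smooth.continuous hα).measurable hclass.smooth.1 hZ
  -- The argument loses only 4δ; the other 4δ are slack.
  rw [show (1 : ℝ) - 8 * δ = 1 - 4 * δ - 4 * δ by ring]
  refine (ENNReal.ofReal_le_ofReal (show 1 - 4 * δ - 4 * δ ≤ 1 - 4 * δ by linarith)).trans ?_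
  rw [ENNReal.ofReal_sub _ (by positivity), ENNReal.ofReal_one, tsub_le_iff_right]
  refine le_trans ?_ (add_le_add_right hbad _)
  -- The event need not be measurable in ω: it covers the whole space together with the failure
  -- event, and subadditivity suffices.
  rw [← measure_univ (μ := μ)]
  refine (measure_mono fun ω _ => ?_).trans (measure_union_le _ _)
  by_cases hω : ∀ i, 1 ≤ i → (phaseInput n δ lam i).α ≤ α →
      GoodCenter (phaseInput n δ lam i) (fun q => Z (i, q) ω) η ∧
      GoodKernel (phaseInput n δ lam i) (fun q => Z (i, q) ω) η
  swap
  · exact Or.inr hω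
  left
  have hf := measurable_adaptiveClassifier n δ lam fun i q => Z (i, q) ω
  have hfE : ∀ x ∈ unitCube d, marginConst d α L₀ * rate d α n δ lam < |η x - 1 / 2| →
      adaptiveClassifier n δ lam (fun i q => Z (i, q) ω) x = bayes η x := fun x hx hxE =>
    h.adaptiveClassifier_eq hd hclass.smooth hx hxE hL₀ hω
  refine ⟨?_, fun hΔ0 hn => hclass.excessRisk_eq_zero hα hf (h.mul_rate_lt hC hΔ0 hn) hfE⟩
  refine (hclass.excessRisk_le hα hΔ hf (by positivity) hfE).trans ?_
  rw [Real.mul_rpow hC.le hr.le, h.rate_rpow, mul_assoc (_ + 1), div_mul_eq_mul_div,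
    div_mul_eq_mul_div, ← mul_assoc]
  refine mul_le_mul_of_nonneg_right (by linarith) ?_
  have := h.one_le_logs
  positivity
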